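/- **Setting.** A *Glass network* with $n$ variables $x_1,\dots,x_n$ has, for each variable $x_i$, thresholds $\theta_i^1<\dots<\theta_i^{J_i}$. They cut $\mathbb R^n$ into open boxes, the *regions*. Each region $\mathcal O$ has a focal point $f\in\mathbb R^n$, no coordinate $f_i$ of which is a threshold of $x_i$, and the dynamics in $\mathcal O$ is $\dot y=-y+f$. (Binary networks, with $J_i=1$ for all $i$, are included.) A *cycle of regions* $\mathcal C:\mathcal O_0\to\mathcal O_1\to\dots\to\mathcal O_{k-1}\to\mathcal O_k=\mathcal O_0$, $k\ge1$, consists of regions $\mathcal O_0,\dots,\mathcal O_{k-1}$ that are pairwise distinct, such that $\mathcal O_i$ and $\mathcal O_{i+1}$ lie on the two sides of exactly one threshold $\theta_i$ of one variable $x_{m_i}$ and do not differ otherwise, and such that the coordinates $m_i$ of the focal points $f^i$ of $\mathcal O_i$ and $f^{i+1}$ of $\mathcal O_{i+1}$ are both $>\theta_i$ if $x_{m_i}$ increases from $\mathcal O_i$ to $\mathcal O_{i+1}$, and both $<\theta_i$ if it decreases. The relatively open common face $\mathcal W_i\subset\{x_{m_i}=\theta_i\}$ of $\mathcal O_i$ and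 $\mathcal O_{i+1}$ is a *wall*; on it the dynamics is $\dot y=-y+f^{i+1}$. Indices are taken modulo $k$. The cycle is a *cyclic attractor* if, for every $i$, every trajectory starting in $\mathcal O_i$ leaves $\mathcal O_i$ through $\mathcal W_i$. Its *spine* is $\mathcal S(\mathcal C)=\bigcap_i\overline{\mathcal W_i}$; $\mathcal C$ is *ideal* if $\mathcal S(\mathcal C)=\emptyset$ and *non-ideal* otherwise. A *trajectory in $\mathcal C$* is a continuous map $y:[0,T)\to\bigcup_i(\mathcal O_i\cup\mathcal W_i)$, $0<T\le\infty$, whose right derivative is given by the dynamics; it is *maximal* if it cannot be continued in $\mathcal C$ beyond $T$. A *periodic orbit* of $\mathcal C$ is the set of points of a periodic trajectory in $\mathcal C$ with $T=\infty$. It is *asymptotically stable* if it is Lyapunov stable and attracts all trajectories that start close enough to it (in particular, these exist for all $t\ge 0$). **Theorem 5.12.** Let $\mathcal C$ be a cyclic attractor in a Glass network. 1. If $\mathcal C$ is ideal, then $\mathcal C$ has a unique periodic orbit, and this orbit is asymptotically stable. 2. If $\mathcal C$ is non-ideal, then exactly one of the following holds: (a) $\mathcal C$ has a unique periodic orbit,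 and this orbit is asymptotically stable; (b) every maximal trajectory in $\mathcal C$ converges to a point of the spine $\mathcal S(\mathcal C)$ (a degenerate periodic orbit) as $t\to T$, where $T\le\infty$ is the end of its interval of existence. 3. The cases, as well as the periodic orbit, can be determined and calculated, as follows. Let $H=P_{k-1}\cdots P_1P_0$, where $P_i$ is the linear map of $\mathbb R^n\times\mathbb R$ given by $$P_i(x,s)=(x,s)+\frac{\theta_i s-x_{m_i}}{f^i_{m_i}-\theta_i}\,(f^i,1)$$ (so that $P_i(x,1)=e^{t}(x',1)$ if the trajectory starting at $x\in\mathcal W_{i-1}$ reaches $\mathcal W_i$ at the point $x'$ after the time $t$). Then $\mathcal C$ has a unique periodic orbit that is asymptotically stable if and only if $H$ has a real eigenvalue greater than $1$. Every periodic orbit $\Gamma$ of $\mathcal C$ meets the wall $\mathcal W_{k-1}$ in exactly one point $x^*$; the largest real eigenvalue $\mu$ of $H$ is greater than $1$, and its eigenspace is the line spanned by $(x^*,1)$. -/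

import Mathlib

open Set Filter Topology

/-- A Glass network with `n` variables and unit decay rate.  Variable `i` has `J i` thresholds
`θ i 0 < θ i 1 < ⋯`.  A region is encoded by giving, for every variable, the number of thresholds
lying below it.  `F r` is the focal point of the region with code `r`: inside this region the
dynamics is `y' = -y + F r`.  No coordinate of a focal point is a threshold. -/
structure GlassNetwork (n : ℕ) where
  J : Fin n → ℕ
  θ : (i : Fin n) → Fin (J i) → ℝ
  θ_strictMono : ∀ i, StrictMono (θ i)
  F : ((i : Fin n) → Fin (J i + 1)) → (Fin n → ℝ)
  F_ne_θ : ∀ r i l, F r i ≠ θ i l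

namespace GlassNetwork

/-- Codes of regions. -/
abbrev Code {n : ℕ} (N : GlassNetwork n) : Type := (i : Fin n) → Fin (N.J i + 1)

/-- The open interval of values of variable `i` having exactly `c` thresholds below them (and the
others above them); it is unbounded below if `c = 0`, and above if `c = J i`. -/
def interval {n : ℕ} (N : GlassNetwork n) (i : Fin n) (c : Fin (N.J i + 1)) : Set ℝ :=
  {s | ∀ l : Fin (N.J i), (l.val < c.val → N.θ i l < s) ∧ (c.val ≤ l.val → s < N.θ i l)}

/-- The region (an open box) with code `r`. -/
def region {n : ℕ} (N : GlassNetwork n) (r : N.Code) : Set (Fin n → ℝ) :=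
  {x | ∀ i, x i ∈ N.interval i (r i)}

/-- The flow towards the focal point `F r`: the solution of `y' = -y + F r`, `y 0 = x`. -/
noncomputable def flow {n : ℕ} (N : GlassNetwork n) (r : N.Code) (x : Fin n → ℝ) (t : ℝ) :
    Fin n → ℝ :=
  N.F r + Real.exp (-t) • (x - N.F r)

end GlassNetwork

/-- A cycle `O 0 → O 1 → ⋯ → O (k - 1) → O 0` of pairwise distinct regions (indices in `Fin k`, so
that `i + 1` is cyclic).  The consecutive regions `O i` and `O (i + 1)` differ in the variable
`var i` only, and are separated by its threshold number `thr i`.  If the variable increases, its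
coordinate in both focal points is above this threshold; if it decreases, both are below it: both
vector fields point from `O i` to `O (i + 1)` at the common wall. -/
structure RegionCycle {n : ℕ} (N : GlassNetwork n) (k : ℕ) [NeZero k] where
  O : Fin k → N.Code
  O_injective : Function.Injective O
  var : Fin k → Fin n
  thr : (i : Fin k) → Fin (N.J (var i))
  eq_of_ne : ∀ i j, j ≠ var i → O (i + 1) j = O i j
  switch : ∀ i,
    ((O i (var i)).val = (thr i).val ∧ (O (i + 1) (var i)).val = (thr i).val + 1 ∧
      N.θ (var i) (thr i) < N.F (O i) (var i) ∧
      N.θ (var i) (thr i) < N.F (O (i + 1)) (var i)) ∨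
    ((O i (var i)).val = (thr i).val + 1 ∧ (O (i + 1) (var i)).val = (thr i).val ∧
      N.F (O i) (var i) < N.θ (var i) (thr i) ∧
      N.F (O (i + 1)) (var i) < N.θ (var i) (thr i))

namespace RegionCycle

/-- The (relatively open) wall between `O i` and `O (i + 1)`. -/
def wall {n k : ℕ} [NeZero k] {N : GlassNetwork n} (C : RegionCycle N k) (i : Fin k) :
    Set (Fin n → ℝ) :=
  {x | x (C.var i) = N.θ (C.var i) (C.thr i) ∧ ∀ j, j ≠ C.var i → x j ∈ N.interval j (C.O i j)}

/-- The spine of the cycle: the common points of the closures of all its walls. -/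
def spine {n k : ℕ} [NeZero k] {N : GlassNetwork n} (C : RegionCycle N k) : Set (Fin n → ℝ) :=
  ⋂ i, closure (C.wall i)

/-- A cycle is ideal if its spine is empty. -/
def IsIdeal {n k : ℕ} [NeZero k] {N : GlassNetwork n} (C : RegionCycle N k) : Prop :=
  C.spine = ∅

/-- A cyclic attractor: every trajectory starting in the region `O i` of the cycle leaves it
through the wall to `O (i + 1)` (which it crosses by the conditions on the focal points). -/
def IsCyclicAttractor {n k : ℕ} [NeZero k] {N : GlassNetwork n} (C : RegionCycle N k) : Prop :=
  ∀ i, ∀ x ∈ N.region (C.O i), ∃ τ : ℝ, 0 < τ ∧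
    (∀ t, 0 ≤ t → t < τ → N.flow (C.O i) x t ∈ N.region (C.O i)) ∧
    N.flow (C.O i) x τ ∈ C.wall i

/-- `C.Velocity x v`: the point `x` lies on one of the regions or walls of the cycle, and `v` is
the velocity there.  On the wall between `O i` and `O (i + 1)` the dynamics is the continuous
extension of the dynamics of `O (i + 1)`. -/
def Velocity {n k : ℕ} [NeZero k] {N : GlassNetwork n} (C : RegionCycle N k)
    (x v : Fin n → ℝ) : Prop :=
  ∃ i, (x ∈ N.region (C.O i) ∧ v = -x + N.F (C.O i)) ∨
    (x ∈ C.wall i ∧ v = -x + N.F (C.O (i + 1)))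

/-- `y` is a trajectory in the cycle on the time interval `[0, T)`, where `0 < T ≤ ∞`: it is
continuous, stays in the regions and walls of the cycle, and its right derivative is the
velocity.  (The values of `y` outside `[0, T)` are irrelevant.) -/
def IsTrajectory {n k : ℕ} [NeZero k] {N : GlassNetwork n} (C : RegionCycle N k)
    (T : EReal) (y : ℝ → Fin n → ℝ) : Prop :=
  0 < T ∧ ContinuousOn y {t : ℝ | 0 ≤ t ∧ (t : EReal) < T} ∧
    ∀ t : ℝ, 0 ≤ t → (t : EReal) < T →
      ∃ v, C.Velocity (y t) v ∧ HasDerivWithinAt y v (Ici t) t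

/-- A trajectory in the cycle that cannot be continued in the cycle beyond the time `T`. -/
def IsMaximalTrajectory {n k : ℕ} [NeZero k] {N : GlassNetwork n} (C : RegionCycle N k)
    (T : EReal) (y : ℝ → Fin n → ℝ) : Prop :=
  C.IsTrajectory T y ∧ ∀ (T' : EReal) (z : ℝ → Fin n → ℝ), C.IsTrajectory T' z →
    (∀ t : ℝ, 0 ≤ t → (t : EReal) < T → (t : EReal) < T' → z t = y t) → T' ≤ T

/-- `Γ` is (the set of points of) a periodic orbit in the cycle. -/
def IsPeriodicOrbit {n k : ℕ} [NeZero k] {N : GlassNetwork n} (C : RegionCycle N k)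
    (Γ : Set (Fin n → ℝ)) : Prop :=
  ∃ (y : ℝ → Fin n → ℝ) (P : ℝ), C.IsTrajectory ⊤ y ∧ 0 < P ∧
    (∀ t, 0 ≤ t → y (t + P) = y t) ∧ Γ = y '' Ici 0

/-- Asymptotic (orbital) stability of an orbit `Γ` in the cycle: Lyapunov stability together with
local attractivity.  All norms on `Fin n → ℝ` give the same notion. -/
def IsAsymptoticallyStable {n k : ℕ} [NeZero k] {N : GlassNetwork n} (C : RegionCycle N k)
    (Γ : Set (Fin n → ℝ)) : Prop :=
  (∀ ε : ℝ, 0 < ε → ∃ δ : ℝ, 0 < δ ∧ ∀ (T : EReal) (y : ℝ → Fin n → ℝ),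
    C.IsMaximalTrajectory T y → Metric.infDist (y 0) Γ < δ →
      T = ⊤ ∧ ∀ t, 0 ≤ t → Metric.infDist (y t) Γ < ε) ∧
  (∃ δ : ℝ, 0 < δ ∧ ∀ (T : EReal) (y : ℝ → Fin n → ℝ),
    C.IsMaximalTrajectory T y → Metric.infDist (y 0) Γ < δ →
      T = ⊤ ∧ Tendsto (fun t => Metric.infDist (y t) Γ) atTop (𝓝 0))

/-- The cycle has exactly one periodic orbit, and this orbit is asymptotically stable. -/
def HasUniqueStablePeriodicOrbit {n k : ℕ} [NeZero k] {N : GlassNetwork n}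
    (C : RegionCycle N k) : Prop :=
  ∃ Γ, C.IsPeriodicOrbit Γ ∧ C.IsAsymptoticallyStable Γ ∧ ∀ Γ', C.IsPeriodicOrbit Γ' → Γ' = Γ

/-- Every maximal trajectory in the cycle converges to a point of the spine (a degenerate periodic
orbit) as the time tends to the end `T ≤ ∞` of its interval of existence. -/
def AllConvergeToSpine {n k : ℕ} [NeZero k] {N : GlassNetwork n} (C : RegionCycle N k) : Prop :=
  ∀ (T : EReal) (y : ℝ → Fin n → ℝ), C.IsMaximalTrajectory T y →
    ∃ p ∈ C.spine, ∀ ε : ℝ, 0 < ε → ∃ s : ℝ, 0 ≤ s ∧ (s : EReal) < T ∧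
      ∀ t : ℝ, s ≤ t → (t : EReal) < T → dist (y t) p < ε

/-- The passage through the region `O i`, from the wall where it is entered to the next wall, in
homogeneous coordinates: with `m = var i`, `f` the focal point of `O i`, and `θ` the threshold of
the next wall, `(x, s) ↦ (x, s) + ((θ * s - x m) / (f m - θ)) • (f, 1)`.
It maps `(x, 1)` to `exp t • (x', 1)`, where `x'` is the point of the next wall that is reached
from `x`, and `t` is the time taken. -/
noncomputable def passage {n k : ℕ} [NeZero k] {N : GlassNetwork n} (C : RegionCycle N k)
    (i : Fin k) : Module.End ℝ ((Fin n → ℝ) × ℝ) :=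
  LinearMap.id +
    ((N.F (C.O i) (C.var i) - N.θ (C.var i) (C.thr i))⁻¹ •
      (N.θ (C.var i) (C.thr i) • LinearMap.snd ℝ (Fin n → ℝ) ℝ -
        (LinearMap.proj (C.var i)).comp (LinearMap.fst ℝ (Fin n → ℝ) ℝ))).smulRight
      (N.F (C.O i), (1 : ℝ))

/-- The linear map inducing the (linear fractional) return map on the wall where `O 0` is entered:
the composition `passage (k - 1) ∘ ⋯ ∘ passage 1 ∘ passage 0`. -/
noncomputable def returnLinearMap {n k : ℕ} [NeZero k] {N : GlassNetwork n}
    (C : RegionCycle N k) : Module.End ℝ ((Fin n → ℝ) × ℝ) :=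
  (List.ofFn C.passage).reverse.prod

end RegionCycle

/-! In homogeneous coordinates the flow is straight: a solution of `y' = -y + f` satisfies e^t
(y(t), 1) = (x, 1) + (e^t - 1) (f, 1). A passage therefore adds a multiple of (f, 1), the last
coordinate s is the exponential of time, and the return map is induced by the linear map H =
`returnLinearMap`.

A cyclic attractor forces every focal point into the box of its region, except for the switching
variable (`IsCyclicAttractor.isFocal`). Hence a passage does not decrease the signed distance
(`slack`) to a threshold of another variable, and on the wall that is reached the slack of another
threshold of the switching variable is a positive multiple of s. Let L collect the slacks of the
thresholds crossed by the cycle, and s itself if some variable crosses two of them. On the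
hyperplane of the last wall, vectors in the kernel of L are fixed by all passages, so H = 1 + G ∘ L
there, and H induces the map A = 1 + L ∘ G on the image of L. By `return_dichotomy`, A sends nonzero
nonnegative vectors of this image to strictly positive ones. Perron-Frobenius theory gives a
positive eigenvector L v with eigenvalue μ and the convergence of μ^(-m) A^m.

If μ > 1, the eigenvector lifts to an eigenvector of H, which lies over the open wall
(`wallCone_of_eigenvector`), and μ^(-m) H^m z converges to a multiple of it, a positive one if z
lies over the wall. This is a globally attracting fixed point of the return map, and its orbit has
period log μ. Lyapunov stability holds because the norms of iterated passages grow no faster than s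
does along this orbit.

If μ ≤ 1, then H^m z converges (μ < 1) or grows linearly (μ = 1). In both cases the relative growth
of s in one turn tends to 0, so whole turns of the trajectory shrink to a point. This point is a
limit of points of every wall, hence lies in the spine, which is impossible for an ideal cycle.
Moreover H then has no eigenvalue above 1. The main lemma `perron_dichotomy` states these two
alternatives. -/

/-- A linear map that vanishes on `U ∩ ker L` factors through `L` on `U`. -/
theorem LinearMap.exists_factor_on {V A B : Type*} [AddCommGroup V] [Module ℝ V] [AddCommGroup A]
    [Module ℝ A] [AddCommGroup B] [Module ℝ B] (U : Submodule ℝ V) (L : V →ₗ[ℝ] A)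
    (f : V →ₗ[ℝ] B) (h : ∀ z ∈ U, L z = 0 → f z = 0) :
    ∃ G : A →ₗ[ℝ] B, ∀ z ∈ U, f z = G (L z) := by
  let L' := L.domRestrict U
  let f' := f.domRestrict U
  have hker : LinearMap.ker L' ≤ LinearMap.ker f' := fun z hz => by
    have h1 : L z = 0 := hz
    exact h z z.2 h1
  let g := (LinearMap.ker L').liftQ f' hker
  obtain ⟨G, hG⟩ := LinearMap.exists_extend (g ∘ₗ L'.quotKerEquivRange.symm.toLinearMap)
  refine ⟨G, fun z hz => ?_⟩
  have h1 := LinearMap.congr_fun hG (L'.rangeRestrict ⟨z, hz⟩)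
  have h2 : L'.quotKerEquivRange.symm (L'.rangeRestrict ⟨z, hz⟩)
      = (LinearMap.ker L').mkQ ⟨z, hz⟩ := by
    rw [LinearEquiv.symm_apply_eq]
    rfl
  have h3 : (g ∘ₗ L'.quotKerEquivRange.symm.toLinearMap) (L'.rangeRestrict ⟨z, hz⟩) = f z := by
    simp only [LinearMap.comp_apply, LinearEquiv.coe_coe, h2]
    rfl
  rw [h3] at h1
  exact h1.symm

/-! ### Perron-Frobenius theory for maps that are positive on the nonnegative vectors of a subspace
-/

namespace PerronFrobenius

variable {ι : Type*} [Fintype ι]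

/-- The nonnegative vectors of a subspace with coordinate sum one. -/
def slice (S : Submodule ℝ (ι → ℝ)) : Set (ι → ℝ) := {u | u ∈ S ∧ 0 ≤ u ∧ ∑ i, u i = 1}

theorem isCompact_slice (S : Submodule ℝ (ι → ℝ)) : IsCompact (slice S) := by
  have hS : IsClosed (S : Set (ι → ℝ)) := S.closed_of_finiteDimensional
  have hcl : IsClosed (slice S) := by
    refine hS.inter ((isClosed_le continuous_const continuous_id).inter
      (isClosed_eq (f := fun u : ι → ℝ => ∑ i, u i) (by fun_prop) continuous_const))
  refine (isCompact_Icc (a := (0 : ι → ℝ)) (b := 1)).of_isClosed_subset hcl ?_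
  rintro u ⟨-, h0, h1⟩
  refine ⟨h0, fun i => ?_⟩
  have := Finset.single_le_sum (f := u) (fun j _ => h0 j) (Finset.mem_univ i)
  simpa [h1] using this

theorem sum_pos_of_ne_zero {u : ι → ℝ} (h0 : 0 ≤ u) (hu : u ≠ 0) : 0 < ∑ i, u i := by
  obtain ⟨i, hi⟩ := Function.ne_iff.mp hu
  exact Finset.sum_pos' (fun j _ => h0 j) ⟨i, Finset.mem_univ i, lt_of_le_of_ne (h0 i) (Ne.symm hi)⟩

theorem smul_mem_slice {S : Submodule ℝ (ι → ℝ)} {u : ι → ℝ} (hS : u ∈ S) (h0 : 0 ≤ u)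
    (hu : u ≠ 0) : (∑ i, u i)⁻¹ • u ∈ slice S := by
  have hp := sum_pos_of_ne_zero h0 hu
  refine ⟨S.smul_mem _ hS, smul_nonneg (inv_nonneg.2 hp.le) h0, ?_⟩
  simp only [Pi.smul_apply, smul_eq_mul, ← Finset.mul_sum]
  exact inv_mul_cancel₀ hp.ne'

theorem exists_pos_smul_le (a b : ι → ℝ) (hb : ∀ i, 0 < b i) :
    ∃ ε : ℝ, 0 < ε ∧ ∀ i, ε * a i ≤ b i := by
  have hs : 0 ≤ ∑ i, |a i| / b i := Finset.sum_nonneg fun i _ => div_nonneg (abs_nonneg _) (hb i).le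
  refine ⟨(1 + ∑ i, |a i| / b i)⁻¹, by positivity, fun i => ?_⟩
  have h1 : |a i| / b i ≤ ∑ i, |a i| / b i :=
    Finset.single_le_sum (f := fun i => |a i| / b i)
      (fun j _ => div_nonneg (abs_nonneg _) (hb j).le) (Finset.mem_univ i)
  rw [div_le_iff₀ (hb i)] at h1
  rw [inv_mul_le_iff₀ (by positivity)]
  nlinarith [le_abs_self (a i), hb i]

variable (S : Submodule ℝ (ι → ℝ)) (A : (ι → ℝ) →ₗ[ℝ] (ι → ℝ))

/-- Collatz-Wielandt: the eigenvalue is the largest r with `r • u ≤ A u` for some u in the slice.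
The maximum exists since the slice is compact and r is at most the coordinate sum of `A u`. -/
theorem exists_eigenvector (hS : ∀ u ∈ S, A u ∈ S)
    (hA : ∀ u ∈ S, 0 ≤ u → u ≠ 0 → ∀ i, 0 < A u i) (hne : ∃ u ∈ S, 0 ≤ u ∧ u ≠ 0) :
    ∃ v ∈ S, ∃ μ : ℝ, 0 < μ ∧ (∀ i, 0 < v i) ∧ A v = μ • v := by
  have hAc : Continuous A := A.continuous_of_finiteDimensional
  have hcomp := isCompact_slice S
  obtain ⟨M, hM⟩ := hcomp.bddAbove_image (f := fun u => ∑ i, A u i) (by fun_prop)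
  let K : Set ((ι → ℝ) × ℝ) := {p | p.1 ∈ slice S ∧ 0 ≤ p.2 ∧ p.2 • p.1 ≤ A p.1}
  have hKcl : IsClosed K :=
    (hcomp.isClosed.preimage continuous_fst).inter
      ((isClosed_le continuous_const continuous_snd).inter
        (isClosed_le (f := fun p : (ι → ℝ) × ℝ => p.2 • p.1) (g := fun p => A p.1)
          (by fun_prop) (by fun_prop)))
  have hKcomp : IsCompact K := by
    refine (hcomp.prod (isCompact_Icc (a := (0 : ℝ)) (b := M))).of_isClosed_subset hKcl ?_
    rintro ⟨u, r⟩ ⟨h1, h2, h3⟩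
    refine ⟨h1, h2, ?_⟩
    have h4 : r ≤ ∑ i, A u i := by
      calc r = ∑ i, r * u i := by rw [← Finset.mul_sum, h1.2.2, mul_one]
        _ ≤ _ := Finset.sum_le_sum fun i _ => h3 i
    exact h4.trans (hM ⟨u, h1, rfl⟩)
  have hKne : K.Nonempty := by
    obtain ⟨u, hu, h0, hu0⟩ := hne
    have hsl := smul_mem_slice hu h0 hu0
    refine ⟨((∑ i, u i)⁻¹ • u, 0), hsl, le_rfl, ?_⟩
    rw [zero_smul]
    intro i
    refine (hA _ hsl.1 hsl.2.1 ?_ i).le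
    exact smul_ne_zero (inv_ne_zero (sum_pos_of_ne_zero h0 hu0).ne') hu0
  obtain ⟨⟨u, r⟩, ⟨hu, hr, hur⟩, hmax⟩ := hKcomp.exists_isMaxOn hKne continuous_snd.continuousOn
  simp only at hu hr hur
  have hu0 : u ≠ 0 := by
    rintro rfl
    simpa using hu.2.2
  have hAu := hA u hu.1 hu.2.1 hu0
  obtain ⟨i₀, -⟩ := Function.ne_iff.mp hu0
  have heq : A u = r • u := by
    -- Otherwise the nonnegative vector `A u - r • u` is made strictly positive by `A`, so the
    -- normalized `A u` admits the larger factor `r + ε`.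
    by_contra hne
    have hw := hA (A u - r • u) (S.sub_mem (hS u hu.1) (S.smul_mem _ hu.1)) (sub_nonneg.2 hur)
      (sub_ne_zero.2 hne)
    obtain ⟨ε, hε, hle⟩ := exists_pos_smul_le (A u) _ hw
    have hAu0 : A u ≠ 0 := fun h => by simpa [h] using hAu i₀
    have hsl := smul_mem_slice (hS u hu.1) (fun i => (hAu i).le) hAu0
    have hp : 0 < ∑ i, A u i := sum_pos_of_ne_zero (fun i => (hAu i).le) hAu0
    have hmem : ((∑ i, A u i)⁻¹ • A u, r + ε) ∈ K := by
      refine ⟨hsl, by simp only; positivity, fun i => ?_⟩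
      have h1 := hle i
      simp only [map_sub, map_smul, Pi.sub_apply, Pi.smul_apply, smul_eq_mul] at h1 ⊢
      have h2 : (r + ε) * A u i ≤ A (A u) i := by linarith
      have := mul_le_mul_of_nonneg_left h2 (inv_nonneg.2 hp.le)
      linarith
    have : r + ε ≤ r := hmax hmem
    linarith
  have hr0 : r ≠ 0 := by
    rintro rfl
    have := hAu i₀
    simp [heq] at this
  have hrpos : 0 < r := lt_of_le_of_ne hr (Ne.symm hr0)
  refine ⟨u, hu.1, r, hrpos, fun i => ?_, heq⟩
  have := hAu i
  rw [heq, Pi.smul_apply, smul_eq_mul] at this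
  exact (mul_pos_iff_of_pos_left hrpos).1 this

/-- A minorization that is uniform by compactness of the slice and homogeneity. It supplies the
contraction rate for the iterates. -/
theorem exists_uniform_pos (hA : ∀ u ∈ S, 0 ≤ u → u ≠ 0 → ∀ i, 0 < A u i) {v : ι → ℝ}
    (hvS : v ∈ S) (hv : ∀ i, 0 < v i) :
    ∃ κ : ℝ, 0 < κ ∧ ∀ u ∈ S, 0 ≤ u → ∀ i, κ * (∑ j, u j) * v i ≤ A u i := by
  rcases isEmpty_or_nonempty ι with hι | hι
  · exact ⟨1, one_pos, fun u _ _ i => hι.elim i⟩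
  have hAc : Continuous A := A.continuous_of_finiteDimensional
  have hv0 : v ≠ 0 := fun h => by simpa [h] using hv (Classical.arbitrary ι)
  have hne : (slice S).Nonempty := ⟨_, smul_mem_slice hvS (fun i => (hv i).le) hv0⟩
  have h0 : ∀ u ∈ slice S, u ≠ 0 := by
    rintro u hu rfl
    simpa using hu.2.2
  have h1 : ∀ i, ∃ b : ℝ, 0 < b ∧ ∀ u ∈ slice S, b ≤ A u i := fun i => by
    obtain ⟨u, hu, hmin⟩ := (isCompact_slice S).exists_isMinOn hne
      (f := fun u => A u i) (by fun_prop)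
    exact ⟨A u i, hA u hu.1 hu.2.1 (h0 u hu) i, fun w hw => hmin hw⟩
  choose b hb hb' using h1
  obtain ⟨κ, hκ, hle⟩ := exists_pos_smul_le v b hb
  refine ⟨κ, hκ, fun u hu hu0 i => ?_⟩
  by_cases hz : u = 0
  · simp [hz]
  have hp := sum_pos_of_ne_zero hu0 hz
  have h2 := (hle i).trans (hb' i _ (smul_mem_slice hu hu0 hz))
  simp only [map_smul, Pi.smul_apply, smul_eq_mul] at h2
  have := mul_le_mul_of_nonneg_left h2 hp.le
  rw [mul_inv_cancel_left₀ hp.ne'] at this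
  linarith

/-- The iterates are squeezed between multiples α v and β v. In each step the minorization moves
both bounds by the fraction q towards the same average σ, so the gap shrinks by the factor 1 - q. If
u is positive, then α can start positive, and it only increases. -/
theorem tendsto_iterate_of_fixed (hS : ∀ u ∈ S, A u ∈ S)
    (hA : ∀ u ∈ S, 0 ≤ u → u ≠ 0 → ∀ i, 0 < A u i) {v : ι → ℝ}
    (hvS : v ∈ S) (hv : ∀ i, 0 < v i) (hAv : A v = v) {u : ι → ℝ} (hu : u ∈ S) :
    ∃ c : ℝ, Tendsto (fun m : ℕ => (A ^ m) u) atTop (𝓝 (c • v)) ∧ ((∀ i, 0 < u i) → 0 < c) := by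
  rcases isEmpty_or_nonempty ι with hι | hι
  · refine ⟨1, ?_, fun _ => one_pos⟩
    have : ∀ w : ι → ℝ, w = (1 : ℝ) • v := fun w => Subsingleton.elim _ _
    rw [show (fun m : ℕ => (A ^ m) u) = fun _ => (1 : ℝ) • v from funext fun m => this _]
    exact tendsto_const_nhds
  obtain ⟨κ, hκ, hle⟩ := exists_uniform_pos S A hA hvS hv
  set s := ∑ j, v j with hs
  have hspos : 0 < s := Finset.sum_pos (fun i _ => hv i) Finset.univ_nonempty
  set q := κ * s with hq
  have hqpos : 0 < q := mul_pos hκ hspos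
  have hq1 : q ≤ 1 := by
    obtain ⟨i⟩ := hι
    have h1 := hle v hvS (fun i => (hv i).le) i
    rw [hAv] at h1
    nlinarith [hv i]
  let U : ℕ → ι → ℝ := fun m => (A ^ m) u
  have hU : ∀ m, U (m + 1) = A (U m) := fun m => by
    simp only [U, pow_succ', Module.End.mul_apply]
  have hUS : ∀ m, U m ∈ S := fun m => by
    induction m with
    | zero => simpa [U] using hu
    | succ m ih => rw [hU]; exact hS _ ih
  let σ : ℕ → ℝ := fun m => (∑ j, U m j) / s
  -- The minorization is applied to the nonnegative vector `U m - α • v`, whose coordinate sum is `s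
  -- * (σ m - α)`.
  have stepA : ∀ m (α : ℝ), (∀ i, α * v i ≤ U m i) →
      ∀ i, (α + q * (σ m - α)) * v i ≤ U (m + 1) i := fun m α h i => by
    have h1 := hle (U m - α • v) (S.sub_mem (hUS m) (S.smul_mem _ hvS))
      (fun i => by simpa using h i) i
    simp only [map_sub, map_smul, hAv, Pi.sub_apply, Pi.smul_apply, smul_eq_mul,
      Finset.sum_sub_distrib, ← Finset.mul_sum] at h1
    rw [hU]
    have h2 : q * (σ m - α) = κ * (∑ j, U m j - α * s) := by
      simp only [σ, hq]
      field_simp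
    rw [add_mul, h2]
    linarith
  have stepB : ∀ m (β : ℝ), (∀ i, U m i ≤ β * v i) →
      ∀ i, U (m + 1) i ≤ (β + q * (σ m - β)) * v i := fun m β h i => by
    have h1 := hle (β • v - U m) (S.sub_mem (S.smul_mem _ hvS) (hUS m))
      (fun i => by simpa using h i) i
    simp only [map_sub, map_smul, hAv, Pi.sub_apply, Pi.smul_apply, smul_eq_mul,
      Finset.sum_sub_distrib, ← Finset.mul_sum] at h1
    rw [hU]
    have h2 : q * (σ m - β) = κ * (∑ j, U m j - β * s) := by
      simp only [σ, hq]
      field_simp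
    rw [add_mul, h2]
    linarith
  have hα₀ : ∃ α : ℝ, (∀ i, α * v i ≤ u i) ∧ ((∀ i, 0 < u i) → 0 < α) := by
    by_cases h : ∀ i, 0 < u i
    · obtain ⟨ε, hε, h'⟩ := exists_pos_smul_le v u h
      exact ⟨ε, h', fun _ => hε⟩
    · obtain ⟨ε, hε, h'⟩ := exists_pos_smul_le (-u) v hv
      refine ⟨-ε⁻¹, fun i => ?_, fun h'' => absurd h'' h⟩
      have h3 := h' i
      rw [Pi.neg_apply] at h3
      have h4 := mul_le_mul_of_nonneg_left h3 (inv_nonneg.2 hε.le)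
      rw [inv_mul_cancel_left₀ hε.ne'] at h4
      linarith
  have hβ₀ : ∃ β : ℝ, ∀ i, u i ≤ β * v i := by
    obtain ⟨ε, hε, h'⟩ := exists_pos_smul_le u v hv
    refine ⟨ε⁻¹, fun i => ?_⟩
    rw [inv_mul_eq_div, le_div_iff₀ hε]
    linarith [h' i]
  obtain ⟨α₀, hα₀, hpos⟩ := hα₀
  obtain ⟨β₀, hβ₀⟩ := hβ₀
  let α : ℕ → ℝ := fun m => Nat.rec α₀ (fun m a => a + q * (σ m - a)) m
  let β : ℕ → ℝ := fun m => Nat.rec β₀ (fun m a => a + q * (σ m - a)) m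
  have hαs : ∀ m, α (m + 1) = α m + q * (σ m - α m) := fun m => rfl
  have hβs : ∀ m, β (m + 1) = β m + q * (σ m - β m) := fun m => rfl
  have hα : ∀ m i, α m * v i ≤ U m i := fun m => by
    induction m with
    | zero => simpa [U, α] using hα₀
    | succ m ih => rw [hαs]; exact stepA m _ ih
  have hβ : ∀ m i, U m i ≤ β m * v i := fun m => by
    induction m with
    | zero => simpa [U, β] using hβ₀
    | succ m ih => rw [hβs]; exact stepB m _ ih
  have hασ : ∀ m, α m ≤ σ m := fun m => by
    simp only [σ]
    rw [le_div_iff₀ hspos, hs, Finset.mul_sum]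
    exact Finset.sum_le_sum fun i _ => hα m i
  have hσβ : ∀ m, σ m ≤ β m := fun m => by
    simp only [σ]
    rw [div_le_iff₀ hspos, hs, Finset.mul_sum]
    exact Finset.sum_le_sum fun i _ => hβ m i
  have hgap : ∀ m, β m - α m = (1 - q) ^ m * (β₀ - α₀) := fun m => by
    induction m with
    | zero => simp [α, β]
    | succ m ih => rw [hαs, hβs, pow_succ]; linear_combination (1 - q) * ih
  have hmonoα : Monotone α := monotone_nat_of_le_succ fun m => by
    rw [hαs]
    nlinarith [hασ m]
  have hantiβ : Antitone β := antitone_nat_of_succ_le fun m => by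
    rw [hβs]
    nlinarith [hσβ m]
  have hbdd : BddAbove (range α) := ⟨β 0, by
    rintro _ ⟨m, rfl⟩
    exact ((hασ m).trans (hσβ m)).trans (hantiβ (Nat.zero_le m))⟩
  have hlimα := tendsto_atTop_ciSup hmonoα hbdd
  set c := ⨆ m, α m
  have hgap0 : Tendsto (fun m => (1 - q) ^ m * (β₀ - α₀)) atTop (𝓝 0) := by
    simpa using (tendsto_pow_atTop_nhds_zero_of_lt_one (by linarith) (by linarith)).mul_const
      (β₀ - α₀)
  have hlimβ : Tendsto β atTop (𝓝 c) := by
    have := hlimα.add hgap0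
    rw [add_zero] at this
    exact this.congr fun m => by rw [← hgap]; ring
  refine ⟨c, tendsto_pi_nhds.2 fun i => ?_, fun h => (hpos h).trans_le ?_⟩
  · exact tendsto_of_tendsto_of_tendsto_of_le_of_le (hlimα.mul_const (v i)) (hlimβ.mul_const (v i))
      (fun m => hα m i) (fun m => hβ m i)
  · exact le_ciSup hbdd 0

theorem tendsto_iterate (hS : ∀ u ∈ S, A u ∈ S)
    (hA : ∀ u ∈ S, 0 ≤ u → u ≠ 0 → ∀ i, 0 < A u i) {v : ι → ℝ} {μ : ℝ} (hμ : 0 < μ)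
    (hvS : v ∈ S) (hv : ∀ i, 0 < v i) (hAv : A v = μ • v) {u : ι → ℝ} (hu : u ∈ S) :
    ∃ c : ℝ, Tendsto (fun m : ℕ => (μ ^ m)⁻¹ • (A ^ m) u) atTop (𝓝 (c • v)) ∧
      ((∀ i, 0 < u i) → 0 < c) := by
  obtain ⟨c, hc, hc'⟩ := tendsto_iterate_of_fixed S (μ⁻¹ • A)
    (fun u hu => S.smul_mem _ (hS u hu))
    (fun u hu h0 hne i => mul_pos (inv_pos.2 hμ) (hA u hu h0 hne i)) hvS hv
    (by rw [LinearMap.smul_apply, hAv, inv_smul_smul₀ hμ.ne']) hu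
  refine ⟨c, ?_, hc'⟩
  simpa only [smul_pow, LinearMap.smul_apply, inv_pow] using hc

end PerronFrobenius

/-! ### Regions described by signed linear functionals -/

namespace GlassNetwork

variable {n : ℕ} (N : GlassNetwork n)

/-- A threshold of some variable. -/
abbrev Edge : Type := (j : Fin n) × Fin (N.J j)

/-- The value of a threshold. -/
def level (e : N.Edge) : ℝ := N.θ e.1 e.2

/-- The side of the threshold `l` on which the interval number `c` lies. -/
noncomputable def sideSign {m : ℕ} (c : Fin (m + 1)) (l : Fin m) : ℝ :=
  if l.val < c.val then 1 else -1

/-- The homogeneous affine functional that vanishes at the threshold `e` and is positive on the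
region `r`. -/
noncomputable def slack (r : N.Code) (e : N.Edge) : ((Fin n → ℝ) × ℝ) →ₗ[ℝ] ℝ :=
  sideSign (r e.1) e.2 • ((LinearMap.proj e.1).comp (LinearMap.fst ℝ (Fin n → ℝ) ℝ) -
    N.level e • LinearMap.snd ℝ (Fin n → ℝ) ℝ)

theorem slack_apply (r : N.Code) (e : N.Edge) (z : (Fin n → ℝ) × ℝ) :
    N.slack r e z = sideSign (r e.1) e.2 * (z.1 e.1 - N.level e * z.2) := by
  simp [slack]

theorem sideSign_ne_zero {m : ℕ} (c : Fin (m + 1)) (l : Fin m) : sideSign c l ≠ 0 := by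
  unfold sideSign; split_ifs <;> norm_num

variable {N}

theorem mem_interval_iff {j : Fin n} {c : Fin (N.J j + 1)} {s : ℝ} :
    s ∈ N.interval j c ↔ ∀ l, 0 < sideSign c l * (s - N.θ j l) := by
  refine forall_congr' fun l => ?_
  unfold sideSign
  split_ifs with h
  · refine ⟨fun H => by linarith [H.1 h], fun H => ⟨fun _ => by linarith, fun h' => by omega⟩⟩
  · refine ⟨fun H => by linarith [H.2 (by omega)], fun H => ⟨fun h' => absurd h' h,
      fun _ => by linarith⟩⟩

theorem mem_region_iff {r : N.Code} {x : Fin n → ℝ} :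
    x ∈ N.region r ↔ ∀ e, 0 < N.slack r e (x, 1) := by
  refine ⟨fun h e => ?_, fun h j => mem_interval_iff.2 fun l => ?_⟩
  · simpa [slack_apply, level] using mem_interval_iff.1 (h e.1) e.2
  · simpa [slack_apply, level] using h ⟨j, l⟩

/-- The region with its boundary. -/
def closedRegion (N : GlassNetwork n) (r : N.Code) : Set (Fin n → ℝ) :=
  {x | ∀ e, 0 ≤ N.slack r e (x, 1)}

theorem region_subset_closedRegion (r : N.Code) : N.region r ⊆ N.closedRegion r :=
  fun _ hx e => (mem_region_iff.1 hx e).le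

theorem isOpen_region (r : N.Code) : IsOpen (N.region r) := by
  have : N.region r = ⋂ e, {x : Fin n → ℝ | 0 < N.slack r e (x, 1)} := by
    ext x; simp [mem_region_iff]
  rw [this]
  refine isOpen_iInter_of_finite fun e => ?_
  have := (N.slack r e).continuous_of_finiteDimensional
  exact isOpen_lt continuous_const (by fun_prop)

theorem isClosed_closedRegion (r : N.Code) : IsClosed (N.closedRegion r) := by
  have : N.closedRegion r = ⋂ e, {x : Fin n → ℝ | 0 ≤ N.slack r e (x, 1)} := by
    ext x; simp [closedRegion]
  rw [this]
  refine isClosed_iInter fun e => ?_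
  have := (N.slack r e).continuous_of_finiteDimensional
  exact isClosed_le continuous_const (by fun_prop)

/-- If the codes differ, the threshold whose number is the smaller code lies between the two
intervals, and it is not attained on the open one. -/
theorem interval_code_unique {j : Fin n} {c c' : Fin (N.J j + 1)} {s : ℝ}
    (h : s ∈ N.interval j c) (h' : ∀ l, 0 ≤ sideSign c' l * (s - N.θ j l)) : c = c' := by
  rcases lt_trichotomy c.val c'.val with hlt | heq | hgt
  · have hl : c.val < N.J j := by omega
    have h1 := (h ⟨c.val, hl⟩).2 le_rfl
    have h2 := h' ⟨c.val, hl⟩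
    simp only [sideSign, hlt, if_true] at h2
    linarith
  · exact Fin.ext heq
  · have hl : c'.val < N.J j := by omega
    have h1 := (h ⟨c'.val, hl⟩).1 hgt
    have h2 := h' ⟨c'.val, hl⟩
    simp only [sideSign, lt_irrefl, if_false] at h2
    linarith

theorem closedRegion_sideSign {r : N.Code} {x : Fin n → ℝ} (h : x ∈ N.closedRegion r) (j : Fin n)
    (l : Fin (N.J j)) : 0 ≤ sideSign (r j) l * (x j - N.θ j l) := by
  simpa [slack_apply, level] using h ⟨j, l⟩

theorem region_code_unique {r r' : N.Code} {x : Fin n → ℝ} (h : x ∈ N.region r)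
    (h' : x ∈ N.closedRegion r') : r = r' :=
  funext fun j => interval_code_unique (h j) (closedRegion_sideSign h' j)

theorem interval_nonempty (j : Fin n) (c : Fin (N.J j + 1)) : (N.interval j c).Nonempty := by
  classical
  obtain ⟨m, h1, h2⟩ := Order.exists_between_finsets
    ((Finset.univ.filter fun l : Fin (N.J j) => l.val < c.val).image (N.θ j))
    ((Finset.univ.filter fun l : Fin (N.J j) => c.val ≤ l.val).image (N.θ j)) (by
      simp only [Finset.mem_image, Finset.mem_filter, Finset.mem_univ, true_and]
      rintro _ ⟨l, hl, rfl⟩ _ ⟨l', hl', rfl⟩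
      exact N.θ_strictMono j (Fin.lt_def.2 (by omega)))
  refine ⟨m, fun l => ⟨fun h => h1 _ ?_, fun h => h2 _ ?_⟩⟩ <;>
  exact Finset.mem_image_of_mem _ (by simpa using h)

theorem ne_threshold_of_mem_interval {j : Fin n} {c : Fin (N.J j + 1)} {s : ℝ}
    (h : s ∈ N.interval j c) (l : Fin (N.J j)) : s ≠ N.θ j l := by
  rintro rfl
  simpa using mem_interval_iff.1 h l

theorem level_injOn {e e' : N.Edge} (h : e.1 = e'.1) (h' : N.level e = N.level e') : e = e' := by
  obtain ⟨j, l⟩ := e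
  obtain ⟨j', l'⟩ := e'
  obtain rfl : j = j' := h
  rw [(N.θ_strictMono j).injective (a₁ := l) (a₂ := l') h']

theorem flow_apply (r : N.Code) (x : Fin n → ℝ) (t : ℝ) (j : Fin n) :
    N.flow r x t j = N.F r j + Real.exp (-t) * (x j - N.F r j) := by
  simp [flow]

end GlassNetwork

/-! ### Position of the focal points, and incidence of regions and walls -/

namespace RegionCycle

open GlassNetwork

variable {n k : ℕ} [NeZero k] {N : GlassNetwork n} (C : RegionCycle N k)

/-- The threshold crossed from `O a` to `O (a + 1)`. -/
def edge (a : Fin k) : N.Edge := ⟨C.var a, C.thr a⟩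

/-- The focal points of the cycle lie in their regions up to the switching variable. -/
def IsFocal : Prop := ∀ i j, j ≠ C.var i → N.F (C.O i) j ∈ N.interval j (C.O i j)

variable {C}

theorem thr_or (a : Fin k) : (C.O a (C.var a)).val = (C.thr a).val ∨
    (C.O a (C.var a)).val = (C.thr a).val + 1 := by
  rcases C.switch a with h | h
  · exact Or.inl h.1
  · exact Or.inr h.1

/-- With the switching coordinate of the starting point fixed, the exit time is fixed, so coordinate
j undergoes one contraction s ↦ f + q (s - f). It has to preserve the whole open interval, but if f
lies beyond an endpoint, points close to that endpoint are pushed across it. -/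
theorem IsCyclicAttractor.isFocal (hC : C.IsCyclicAttractor) : C.IsFocal := by
  classical
  intro i j hj
  by_contra hcon
  rw [mem_interval_iff] at hcon
  push Not at hcon
  obtain ⟨l, hl⟩ := hcon
  choose x₀ hx₀ using fun j' => interval_nonempty (N := N) j' (C.O i j')
  have hθ : 0 < |N.F (C.O i) j - N.θ j l| := abs_pos.2 (sub_ne_zero.2 (N.F_ne_θ _ _ _))
  -- the exit time depends only on the switching coordinate
  have key : ∃ q : ℝ, 0 < q ∧ q < 1 ∧ ∀ s ∈ N.interval j (C.O i j),
      N.F (C.O i) j + q * (s - N.F (C.O i) j) ∈ N.interval j (C.O i j) := by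
    let m := C.var i
    let D := N.θ m (C.thr i) - N.F (C.O i) m
    have hD : D ≠ 0 := sub_ne_zero.2 (N.F_ne_θ _ _ _).symm
    have hx : ∀ s ∈ N.interval j (C.O i j), Function.update x₀ j s ∈ N.region (C.O i) := by
      intro s hs j'
      by_cases h : j' = j
      · subst h; simpa using hs
      · simpa [h] using hx₀ j'
    have hsw := C.switch i
    have hxm := hx₀ m
    have hform : ∀ τ : ℝ, N.F (C.O i) m + Real.exp (-τ) * (x₀ m - N.F (C.O i) m)
        = N.θ m (C.thr i) → Real.exp (-τ) = D / (x₀ m - N.F (C.O i) m) := by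
      intro τ h
      have hne : x₀ m - N.F (C.O i) m ≠ 0 := by
        intro h0
        rw [h0, mul_zero, add_zero] at h
        exact N.F_ne_θ _ _ _ h
      rw [eq_div_iff hne]
      simp only [D]
      linarith
    have hex : ∀ s ∈ N.interval j (C.O i j), ∃ τ : ℝ, 0 < τ ∧
        Real.exp (-τ) = D / (x₀ m - N.F (C.O i) m) ∧
        N.F (C.O i) j + Real.exp (-τ) * (s - N.F (C.O i) j) ∈ N.interval j (C.O i j) := by
      intro s hs
      obtain ⟨τ, hτ, -, hw⟩ := hC i _ (hx s hs)
      refine ⟨τ, hτ, hform τ ?_, ?_⟩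
      · have := hw.1
        rwa [flow_apply, Function.update_of_ne (Ne.symm hj)] at this
      · have := hw.2 j hj
        rwa [flow_apply, Function.update_self] at this
    obtain ⟨τ, hτ, hq, -⟩ := hex _ (hx₀ j)
    refine ⟨Real.exp (-τ), Real.exp_pos _, Real.exp_zero ▸ Real.exp_lt_exp.2 (by linarith), fun s hs => ?_⟩
    obtain ⟨τ', -, hq', h⟩ := hex s hs
    rwa [hq, ← hq']
  obtain ⟨q, hq0, hq1, hq⟩ := key
  by_cases hlc : l.val < (C.O i j).val
  · have hc0 : (C.O i j).val - 1 < N.J j := by omega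
    -- The violated threshold `l` may be further out; `l'` is the endpoint of the interval.
    set l' : Fin (N.J j) := ⟨(C.O i j).val - 1, hc0⟩ with hl'
    have hll : N.θ j l ≤ N.θ j l' := (N.θ_strictMono j).monotone (Fin.le_def.2 (by
      simp only [hl']; omega))
    simp only [sideSign, hlc, if_true] at hl
    have hlt : N.F (C.O i) j < N.θ j l' := by
      refine lt_of_le_of_ne (by linarith) (N.F_ne_θ _ _ _)
    set f := N.F (C.O i) j
    -- At the second entry of the minimum, the contraction yields θ - (1 - q)² (θ - f), which is
    -- below the endpoint θ. The first entry keeps `s` below the upper end of the interval.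
    let s := min (x₀ j) (N.θ j l' + (1 - q) * (N.θ j l' - f))
    have hs1 : N.θ j l' < s := lt_min (((hx₀ j) l').1 (by simp only [hl']; omega))
      (by nlinarith)
    have hs : s ∈ N.interval j (C.O i j) := fun p => by
      refine ⟨fun hp => lt_of_le_of_lt ((N.θ_strictMono j).monotone (Fin.le_def.2 ?_)) hs1,
        fun hp => lt_of_le_of_lt (min_le_left _ _) (((hx₀ j) p).2 hp)⟩
      simp only [hl']; omega
    have h1 := (hq s hs l').1 (by simp only [hl']; omega)
    have h2 : s ≤ N.θ j l' + (1 - q) * (N.θ j l' - f) := min_le_right _ _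
    nlinarith [mul_le_mul_of_nonneg_left h2 hq0.le, mul_pos (sub_pos.2 hq1) (sub_pos.2 hlt),
      mul_pos (mul_pos (sub_pos.2 hq1) (sub_pos.2 hq1)) (sub_pos.2 hlt)]
  · have hc0 : (C.O i j).val < N.J j := by omega
    set l' : Fin (N.J j) := ⟨(C.O i j).val, hc0⟩ with hl'
    have hll : N.θ j l' ≤ N.θ j l := (N.θ_strictMono j).monotone (Fin.le_def.2 (by
      simp only [hl']; omega))
    simp only [sideSign, hlc, if_false] at hl
    have hlt : N.θ j l' < N.F (C.O i) j := by
      refine lt_of_le_of_ne (by linarith) (N.F_ne_θ _ _ _).symm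
    set f := N.F (C.O i) j
    let s := max (x₀ j) (N.θ j l' - (1 - q) * (f - N.θ j l'))
    have hs1 : s < N.θ j l' := max_lt (((hx₀ j) l').2 (by simp only [hl']; omega))
      (by nlinarith)
    have hs : s ∈ N.interval j (C.O i j) := fun p => by
      refine ⟨fun hp => lt_of_lt_of_le (((hx₀ j) p).1 hp) (le_max_left _ _),
        fun hp => lt_of_lt_of_le hs1 ((N.θ_strictMono j).monotone (Fin.le_def.2 ?_))⟩
      simp only [hl']; omega
    have h1 := (hq s hs l').2 (by simp only [hl']; omega)
    have h2 : N.θ j l' - (1 - q) * (f - N.θ j l') ≤ s := le_max_right _ _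
    nlinarith [mul_le_mul_of_nonneg_left h2 hq0.le, mul_pos (sub_pos.2 hq1) (sub_pos.2 hlt),
      mul_pos (mul_pos (sub_pos.2 hq1) (sub_pos.2 hq1)) (sub_pos.2 hlt)]

/-- A second crossing of the same threshold in the same direction contradicts the codes; a crossing
back would require the focal point of `O (a + 1)` to be on both sides of the threshold. -/
theorem edge_succ_ne (a : Fin k) : C.edge (a + 1) ≠ C.edge a := by
  intro h
  have hv : C.var (a + 1) = C.var a := congrArg Sigma.fst h
  have hl : N.θ (C.var (a + 1)) (C.thr (a + 1)) = N.θ (C.var a) (C.thr a) :=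
    congrArg N.level h
  have ht : (C.thr (a + 1)).val = (C.thr a).val := by
    have : ∀ e e' : N.Edge, e = e' → e.2.val = e'.2.val := by rintro e _ rfl; rfl
    exact this _ _ h
  have hF : N.F (C.O (a + 1)) (C.var (a + 1)) = N.F (C.O (a + 1)) (C.var a) := by rw [hv]
  have hO : (C.O (a + 1) (C.var (a + 1))).val = (C.O (a + 1) (C.var a)).val := by rw [hv]
  rcases C.switch a with h1 | h1 <;> rcases C.switch (a + 1) with h2 | h2
  · omega
  · linarith [h1.2.2.2, h2.2.2.1]
  · linarith [h1.2.2.2, h2.2.2.1]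
  · omega

/-- The code of the switching variable changes by one, which affects the side of the crossed
threshold only. -/
theorem sideSign_succ_of_ne {a : Fin k} {e : N.Edge} (he : e ≠ C.edge a) :
    sideSign (C.O (a + 1) e.1) e.2 = sideSign (C.O a e.1) e.2 := by
  obtain ⟨j, l⟩ := e
  by_cases hj : j = C.var a
  · subst hj
    have hl : l.val ≠ (C.thr a).val := fun h => he (by rw [edge, Fin.ext h])
    have : l.val < (C.O (a + 1) (C.var a)).val ↔ l.val < (C.O a (C.var a)).val := by
      rcases C.switch a with h1 | h1 <;> omega
    simp only [sideSign, this]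
  · simp only [C.eq_of_ne a j hj]

theorem slack_succ_of_ne {a : Fin k} {e : N.Edge} (he : e ≠ C.edge a) :
    N.slack (C.O (a + 1)) e = N.slack (C.O a) e := by
  ext z <;> simp [slack_apply, sideSign_succ_of_ne he]

/-- Another threshold of the switching variable is on the outer side of the wall. -/
theorem sideSign_mul_pos {a : Fin k} {e : N.Edge} (hv : e.1 = C.var a) (he : e ≠ C.edge a) :
    0 < sideSign (C.O a e.1) e.2 * (N.level (C.edge a) - N.level e) := by
  obtain ⟨j, l⟩ := e
  obtain rfl : j = C.var a := hv
  have hl : l.val ≠ (C.thr a).val := fun h => he (by rw [edge, Fin.ext h])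
  simp only [level, edge, sideSign]
  have h1 := thr_or (C := C) a
  split_ifs with h
  · have : l < C.thr a := Fin.lt_def.2 (by omega)
    linarith [N.θ_strictMono _ this]
  · have : C.thr a < l := Fin.lt_def.2 (by omega)
    linarith [N.θ_strictMono _ this]

theorem mem_wall_iff {a : Fin k} {x : Fin n → ℝ} : x ∈ C.wall a ↔
    x (C.var a) = N.level (C.edge a) ∧ ∀ e, e ≠ C.edge a → 0 < N.slack (C.O a) e (x, 1) := by
  refine ⟨fun h => ⟨h.1, fun e he => ?_⟩, fun h => ⟨h.1, fun j hj => ?_⟩⟩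
  · by_cases hv : e.1 = C.var a
    · have := sideSign_mul_pos hv he
      rw [slack_apply]
      simp only [hv, h.1] at this ⊢
      simpa [level, edge] using this
    · simpa [slack_apply, level] using mem_interval_iff.1 (h.2 e.1 hv) e.2
  · refine mem_interval_iff.2 fun l => ?_
    have he : (⟨j, l⟩ : N.Edge) ≠ C.edge a := fun h' => hj (congrArg Sigma.fst h')
    simpa [slack_apply, level] using h.2 ⟨j, l⟩ he

theorem slack_edge_eq_zero {a : Fin k} {x : Fin n → ℝ} (hx : x ∈ C.wall a) (r : N.Code) :
    N.slack r (C.edge a) (x, 1) = 0 := by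
  rw [slack_apply]
  have := hx.1
  simp [level, edge, this]

theorem wall_subset_closedRegion (a : Fin k) : C.wall a ⊆ N.closedRegion (C.O a) := fun x hx e => by
  by_cases he : e = C.edge a
  · rw [he, slack_edge_eq_zero hx]
  · exact ((mem_wall_iff.1 hx).2 e he).le

theorem wall_subset_closedRegion_succ (a : Fin k) :
    C.wall a ⊆ N.closedRegion (C.O (a + 1)) := fun x hx e => by
  by_cases he : e = C.edge a
  · rw [he, slack_edge_eq_zero hx]
  · rw [slack_succ_of_ne he]
    exact ((mem_wall_iff.1 hx).2 e he).le

theorem not_mem_region_of_mem_wall {a : Fin k} {x : Fin n → ℝ} (hx : x ∈ C.wall a) (r : N.Code) :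
    x ∉ N.region r := fun h => by
  simpa [slack_edge_eq_zero hx] using mem_region_iff.1 h (C.edge a)

/-- The other coordinates lie in open intervals, which fixes their codes. For the switching
coordinate, a value equal to the threshold leaves two codes, those of `O a` and `O (a + 1)`. -/
theorem eq_or_of_mem_wall_of_mem_closedRegion {a b : Fin k} {x : Fin n → ℝ} (hx : x ∈ C.wall a)
    (h : x ∈ N.closedRegion (C.O b)) : b = a ∨ b = a + 1 := by
  have h1 : ∀ j, j ≠ C.var a → C.O b j = C.O a j := fun j hj =>
    (interval_code_unique (hx.2 j hj) (closedRegion_sideSign h j)).symm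
  have h2 : (C.O b (C.var a)).val = (C.thr a).val ∨
      (C.O b (C.var a)).val = (C.thr a).val + 1 := by
    have h3 := closedRegion_sideSign h (C.var a)
    rw [hx.1] at h3
    have hb := (C.O b (C.var a)).isLt
    by_contra hcon
    rcases lt_or_ge (C.O b (C.var a)).val (C.thr a).val with hlt | hge
    · have h4 := h3 ⟨(C.O b (C.var a)).val, by omega⟩
      simp only [sideSign, lt_irrefl, if_false] at h4
      have := N.θ_strictMono (C.var a)
        (show (⟨(C.O b (C.var a)).val, by omega⟩ : Fin _) < C.thr a from Fin.lt_def.2 hlt)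
      linarith
    · have h4 := h3 ⟨(C.thr a).val + 1, by omega⟩
      have h5 : (C.thr a).val + 1 < (C.O b (C.var a)).val := by omega
      simp only [sideSign, h5, if_true] at h4
      have := N.θ_strictMono (C.var a)
        (show C.thr a < (⟨(C.thr a).val + 1, by omega⟩ : Fin _) from Fin.lt_def.2 (by simp))
      linarith
  have h3 : C.O b (C.var a) = C.O a (C.var a) ∨ C.O b (C.var a) = C.O (a + 1) (C.var a) := by
    simp only [Fin.ext_iff]
    rcases C.switch a with h | h <;> omega
  rcases h3 with h3 | h3
  · left
    refine C.O_injective (funext fun j => ?_)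
    by_cases hj : j = C.var a
    · rw [hj, h3]
    · exact h1 j hj
  · right
    refine C.O_injective (funext fun j => ?_)
    by_cases hj : j = C.var a
    · rw [hj, h3]
    · rw [h1 j hj, C.eq_of_ne a j hj]

theorem edge_eq_of_mem_wall {a b : Fin k} {x : Fin n → ℝ} (ha : x ∈ C.wall a)
    (hb : x ∈ C.wall b) : C.edge b = C.edge a := by
  by_contra h
  have := (mem_wall_iff.1 ha).2 _ h
  simp [slack_edge_eq_zero hb] at this

theorem wall_index_unique {a b : Fin k} {x : Fin n → ℝ} (ha : x ∈ C.wall a)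
    (hb : x ∈ C.wall b) : b = a := by
  rcases eq_or_of_mem_wall_of_mem_closedRegion ha (wall_subset_closedRegion b hb) with h | h
  · exact h
  · rw [h] at hb
    exact absurd (edge_eq_of_mem_wall ha hb) (edge_succ_ne a)

end RegionCycle

/-! ### Indices modulo k -/

/-- The cyclic index of a natural number. -/
def cyc (k : ℕ) [NeZero k] (j : ℕ) : Fin k := Fin.ofNat k j

section cyc
variable {k : ℕ} [NeZero k]

theorem cyc_zero : cyc k 0 = 0 := rfl

theorem cyc_val (i : Fin k) : cyc k i.val = i := by
  ext; simp [cyc]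

theorem cyc_add_self (j : ℕ) : cyc k (j + k) = cyc k j := by
  ext; simp [cyc]

theorem cyc_add_mul (j m : ℕ) : cyc k (j + m * k) = cyc k j := by
  ext; simp [cyc]

theorem cyc_succ (j : ℕ) : cyc k (j + 1) = cyc k j + 1 := by
  ext; simp [cyc, Fin.val_add]

theorem cyc_pred : cyc k (k - 1) = -1 := by
  have h : cyc k (k - 1) + 1 = 0 := by
    rw [← cyc_succ, Nat.sub_add_cancel (NeZero.one_le)]
    ext; simp [cyc]
  exact eq_neg_of_add_eq_zero_left h

theorem cyc_eq_iff {i j : ℕ} : cyc k i = cyc k j ↔ i % k = j % k := by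
  simp [cyc, Fin.ext_iff]

end cyc

/-! ### Passages in homogeneous coordinates and the cones they preserve -/

namespace RegionCycle

open GlassNetwork

variable {n k : ℕ} [NeZero k] {N : GlassNetwork n} (C : RegionCycle N k)

/-- The focal point of `O i` in homogeneous coordinates. -/
def focus (i : Fin k) : (Fin n → ℝ) × ℝ := (N.F (C.O i), 1)

/-- The coefficient of the focal point in the passage through `O i`. -/
noncomputable def coef (i : Fin k) : ((Fin n → ℝ) × ℝ) →ₗ[ℝ] ℝ :=
  (N.F (C.O i) (C.var i) - N.θ (C.var i) (C.thr i))⁻¹ •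
    (N.θ (C.var i) (C.thr i) • LinearMap.snd ℝ (Fin n → ℝ) ℝ -
      (LinearMap.proj (C.var i)).comp (LinearMap.fst ℝ (Fin n → ℝ) ℝ))

variable {C}

theorem passage_apply (i : Fin k) (z : (Fin n → ℝ) × ℝ) :
    C.passage i z = z + C.coef i z • C.focus i := rfl

theorem passage_snd (i : Fin k) (z : (Fin n → ℝ) × ℝ) :
    (C.passage i z).2 = z.2 + C.coef i z := by
  simp [passage_apply, focus]

theorem coef_apply (i : Fin k) (z : (Fin n → ℝ) × ℝ) : C.coef i z =
    (N.F (C.O i) (C.var i) - N.level (C.edge i))⁻¹ *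
      (N.level (C.edge i) * z.2 - z.1 (C.var i)) := by
  simp [coef, level, edge]

theorem focus_sub_ne (i : Fin k) : N.F (C.O i) (C.var i) - N.level (C.edge i) ≠ 0 :=
  sub_ne_zero.2 (N.F_ne_θ _ _ _)

theorem passage_var (i : Fin k) (z : (Fin n → ℝ) × ℝ) :
    (C.passage i z).1 (C.var i) = N.level (C.edge i) * (C.passage i z).2 := by
  have h := focus_sub_ne (C := C) i
  simp only [passage_apply, focus, Prod.fst_add, Prod.snd_add, Prod.smul_fst, Prod.smul_snd,
    Pi.add_apply, Pi.smul_apply, smul_eq_mul, coef_apply]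
  field_simp
  ring

theorem coef_eq_zero_iff {i : Fin k} {z : (Fin n → ℝ) × ℝ} :
    C.coef i z = 0 ↔ z.1 (C.var i) = N.level (C.edge i) * z.2 := by
  rw [coef_apply, mul_eq_zero, inv_eq_zero]
  simp only [focus_sub_ne, false_or]
  constructor <;> intro h <;> linarith

/-- The factor is the distance of the focal coordinate from the threshold. So the sign of `coef`
tells on which side of the exit wall a vector lies. -/
theorem exists_slack_edge_eq (i : Fin k) : ∃ b : ℝ, 0 < b ∧ ∀ z,
    N.slack (C.O i) (C.edge i) z = b * C.coef i z := by
  have hd := focus_sub_ne (C := C) i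
  rcases C.switch i with h | h
  · refine ⟨N.F (C.O i) (C.var i) - N.level (C.edge i), sub_pos.2 h.2.2.1, fun z => ?_⟩
    rw [coef_apply, mul_inv_cancel_left₀ hd, slack_apply]
    have : sideSign (C.O i (C.edge i).1) (C.edge i).2 = -1 := by
      simp [sideSign, edge, h.1]
    rw [this]
    simp only [edge]
    ring
  · refine ⟨-(N.F (C.O i) (C.var i) - N.level (C.edge i)), ?_, fun z => ?_⟩
    · have := h.2.2.1
      simp only [level, edge]
      linarith
    rw [coef_apply, neg_mul, mul_inv_cancel_left₀ hd, slack_apply]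
    have : sideSign (C.O i (C.edge i).1) (C.edge i).2 = 1 := by
      simp [sideSign, edge, h.1]
    rw [this]
    simp only [edge]
    ring

theorem coef_nonneg_iff {i : Fin k} {z : (Fin n → ℝ) × ℝ} :
    0 ≤ C.coef i z ↔ 0 ≤ N.slack (C.O i) (C.edge i) z := by
  obtain ⟨b, hb, h⟩ := exists_slack_edge_eq (C := C) i
  rw [h, mul_nonneg_iff_of_pos_left hb]

theorem coef_pos_iff {i : Fin k} {z : (Fin n → ℝ) × ℝ} :
    0 < C.coef i z ↔ 0 < N.slack (C.O i) (C.edge i) z := by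
  obtain ⟨b, hb, h⟩ := exists_slack_edge_eq (C := C) i
  rw [h, mul_pos_iff_of_pos_left hb]

theorem slack_eq_of_mem_hyperplane {a : Fin k} {e : N.Edge} (hv : e.1 = C.var a) (r : N.Code)
    {z : (Fin n → ℝ) × ℝ} (hz : z.1 (C.var a) = N.level (C.edge a) * z.2) :
    N.slack r e z = sideSign (r e.1) e.2 * (N.level (C.edge a) - N.level e) * z.2 := by
  rw [slack_apply, show z.1 e.1 = z.1 (C.var a) by rw [hv], hz]
  ring

theorem slack_passage (r : N.Code) (e : N.Edge) (i : Fin k) (z : (Fin n → ℝ) × ℝ) :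
    N.slack r e (C.passage i z) = N.slack r e z + C.coef i z * N.slack r e (C.focus i) := by
  rw [passage_apply, map_add, map_smul, smul_eq_mul]

theorem IsFocal.slack_focus_pos (hF : C.IsFocal) {a : Fin k} {e : N.Edge} (he : e.1 ≠ C.var a) :
    0 < N.slack (C.O a) e (C.focus a) := by
  have := mem_interval_iff.1 (hF a e.1 he) e.2
  simpa [slack_apply, focus, level] using this

/-! ### Iterated passages -/

variable (C) in
/-- The composition of `j` consecutive passages, the first of which is through `O a`. -/
noncomputable def path (a : ℕ) : ℕ → Module.End ℝ ((Fin n → ℝ) × ℝ)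
  | 0 => 1
  | j + 1 => C.passage (cyc k (a + j)) * path a j

theorem path_zero (a : ℕ) (z : (Fin n → ℝ) × ℝ) : C.path a 0 z = z := rfl

theorem path_succ (a j : ℕ) (z : (Fin n → ℝ) × ℝ) :
    C.path a (j + 1) z = C.passage (cyc k (a + j)) (C.path a j z) := rfl

theorem path_add (a i j : ℕ) (z : (Fin n → ℝ) × ℝ) :
    C.path a (i + j) z = C.path (a + i) j (C.path a i z) := by
  induction j with
  | zero => rfl
  | succ j ih => rw [← add_assoc, path_succ, path_succ, ih, add_assoc]

theorem path_congr {a b : ℕ} (h : cyc k a = cyc k b) (j : ℕ) : C.path a j = C.path b j := by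
  induction j with
  | zero => rfl
  | succ j ih =>
    have : cyc k (a + j) = cyc k (b + j) := by
      rw [cyc_eq_iff] at h ⊢
      exact Nat.ModEq.add_right j h
    rw [path, path, ih, this]

theorem path_returnLinearMap : C.path 0 k = C.returnLinearMap := by
  have key : ∀ j (hj : j ≤ k), C.path 0 j =
      (List.ofFn fun i : Fin j => C.passage (Fin.castLE hj i)).reverse.prod := by
    intro j
    induction j with
    | zero => intro _; simp [path]
    | succ j ih =>
      intro hj
      rw [List.ofFn_succ', List.concat_eq_append, List.reverse_append, List.prod_append, path,
        ih (by omega)]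
      have : cyc k (0 + j) = Fin.castLE hj (Fin.last j) := by
        ext; simp [cyc, Nat.mod_eq_of_lt (show j < k by omega)]
      rw [this]
      simp
  exact key k le_rfl

theorem path_mul (m : ℕ) (z : (Fin n → ℝ) × ℝ) :
    C.path 0 (m * k) z = (C.returnLinearMap ^ m) z := by
  induction m with
  | zero => simp [path]
  | succ m ih =>
    rw [Nat.succ_mul, path_add, ih, pow_succ', Module.End.mul_apply, ← path_returnLinearMap,
      path_congr (b := 0)]
    simpa using cyc_add_mul (k := k) 0 m

theorem path_mul_add (m i : ℕ) (z : (Fin n → ℝ) × ℝ) :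
    C.path 0 (m * k + i) z = C.path 0 i ((C.returnLinearMap ^ m) z) := by
  rw [path_add, path_mul, path_congr (b := 0)]
  simpa using cyc_add_mul (k := k) 0 m

theorem returnLinearMap_var (z : (Fin n → ℝ) × ℝ) : (C.returnLinearMap z).1 (C.var (-1)) =
    N.level (C.edge (-1)) * (C.returnLinearMap z).2 := by
  have : C.returnLinearMap z = C.passage (-1) (C.path 0 (k - 1) z) := by
    have hk : C.path 0 k = C.path 0 (k - 1 + 1) := by
      congr 1
      exact (Nat.sub_add_cancel NeZero.one_le).symm
    rw [← path_returnLinearMap, ← cyc_pred, hk, path_succ, zero_add]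
  rw [this, passage_var]

/-! ### Cones over regions and walls -/

/-- The point with given homogeneous coordinates. -/
noncomputable def _root_.GlassNetwork.dehom (z : (Fin n → ℝ) × ℝ) : Fin n → ℝ := z.2⁻¹ • z.1

theorem _root_.GlassNetwork.dehom_one (x : Fin n → ℝ) : dehom (x, (1 : ℝ)) = x := by simp [dehom]

theorem _root_.GlassNetwork.smul_dehom {z : (Fin n → ℝ) × ℝ} (hz : 0 < z.2) :
    z.2 • (dehom z, (1 : ℝ)) = z := by
  ext <;> simp [dehom, hz.ne']

theorem _root_.GlassNetwork.dehom_smul {c : ℝ} (hc : c ≠ 0) (z : (Fin n → ℝ) × ℝ) :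
    dehom (c • z) = dehom z := by
  simp only [dehom, Prod.smul_fst, Prod.smul_snd, smul_eq_mul, mul_inv, smul_smul]
  congr 1
  field_simp

theorem slack_dehom {z : (Fin n → ℝ) × ℝ} (hz : 0 < z.2) (r : N.Code) (e : N.Edge) :
    N.slack r e z = z.2 * N.slack r e (dehom z, 1) := by
  conv_lhs => rw [← smul_dehom hz, map_smul, smul_eq_mul]

variable (C) in
/-- The cone of points from which the passage through `O a` can start. -/
def StartCone (a : Fin k) (z : (Fin n → ℝ) × ℝ) : Prop :=
  0 < z.2 ∧ (∀ e, 0 ≤ N.slack (C.O a) e z) ∧ 0 < C.coef a z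

variable (C) in
/-- The cone over a wall. -/
def WallCone (a : Fin k) (z : (Fin n → ℝ) × ℝ) : Prop :=
  0 < z.2 ∧ z.1 (C.var a) = N.level (C.edge a) * z.2 ∧
    ∀ e, e ≠ C.edge a → 0 < N.slack (C.O a) e z

theorem wallCone_iff {a : Fin k} {z : (Fin n → ℝ) × ℝ} :
    C.WallCone a z ↔ 0 < z.2 ∧ dehom z ∈ C.wall a := by
  refine and_congr_right fun hz => ?_
  rw [mem_wall_iff]
  refine and_congr ?_ (forall₂_congr fun e _ => ?_)
  · simp only [dehom, Pi.smul_apply, smul_eq_mul]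
    rw [inv_mul_eq_iff_eq_mul₀ hz.ne', mul_comm]
  · rw [slack_dehom hz, mul_pos_iff_of_pos_left hz]

theorem wallCone_one {a : Fin k} {x : Fin n → ℝ} : C.WallCone a (x, 1) ↔ x ∈ C.wall a := by
  rw [wallCone_iff, dehom_one]; simp

theorem startCone_of_mem_region {a : Fin k} {x : Fin n → ℝ} (hx : x ∈ N.region (C.O a)) :
    C.StartCone a (x, 1) :=
  ⟨one_pos, fun e => (mem_region_iff.1 hx e).le, coef_pos_iff.2 (mem_region_iff.1 hx _)⟩

theorem WallCone.startCone {a : Fin k} {z : (Fin n → ℝ) × ℝ} (h : C.WallCone a z) :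
    C.StartCone (a + 1) z := by
  refine ⟨h.1, fun e => ?_, coef_pos_iff.2 ?_⟩
  · by_cases he : e = C.edge a
    · have : N.slack (C.O (a + 1)) e z = 0 := by
        rw [slack_apply, he]
        have := h.2.1
        simp only [edge, level] at this ⊢
        rw [this]; ring
      exact this.ge
    · rw [slack_succ_of_ne he]
      exact (h.2.2 e he).le
  · rw [slack_succ_of_ne (edge_succ_ne a)]
    exact h.2.2 _ (edge_succ_ne a)

theorem StartCone.smul {a : Fin k} {z : (Fin n → ℝ) × ℝ} (h : C.StartCone a z) {c : ℝ}
    (hc : 0 < c) : C.StartCone a (c • z) := by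
  refine ⟨mul_pos hc h.1, fun e => ?_, ?_⟩
  · rw [map_smul]; exact mul_nonneg hc.le (h.2.1 e)
  · rw [map_smul]; exact mul_pos hc h.2.2

/-- For thresholds of other variables the slack grows by a positive multiple of the slack of the
focal point. For those of the switching variable it is determined by the wall just reached. -/
theorem IsFocal.wallCone_passage (hF : C.IsFocal) {a : Fin k} {z : (Fin n → ℝ) × ℝ}
    (h : C.StartCone a z) : C.WallCone a (C.passage a z) := by
  obtain ⟨h1, h2, h3⟩ := h
  have hs : 0 < (C.passage a z).2 := by rw [passage_snd]; linarith
  refine ⟨hs, passage_var a z, fun e he => ?_⟩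
  by_cases hv : e.1 = C.var a
  · rw [slack_eq_of_mem_hyperplane hv _ (passage_var a z)]
    exact mul_pos (sideSign_mul_pos hv he) hs
  · rw [slack_passage]
    have := mul_pos h3 (hF.slack_focus_pos hv)
    linarith [h2 e]

/-- Between the start and the end of a passage, a trajectory is in the open region. -/
theorem IsFocal.dehom_mem_region (hF : C.IsFocal) {a : Fin k} {z : (Fin n → ℝ) × ℝ}
    (h : C.StartCone a z) {r : ℝ} (h0 : 0 < r) (h1 : r < C.coef a z) :
    dehom (z + r • C.focus a) ∈ N.region (C.O a) := by
  have hw := hF.wallCone_passage h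
  have hc := h.2.2
  have hs : 0 < (z + r • C.focus a).2 := by
    have := h.1
    simp only [focus, Prod.snd_add, Prod.smul_snd, smul_eq_mul, mul_one]
    linarith
  -- A point inside the passage is a convex combination, with positive weights, of the start and the
  -- end. The start is strictly inside with respect to the exit threshold, the end with respect to
  -- all others.
  have hcomb : z + r • C.focus a =
      (1 - r / C.coef a z) • z + (r / C.coef a z) • C.passage a z := by
    rw [passage_apply, smul_add, smul_smul, div_mul_cancel₀ _ hc.ne', sub_smul, one_smul]
    abel
  have hr : 0 < r / C.coef a z := div_pos h0 hc
  have hr1 : 0 < 1 - r / C.coef a z := by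
    rw [sub_pos, div_lt_one hc]; exact h1
  refine mem_region_iff.2 fun e => ?_
  have key : 0 < N.slack (C.O a) e (z + r • C.focus a) := by
    rw [hcomb, map_add, map_smul, map_smul, smul_eq_mul, smul_eq_mul]
    by_cases he : e = C.edge a
    · have h5 : 0 < N.slack (C.O a) e z := he ▸ coef_pos_iff.1 hc
      have h6 : N.slack (C.O a) e (C.passage a z) = 0 := by
        rw [slack_apply, he]
        have := passage_var (C := C) a z
        simp only [edge, level] at this ⊢
        rw [this]; ring
      rw [h6, mul_zero, add_zero]
      exact mul_pos hr1 h5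
    · have := mul_pos hr (hw.2.2 e he)
      have := mul_nonneg hr1.le (h.2.1 e)
      linarith
  rw [slack_dehom hs, mul_pos_iff_of_pos_left hs] at key
  exact key

theorem IsFocal.path_cone (hF : C.IsFocal) {a : ℕ} {z : (Fin n → ℝ) × ℝ}
    (h : C.StartCone (cyc k a) z) (j : ℕ) : C.StartCone (cyc k (a + j)) (C.path a j z) ∧
      C.WallCone (cyc k (a + j)) (C.path a (j + 1) z) := by
  have key : C.StartCone (cyc k (a + j)) (C.path a j z) := by
    induction j with
    | zero => exact h
    | succ j ih =>
      rw [← add_assoc, cyc_succ]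
      exact (hF.wallCone_passage ih).startCone
  exact ⟨key, hF.wallCone_passage key⟩

/-! ### Cones given by the thresholds of the cycle -/

variable (C) in
/-- Some variable crosses two different thresholds. -/
def Multi : Prop := ∃ i i', C.var i = C.var i' ∧ C.edge i ≠ C.edge i'

variable (C) in
/-- The closed cone over `O a` given by the thresholds of the cycle. -/
def WeakCone (a : Fin k) (z : (Fin n → ℝ) × ℝ) : Prop :=
  (∀ i, 0 ≤ N.slack (C.O a) (C.edge i) z) ∧ (C.Multi → 0 ≤ z.2)

variable (C) in
/-- The open cone over the wall number `a` given by the thresholds of the cycle. -/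
def StrictCone (a : Fin k) (z : (Fin n → ℝ) × ℝ) : Prop :=
  (∀ i, C.edge i ≠ C.edge a → 0 < N.slack (C.O a) (C.edge i) z) ∧
    z.1 (C.var a) = N.level (C.edge a) * z.2 ∧ (C.Multi → 0 < z.2)

theorem slack_edge_eq_zero_iff {a : Fin k} {z : (Fin n → ℝ) × ℝ} (r : N.Code) :
    N.slack r (C.edge a) z = 0 ↔ z.1 (C.var a) = N.level (C.edge a) * z.2 := by
  rw [slack_apply, mul_eq_zero, or_iff_right (sideSign_ne_zero _ _), sub_eq_zero]
  rfl

theorem StrictCone.weakCone {a : Fin k} {z : (Fin n → ℝ) × ℝ} (h : C.StrictCone a z) :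
    C.WeakCone (a + 1) z := by
  refine ⟨fun i => ?_, fun hM => (h.2.2 hM).le⟩
  by_cases he : C.edge i = C.edge a
  · rw [he, (slack_edge_eq_zero_iff _).2 h.2.1]
  · rw [slack_succ_of_ne he]
    exact (h.1 i he).le

theorem StrictCone.coef_pos {a : Fin k} {z : (Fin n → ℝ) × ℝ} (h : C.StrictCone a z) :
    0 < C.coef (a + 1) z := by
  rw [coef_pos_iff, slack_succ_of_ne (edge_succ_ne a)]
  exact h.1 _ (edge_succ_ne a)

/-- The condition on `z.2` under `Multi` is needed here: the slack of a second crossed threshold of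
the switching variable is a positive multiple of the last coordinate. -/
theorem IsFocal.strictCone_passage (hF : C.IsFocal) {a : Fin k} {z : (Fin n → ℝ) × ℝ}
    (h : C.WeakCone a z) (hc : 0 < C.coef a z) : C.StrictCone a (C.passage a z) := by
  have hs : C.Multi → 0 < (C.passage a z).2 := fun hM => by
    rw [passage_snd]; linarith [h.2 hM]
  refine ⟨fun i he => ?_, passage_var a z, hs⟩
  by_cases hv : (C.edge i).1 = C.var a
  · rw [slack_eq_of_mem_hyperplane hv _ (passage_var a z)]
    exact mul_pos (sideSign_mul_pos hv he) (hs ⟨i, a, hv, he⟩)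
  · rw [slack_passage]
    have := mul_pos hc (hF.slack_focus_pos hv)
    linarith [h.1 i]

theorem WeakCone.succ {a : Fin k} {z : (Fin n → ℝ) × ℝ} (h : C.WeakCone a z)
    (hc : C.coef a z = 0) : C.WeakCone (a + 1) z := by
  refine ⟨fun i => ?_, h.2⟩
  by_cases he : C.edge i = C.edge a
  · rw [he, (slack_edge_eq_zero_iff _).2 (coef_eq_zero_iff.1 hc)]
  · rw [slack_succ_of_ne he]
    exact h.1 i

theorem WeakCone.coef_nonneg {a : Fin k} {z : (Fin n → ℝ) × ℝ} (h : C.WeakCone a z) :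
    0 ≤ C.coef a z := coef_nonneg_iff.2 (h.1 a)

theorem passage_of_coef_eq_zero {a : Fin k} {z : (Fin n → ℝ) × ℝ} (h : C.coef a z = 0) :
    C.passage a z = z := by rw [passage_apply, h, zero_smul, add_zero]

/-- As long as the coefficients vanish, the vector does not move and satisfies further equations.
The first positive coefficient puts it into the strict cone, which is never left again: the next
threshold differs from the one just crossed, so the next coefficient is positive too. -/
theorem IsFocal.path_dichotomy (hF : C.IsFocal) {z : (Fin n → ℝ) × ℝ}
    (h : C.WeakCone 0 z) (j : ℕ) :
    (C.path 0 j z = z ∧ (∀ i < j, C.coef (cyc k i) z = 0) ∧ C.WeakCone (cyc k j) z) ∨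
      ∃ p, p + 1 = j ∧ C.StrictCone (cyc k p) (C.path 0 j z) := by
  induction j with
  | zero => exact Or.inl ⟨rfl, by simp, h⟩
  | succ j ih =>
    rw [path_succ, zero_add]
    rcases ih with ⟨h1, h2, h3⟩ | ⟨p, rfl, h1⟩
    · rw [h1]
      rcases h3.coef_nonneg.eq_or_lt with h4 | h4
      · refine Or.inl ⟨passage_of_coef_eq_zero h4.symm, fun i hi => ?_, ?_⟩
        · rcases Nat.lt_succ_iff_lt_or_eq.1 hi with h5 | rfl
          · exact h2 i h5
          · exact h4.symm
        · rw [cyc_succ]; exact h3.succ h4.symm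
      · exact Or.inr ⟨j, rfl, hF.strictCone_passage h3 h4⟩
    · refine Or.inr ⟨p + 1, rfl, ?_⟩
      have h2 := h1.weakCone
      have h3 := h1.coef_pos
      rw [← cyc_succ] at h2 h3
      exact hF.strictCone_passage h2 h3

theorem path_eq_self {z : (Fin n → ℝ) × ℝ} (h : ∀ i, C.coef i z = 0) (j : ℕ) :
    C.path 0 j z = z := by
  induction j with
  | zero => rfl
  | succ j ih => rw [path_succ, ih, passage_of_coef_eq_zero (h _)]

theorem IsFocal.return_dichotomy (hF : C.IsFocal) {z : (Fin n → ℝ) × ℝ} (h : C.WeakCone 0 z) :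
    (∀ i, C.coef i z = 0) ∨ C.StrictCone (-1) (C.returnLinearMap z) := by
  rcases hF.path_dichotomy h k with ⟨-, h2, -⟩ | ⟨p, hp, h1⟩
  · exact Or.inl fun i => by rw [← cyc_val i]; exact h2 _ i.isLt
  · right
    rw [path_returnLinearMap] at h1
    rwa [← cyc_pred, show k - 1 = p by omega]

/-- One coordinate equals two different levels times `z.2`. -/
theorem snd_eq_zero_of_multi {z : (Fin n → ℝ) × ℝ} (h : ∀ i, C.coef i z = 0) (hM : C.Multi) :
    z.2 = 0 := by
  obtain ⟨i, i', hv, he⟩ := hM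
  have h1 := coef_eq_zero_iff.1 (h i)
  have h2 := coef_eq_zero_iff.1 (h i')
  rw [hv, h2] at h1
  have h3 : N.level (C.edge i') - N.level (C.edge i) ≠ 0 := fun h4 =>
    he (level_injOn hv (sub_eq_zero.1 h4).symm)
  have h4 : (N.level (C.edge i') - N.level (C.edge i)) * z.2 = 0 := by linarith
  exact (mul_eq_zero.1 h4).resolve_left h3

theorem path_snd (z : (Fin n → ℝ) × ℝ) (a j : ℕ) : (C.path a j z).2 =
    z.2 + ∑ i ∈ Finset.range j, C.coef (cyc k (a + i)) (C.path a i z) := by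
  induction j with
  | zero => simp [path]
  | succ j ih => rw [path_succ, passage_snd, Finset.sum_range_succ, ← add_assoc, ← ih]

theorem IsFocal.path_coef_pos (hF : C.IsFocal) {z : (Fin n → ℝ) × ℝ} (h : C.StrictCone (-1) z)
    (j : ℕ) : 0 < C.coef (cyc k j) (C.path 0 j z) := by
  have h0 : C.WeakCone 0 z := by simpa using h.weakCone
  have h1 : 0 < C.coef 0 z := by simpa using h.coef_pos
  rcases hF.path_dichotomy h0 j with ⟨h2, h3, -⟩ | ⟨p, rfl, h2⟩
  · rcases Nat.eq_zero_or_pos j with rfl | hj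
    · rwa [cyc_zero, path_zero]
    · exact absurd (h3 0 hj) h1.ne'
  · rw [cyc_succ]; exact h2.coef_pos

end RegionCycle

/-! ### Limits of perturbed geometric sequences -/

theorem tendsto_zero_of_le_mul_add {x b : ℕ → ℝ} {r : ℝ} (hx : ∀ m, 0 ≤ x m) (hr : 0 ≤ r)
    (hr1 : r < 1) (hb : Tendsto b atTop (𝓝 0)) (h : ∀ m, x (m + 1) ≤ r * x m + b m) :
    Tendsto x atTop (𝓝 0) := by
  have key : ∀ ε : ℝ, 0 < ε → ∃ K, ∀ j, x (K + j) ≤ r ^ j * x K + ε := fun ε hε => by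
    obtain ⟨K, hK⟩ := (hb.eventually_lt_const (show 0 < ε * (1 - r) from
      mul_pos hε (by linarith))).exists_forall_of_atTop
    refine ⟨K, fun j => ?_⟩
    induction j with
    | zero => simp; exact hε.le
    | succ j ih =>
      have h1 := h (K + j)
      have h2 := hK (K + j) (by omega)
      have h3 := mul_le_mul_of_nonneg_left ih hr
      rw [← add_assoc, pow_succ]
      linarith
  rw [Metric.tendsto_atTop]
  intro ε hε
  obtain ⟨K, hK⟩ := key (ε / 2) (by linarith)
  have h1 : Tendsto (fun j => r ^ j * x K) atTop (𝓝 0) := by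
    simpa using (tendsto_pow_atTop_nhds_zero_of_lt_one hr hr1).mul_const (x K)
  obtain ⟨J, hJ⟩ := (h1.eventually_lt_const (show 0 < ε / 2 by linarith)).exists_forall_of_atTop
  refine ⟨K + J, fun m hm => ?_⟩
  obtain ⟨j, rfl⟩ := Nat.exists_eq_add_of_le (show K ≤ m by omega)
  have h2 := hK j
  have h3 := hJ j (by omega)
  rw [Real.dist_eq, sub_zero, abs_of_nonneg (hx _)]
  linarith

theorem tendsto_zero_of_recurrence {E : Type*} [NormedAddCommGroup E] [NormedSpace ℝ E]
    {d b : ℕ → E} {r : ℝ} (hr : 0 ≤ r) (hr1 : r < 1) (hb : Tendsto b atTop (𝓝 0))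
    (h : ∀ m, d (m + 1) = r • (d m + b m)) : Tendsto d atTop (𝓝 0) := by
  rw [tendsto_zero_iff_norm_tendsto_zero] at hb ⊢
  refine tendsto_zero_of_le_mul_add (b := fun m => r * ‖b m‖) (fun m => norm_nonneg _) hr hr1
    (by simpa using hb.const_mul r) fun m => ?_
  rw [h, norm_smul, Real.norm_of_nonneg hr, ← mul_add]
  exact mul_le_mul_of_nonneg_left (norm_add_le _ _) hr

/-- The limit is invariant under multiplication by r, hence zero, while the norms of the sequence
are at least the norm of u. -/
theorem eq_zero_of_tendsto_pow_smul {E : Type*} [NormedAddCommGroup E] [NormedSpace ℝ E]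
    {u l : E} {r : ℝ} (hr : 1 < r) (h : Tendsto (fun m : ℕ => r ^ m • u) atTop (𝓝 l)) :
    u = 0 := by
  have h1 : Tendsto (fun m : ℕ => r ^ (m + 1) • u) atTop (𝓝 (r • l)) := by
    simpa only [pow_succ', mul_smul] using h.const_smul r
  have h2 := tendsto_nhds_unique h1 ((tendsto_add_atTop_iff_nat 1).2 h)
  have h3 : l = 0 := by
    have h4 : (r - 1) • l = 0 := by rw [sub_smul, h2, one_smul, sub_self]
    exact (smul_eq_zero.1 h4).resolve_left (by linarith)
  rw [h3] at h
  have h5 : ‖u‖ ≤ 0 := by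
    refine le_of_tendsto_of_tendsto' tendsto_const_nhds (by simpa using h.norm) fun m => ?_
    rw [norm_smul, Real.norm_of_nonneg (by positivity)]
    exact le_mul_of_one_le_left (norm_nonneg _) (one_le_pow₀ hr.le)
  exact norm_le_zero_iff.1 h5

theorem Module.End.pow_apply_of_eq_smul {E : Type*} [AddCommGroup E] [Module ℝ E]
    {A : Module.End ℝ E} {u : E} {r : ℝ} (h : A u = r • u) (m : ℕ) : (A ^ m) u = r ^ m • u := by
  induction m with
  | zero => simp
  | succ m ih => rw [pow_succ', Module.End.mul_apply, ih, map_smul, h, smul_smul, pow_succ]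

/-! ### The Perron-Frobenius dichotomy for the return map -/

namespace RegionCycle

open GlassNetwork

variable {n k : ℕ} [NeZero k] {N : GlassNetwork n} (C : RegionCycle N k)

/-- The functionals used as coordinates: the thresholds of the cycle other than the one of the last
wall and, if some variable crosses two thresholds, the homogenizing variable. -/
def IsCoord : Option (Fin k) → Prop
  | none => C.Multi
  | some i => C.edge i ≠ C.edge (-1)

/-- The coordinates modulo the common fixed points of all passages. -/
noncomputable def coords : ((Fin n → ℝ) × ℝ) →ₗ[ℝ] ({o // C.IsCoord o} → ℝ) :=
  LinearMap.pi fun o => match o.1 with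
    | none => LinearMap.snd ℝ (Fin n → ℝ) ℝ
    | some i => N.slack (C.O 0) (C.edge i)

/-- The hyperplane of the last wall. -/
noncomputable def hyper : Submodule ℝ ((Fin n → ℝ) × ℝ) :=
  LinearMap.ker (N.slack (C.O 0) (C.edge (-1)))

variable {C}

theorem mem_hyper {z : (Fin n → ℝ) × ℝ} :
    z ∈ C.hyper ↔ z.1 (C.var (-1)) = N.level (C.edge (-1)) * z.2 := by
  rw [hyper, LinearMap.mem_ker, slack_edge_eq_zero_iff]

theorem returnLinearMap_mem_hyper (z : (Fin n → ℝ) × ℝ) : C.returnLinearMap z ∈ C.hyper :=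
  mem_hyper.2 (returnLinearMap_var z)

theorem pow_mem_hyper {z : (Fin n → ℝ) × ℝ} (hz : z ∈ C.hyper) (m : ℕ) :
    (C.returnLinearMap ^ m) z ∈ C.hyper := by
  cases m with
  | zero => simpa using hz
  | succ m =>
    rw [pow_succ', Module.End.mul_apply]
    exact returnLinearMap_mem_hyper _

theorem slack_zero_eq {e : N.Edge} (he : e ≠ C.edge (-1)) :
    N.slack (C.O 0) e = N.slack (C.O (-1)) e := by
  rw [← slack_succ_of_ne he, neg_add_cancel]

theorem weakCone_of_coords {z : (Fin n → ℝ) × ℝ} (hz : z ∈ C.hyper) (h : 0 ≤ C.coords z) :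
    C.WeakCone 0 z := by
  refine ⟨fun i => ?_, fun hM => h ⟨none, hM⟩⟩
  by_cases he : C.edge i = C.edge (-1)
  · rw [he, (slack_edge_eq_zero_iff _).2 (mem_hyper.1 hz)]
  · exact h ⟨some i, he⟩

theorem strictCone_iff_coords {z : (Fin n → ℝ) × ℝ} (hz : z ∈ C.hyper) :
    C.StrictCone (-1) z ↔ ∀ o, 0 < C.coords z o := by
  constructor
  · rintro ⟨h1, -, h3⟩ ⟨o, ho⟩
    cases o with
    | none => exact h3 ho
    | some i =>
      change 0 < N.slack (C.O 0) (C.edge i) z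
      rw [slack_zero_eq ho]
      exact h1 i ho
  · refine fun h => ⟨fun i hi => ?_, mem_hyper.1 hz, fun hM => h ⟨none, hM⟩⟩
    rw [← slack_zero_eq hi]
    exact h ⟨some i, hi⟩

theorem coef_eq_zero_of_coords {z : (Fin n → ℝ) × ℝ} (hz : z ∈ C.hyper) (h : C.coords z = 0)
    (i : Fin k) : C.coef i z = 0 := by
  rw [coef_eq_zero_iff]
  by_cases he : C.edge i = C.edge (-1)
  · have hv : C.var i = C.var (-1) := congrArg Sigma.fst he
    rw [he, hv]
    exact mem_hyper.1 hz
  · exact (slack_edge_eq_zero_iff (C.O 0)).1 (congrFun h ⟨some i, he⟩)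

theorem returnLinearMap_of_coords {z : (Fin n → ℝ) × ℝ} (hz : z ∈ C.hyper)
    (h : C.coords z = 0) : C.returnLinearMap z = z := by
  rw [← path_returnLinearMap]
  exact path_eq_self (coef_eq_zero_of_coords hz h) k

theorem WallCone.strictCone {a : Fin k} {z : (Fin n → ℝ) × ℝ} (h : C.WallCone a z) :
    C.StrictCone a z := ⟨fun _ hi => h.2.2 _ hi, h.2.1, fun _ => h.1⟩

theorem WallCone.mem_hyper {z : (Fin n → ℝ) × ℝ} (h : C.WallCone (-1) z) : z ∈ C.hyper :=
  RegionCycle.mem_hyper.2 h.2.1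

theorem wall_nonempty (a : Fin k) : (C.wall a).Nonempty := by
  classical
  choose x hx using fun j => interval_nonempty (N := N) j (C.O a j)
  refine ⟨Function.update x (C.var a) (N.θ (C.var a) (C.thr a)), by simp, fun j hj => ?_⟩
  simpa [hj] using hx j

theorem IsFocal.wallCone_return (hF : C.IsFocal) {z : (Fin n → ℝ) × ℝ}
    (h : C.WallCone (-1) z) : C.WallCone (-1) (C.returnLinearMap z) := by
  have h0 : C.StartCone (cyc k 0) z := by
    rw [cyc_zero, ← neg_add_cancel]
    exact h.startCone
  have h1 := (hF.path_cone h0 (k - 1)).2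
  rw [Nat.sub_add_cancel NeZero.one_le, path_returnLinearMap, zero_add, cyc_pred] at h1
  exact h1

theorem IsFocal.wallCone_pow (hF : C.IsFocal) {z : (Fin n → ℝ) × ℝ}
    (h : C.WallCone (-1) z) (m : ℕ) : C.WallCone (-1) ((C.returnLinearMap ^ m) z) := by
  induction m with
  | zero => simpa using h
  | succ m ih =>
    rw [pow_succ', Module.End.mul_apply]
    exact hF.wallCone_return ih

theorem IsFocal.snd_lt_return (hF : C.IsFocal) {z : (Fin n → ℝ) × ℝ}
    (h : C.StrictCone (-1) z) : z.2 < (C.returnLinearMap z).2 := by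
  rw [← path_returnLinearMap, path_snd]
  have : 0 < ∑ i ∈ Finset.range k, C.coef (cyc k (0 + i)) (C.path 0 i z) := by
    refine Finset.sum_pos (fun i _ => ?_) ⟨0, Finset.mem_range.2 (NeZero.pos k)⟩
    rw [zero_add]
    exact hF.path_coef_pos h i
  linarith

/-- An eigenvector for an eigenvalue greater than one in the cone given by the thresholds of the
cycle lies over the wall. -/
theorem IsFocal.wallCone_of_eigenvector (hF : C.IsFocal) {w : (Fin n → ℝ) × ℝ} {μ : ℝ}
    (hμ : 1 < μ) (hw : C.StrictCone (-1) w) (h : C.returnLinearMap w = μ • w) :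
    C.WallCone (-1) w := by
  have hs : 0 < w.2 := by
    have := hF.snd_lt_return hw
    rw [h, Prod.smul_snd, smul_eq_mul] at this
    nlinarith
  refine ⟨hs, hw.2.1, fun e he => ?_⟩
  by_cases hinv : ∃ i, e = C.edge i
  · obtain ⟨i, rfl⟩ := hinv
    exact hw.1 i he
  push Not at hinv
  rw [← slack_zero_eq he]
  -- The slack of a threshold that the cycle never crosses, followed along one turn. Each passage
  -- increases it, or makes it positive if the switching variable is that of the threshold.
  let q : ℕ → ℝ := fun j => N.slack (C.O (cyc k j)) e (C.path 0 j w)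
  have hpath : ∀ j, 0 < (C.path 0 j w).2 := fun j => by
    rw [path_snd]
    have : 0 ≤ ∑ i ∈ Finset.range j, C.coef (cyc k (0 + i)) (C.path 0 i w) :=
      Finset.sum_nonneg fun i _ => by rw [zero_add]; exact (hF.path_coef_pos hw i).le
    linarith
  have hstep : ∀ j, q j < q (j + 1) ∨ 0 < q (j + 1) := fun j => by
    simp only [q]
    rw [cyc_succ, slack_succ_of_ne (hinv _)]
    by_cases hv : e.1 = C.var (cyc k j)
    · right
      have hz : (C.path 0 (j + 1) w).1 (C.var (cyc k j)) =
          N.level (C.edge (cyc k j)) * (C.path 0 (j + 1) w).2 := by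
        rw [path_succ, zero_add]; exact passage_var _ _
      rw [slack_eq_of_mem_hyperplane hv _ hz]
      exact mul_pos (sideSign_mul_pos hv (hinv _)) (hpath _)
    · left
      rw [path_succ, zero_add, slack_passage]
      linarith [mul_pos (hF.path_coef_pos hw j) (hF.slack_focus_pos hv)]
  have hq : ∀ j, 0 < q (j + 1) ∨ q 0 < q (j + 1) := fun j => by
    induction j with
    | zero => exact (hstep 0).symm
    | succ j ih =>
      rcases hstep (j + 1) with h1 | h1
      · rcases ih with h2 | h2
        · exact Or.inl (h2.trans h1)
        · exact Or.inr (h2.trans h1)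
      · exact Or.inl h1
  -- A full turn multiplies the slack by μ > 1. So a positive final value, as well as a final value
  -- above the initial one, forces the initial value to be positive.
  have hk : q (k - 1 + 1) = μ * q 0 := by
    simp only [q]
    rw [Nat.sub_add_cancel NeZero.one_le, path_returnLinearMap, h, map_smul, smul_eq_mul,
      path_zero]
    congr 4
    simpa using cyc_add_self (k := k) 0
  have h0 := hq (k - 1)
  rw [hk] at h0
  change 0 < q 0
  rcases h0 with h0 | h0
  · exact pos_of_mul_pos_right h0 (by linarith)
  · nlinarith

/-- Either the return map has an attracting fixed point, or all its orbits converge to a degenerate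
fixed point. -/
theorem IsFocal.perron_dichotomy (hF : C.IsFocal) :
    (∃ (μ : ℝ) (x : Fin n → ℝ), 1 < μ ∧ x ∈ C.wall (-1) ∧
      C.returnLinearMap (x, 1) = μ • (x, (1 : ℝ)) ∧
      ∀ z ∈ C.hyper, ∃ c : ℝ, Tendsto (fun m : ℕ => (μ ^ m)⁻¹ • (C.returnLinearMap ^ m) z) atTop
        (𝓝 (c • (x, (1 : ℝ)))) ∧ (C.WallCone (-1) z → 0 < c)) ∨
    ((∀ ν : ℝ, 1 < ν → ¬ Module.End.HasEigenvalue C.returnLinearMap ν) ∧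
      ∀ z, C.WallCone (-1) z → ∃ p : Fin n → ℝ,
        Tendsto (fun m : ℕ => ((C.returnLinearMap ^ m) z).2⁻¹ • (C.returnLinearMap ^ m) z) atTop
          (𝓝 (p, 1)) ∧
        Tendsto (fun m : ℕ => (((C.returnLinearMap ^ (m + 1)) z).2 -
          ((C.returnLinearMap ^ m) z).2) / ((C.returnLinearMap ^ m) z).2) atTop (𝓝 0)) := by
  have : Fintype {o // C.IsCoord o} := Fintype.ofFinite _
  set H := C.returnLinearMap with hH
  set L := C.coords
  set U := C.hyper
  -- `H - 1` vanishes on the part of `U` where all coordinates are zero, so it depends on the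
  -- coordinates only.
  obtain ⟨G, hG⟩ := LinearMap.exists_factor_on U L (H - 1) fun z hz h => by
    rw [LinearMap.sub_apply, returnLinearMap_of_coords hz h]
    exact sub_self z
  have hHG : ∀ z ∈ U, H z = z + G (L z) := fun z hz => by
    rw [← hG z hz, LinearMap.sub_apply, Module.End.one_apply]
    abel
  let A : ({o // C.IsCoord o} → ℝ) →ₗ[ℝ] ({o // C.IsCoord o} → ℝ) := LinearMap.id + L ∘ₗ G
  have hLA : ∀ z ∈ U, L (H z) = A (L z) := fun z hz => by
    rw [hHG z hz, map_add]
    rfl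
  have hLAm : ∀ z ∈ U, ∀ m : ℕ, L ((H ^ m) z) = (A ^ m) (L z) := fun z hz m => by
    induction m with
    | zero => simp
    | succ m ih =>
      rw [pow_succ', Module.End.mul_apply, hLA _ (pow_mem_hyper hz m), ih, pow_succ',
        Module.End.mul_apply]
  have hGc : Continuous G := G.continuous_of_finiteDimensional
  let S := U.map L
  have hS : ∀ u ∈ S, A u ∈ S := by
    rintro _ ⟨z, hz, rfl⟩
    rw [← hLA z hz]
    exact ⟨_, returnLinearMap_mem_hyper z, rfl⟩
  have hA : ∀ u ∈ S, 0 ≤ u → u ≠ 0 → ∀ o, 0 < A u o := by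
    rintro _ ⟨z, hz, rfl⟩ h0 hne
    rw [← hLA z hz]
    rcases hF.return_dichotomy (weakCone_of_coords hz h0) with h | h
    · refine absurd (funext fun o => ?_) hne
      obtain ⟨o, ho⟩ := o
      cases o with
      | none => exact snd_eq_zero_of_multi h ho
      | some i => exact (slack_edge_eq_zero_iff _).2 (coef_eq_zero_iff.1 (h i))
    · exact (strictCone_iff_coords (returnLinearMap_mem_hyper z)).1 h
  have hne : ∃ u ∈ S, 0 ≤ u ∧ u ≠ 0 := by
    obtain ⟨x₀, hx₀⟩ := wall_nonempty (C := C) (-1)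
    have hw := wallCone_one.2 hx₀
    have hp := (strictCone_iff_coords hw.mem_hyper).1 hw.strictCone
    refine ⟨_, ⟨_, hw.mem_hyper, rfl⟩, fun o => (hp o).le, fun h => ?_⟩
    -- This provides a coordinate: without one, the zero vector would be vacuously positive.
    have he : C.edge 0 ≠ C.edge (-1) := by
      have := edge_succ_ne (C := C) (-1)
      rwa [neg_add_cancel] at this
    have h1 := hp ⟨some 0, he⟩
    have h2 := congrFun h ⟨some 0, he⟩
    rw [Pi.zero_apply] at h2
    exact h1.ne' h2
  obtain ⟨_, ⟨v, hvU, rfl⟩, μ, hμ, hvpos, hAv⟩ :=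
    PerronFrobenius.exists_eigenvector S A hS hA hne
  have hconv : ∀ z ∈ U, ∃ c : ℝ, Tendsto (fun m : ℕ => (μ ^ m)⁻¹ • (A ^ m) (L z)) atTop
      (𝓝 (c • L v)) ∧ ((∀ o, 0 < L z o) → 0 < c) := fun z hz =>
    PerronFrobenius.tendsto_iterate S A hS hA hμ ⟨v, hvU, rfl⟩ hvpos hAv ⟨z, hz, rfl⟩
  have hvs : C.StrictCone (-1) v := (strictCone_iff_coords hvU).2 hvpos
  rcases lt_or_ge 1 μ with hμ1 | hμ1
  · left
    -- `v` is an eigenvector only up to the kernel of `L`. The error `e` is fixed by `H`, so adding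
    -- `(μ - 1)⁻¹ • e` corrects it.
    set e := H v - μ • v with he
    have heU : e ∈ U := U.sub_mem (returnLinearMap_mem_hyper v) (U.smul_mem _ hvU)
    have hLe : L e = 0 := by rw [he, map_sub, map_smul, hLA v hvU, hAv, sub_self]
    have hHe : H e = e := returnLinearMap_of_coords heU hLe
    set w := v + (μ - 1)⁻¹ • e with hw
    have hwU : w ∈ U := U.add_mem hvU (U.smul_mem _ heU)
    have hLw : L w = L v := by rw [hw, map_add, map_smul, hLe, smul_zero, add_zero]
    have hHw : H w = μ • w := by
      have h1 : H v = μ • v + e := by rw [he]; abel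
      have h2 : (1 : ℝ) + (μ - 1)⁻¹ = μ * (μ - 1)⁻¹ := by
        have : μ - 1 ≠ 0 := by linarith
        field_simp
        ring
      rw [hw, map_add, map_smul, hHe, h1, smul_add, smul_smul, ← h2, add_smul, one_smul]
      abel
    have hws : C.StrictCone (-1) w := (strictCone_iff_coords hwU).2 (by
      intro o; exact (congrFun hLw o).symm ▸ hvpos o)
    have hww := hF.wallCone_of_eigenvector hμ1 hws hHw
    have hwx : (dehom w, (1 : ℝ)) = w.2⁻¹ • w := by
      rw [eq_inv_smul_iff₀ hww.1.ne', smul_dehom hww.1]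
    refine ⟨μ, dehom w, hμ1, (wallCone_iff.1 hww).2, ?_, fun z hz => ?_⟩
    · rw [hwx, map_smul, hHw, smul_comm]
    obtain ⟨c, hc, hc'⟩ := hconv z hz
    refine ⟨c * w.2, ?_, fun h => mul_pos (hc' ((strictCone_iff_coords hz).1 h.strictCone))
      hww.1⟩
    have hlim : (c * w.2) • (dehom w, (1 : ℝ)) = c • w := by
      rw [mul_smul, smul_dehom hww.1]
    rw [hlim]
    -- Without its component along `w`, the rescaled orbit has coordinates tending to zero. Since `H
    -- = 1 + G ∘ L` on `U`, it obeys the recursion d ↦ μ⁻¹ (d + G (L d)), in which the perturbation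
    -- tends to zero and the factor is below one.
    set y := z - c • w with hy
    have hyU : y ∈ U := U.sub_mem hz (U.smul_mem _ hwU)
    let d : ℕ → (Fin n → ℝ) × ℝ := fun m => (μ ^ m)⁻¹ • (H ^ m) y
    have hLd : ∀ m, L (d m) = (μ ^ m)⁻¹ • (A ^ m) (L z) - c • L v := fun m => by
      have : (A ^ m) (L w) = μ ^ m • L v := by
        rw [hLw]; exact Module.End.pow_apply_of_eq_smul hAv m
      simp only [d]
      rw [map_smul, hLAm y hyU, hy, map_sub, map_smul, map_sub, map_smul, this, smul_sub,
        smul_comm _ c, inv_smul_smul₀ (pow_pos hμ m).ne']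
    have hLd0 : Tendsto (fun m => G (L (d m))) atTop (𝓝 0) := by
      have h1 : Tendsto (fun m => L (d m)) atTop (𝓝 0) := by
        have := hc.sub_const (c • L v)
        rw [sub_self] at this
        exact this.congr fun m => (hLd m).symm
      have := (hGc.tendsto 0).comp h1
      rwa [map_zero] at this
    have hd : Tendsto d atTop (𝓝 0) := by
      refine tendsto_zero_of_recurrence (r := μ⁻¹) (inv_nonneg.2 hμ.le) (inv_lt_one_of_one_lt₀ hμ1)
        hLd0 fun m => ?_
      have hdU : d m ∈ U := U.smul_mem _ (pow_mem_hyper hyU m)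
      rw [← hHG _ hdU]
      simp only [d]
      rw [map_smul, pow_succ' μ, pow_succ' H, Module.End.mul_apply, mul_inv, smul_smul]
    have h1 := hd.add_const (c • w)
    rw [zero_add] at h1
    refine h1.congr fun m => ?_
    simp only [d, hy]
    rw [map_sub, map_smul, Module.End.pow_apply_of_eq_smul hHw, smul_sub, smul_comm _ c,
      inv_smul_smul₀ (pow_pos hμ m).ne', sub_add_cancel]
  · right
    refine ⟨fun ν hν hev => ?_, fun z hz => ?_⟩
    · obtain ⟨w, hw⟩ := hev.exists_hasEigenvector
      have hHw : H w = ν • w := hw.apply_eq_smul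
      have hwU : w ∈ U := by
        have h1 : w = ν⁻¹ • H w := by rw [hHw, inv_smul_smul₀ (by linarith)]
        rw [h1]
        exact U.smul_mem _ (returnLinearMap_mem_hyper w)
      obtain ⟨c, hc, -⟩ := hconv w hwU
      have hAw : A (L w) = ν • L w := by rw [← hLA w hwU, hHw, map_smul]
      have hLw : L w = 0 := by
        -- An eigenvalue of `A` above μ contradicts the convergence of μ^(-m) A^m, so the
        -- coordinates of `w` vanish. Then `H` fixes `w`, against ν > 1.
        refine eq_zero_of_tendsto_pow_smul (r := ν / μ) ?_ (hc.congr fun m => ?_)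
        · rw [one_lt_div hμ]; linarith
        · rw [Module.End.pow_apply_of_eq_smul hAw, smul_smul, div_pow, div_eq_inv_mul]
      have h1 := returnLinearMap_of_coords hwU hLw
      rw [← hH, hHw] at h1
      have h2 : (ν - 1) • w = 0 := by rw [sub_smul, h1, one_smul, sub_self]
      exact hw.2 ((smul_eq_zero.1 h2).resolve_left (by linarith))
    · have hzU := hz.mem_hyper
      obtain ⟨c, hc, hc'⟩ := hconv z hzU
      have hcpos := hc' ((strictCone_iff_coords hzU).1 hz.strictCone)
      let Z : ℕ → (Fin n → ℝ) × ℝ := fun m => (H ^ m) z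
      let g : ℕ → (Fin n → ℝ) × ℝ := fun m => G ((A ^ m) (L z))
      have hZ0 : Z 0 = z := by simp [Z]
      have hZs : ∀ m, Z (m + 1) = Z m + g m := fun m => by
        simp only [Z, g]
        rw [pow_succ', Module.End.mul_apply, hHG _ (pow_mem_hyper hzU m), hLAm z hzU]
      have hZw : ∀ m, C.WallCone (-1) (Z m) := hF.wallCone_pow hz
      have hmono : Monotone fun m => (Z m).2 := monotone_nat_of_le_succ fun m => by
        have := hF.snd_lt_return (hZw m).strictCone
        simp only [Z] at this ⊢
        rw [pow_succ', Module.End.mul_apply]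
        exact this.le
      have hgs : ∀ m, (Z (m + 1)).2 - (Z m).2 = (g m).2 := fun m => by
        rw [hZs, Prod.snd_add]; ring
      change ∃ p : Fin n → ℝ, Tendsto (fun m => (Z m).2⁻¹ • Z m) atTop (𝓝 (p, 1)) ∧
        Tendsto (fun m => ((Z (m + 1)).2 - (Z m).2) / (Z m).2) atTop (𝓝 0)
      simp only [hgs]
      have hglim : Tendsto (fun m => (μ ^ m)⁻¹ • g m) atTop (𝓝 (c • G (L v))) := by
        have := (hGc.tendsto _).comp hc
        rw [map_smul] at this
        exact this.congr fun m => by simp [g]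
      have htwo : ∀ y : (Fin n → ℝ) × ℝ, y.2 ≠ 0 → y.2⁻¹ • y = (dehom y, 1) := fun y hy => by
        ext <;> simp [dehom, hy]
      -- The increments `g m` are of order μ^m. For μ < 1 the orbit is a Cauchy sequence; for μ = 1
      -- they converge to a vector `l`, and the orbit divided by m tends to `l` by Cesàro means.
      rcases hμ1.lt_or_eq with hμ1 | rfl
      · obtain ⟨K, hK⟩ := hglim.norm.bddAbove_range
        have hgK : ∀ m, ‖g m‖ ≤ K * μ ^ m := fun m => by
          have h1 : ‖(μ ^ m)⁻¹ • g m‖ ≤ K := hK ⟨m, rfl⟩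
          rwa [norm_smul, norm_inv, Real.norm_of_nonneg (pow_pos hμ m).le,
            inv_mul_le_iff₀ (pow_pos hμ m), mul_comm] at h1
        have hcau : CauchySeq Z := cauchySeq_of_le_geometric μ K hμ1 fun m => by
          rw [hZs, dist_self_add_right]
          exact hgK m
        obtain ⟨Zl, hZl⟩ := cauchySeq_tendsto_of_complete hcau
        have hsl : Tendsto (fun m => (Z m).2) atTop (𝓝 Zl.2) :=
          (continuous_snd.tendsto _).comp hZl
        have hpos : 0 < Zl.2 := (hZw 0).1.trans_le (hmono.ge_of_tendsto hsl 0)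
        refine ⟨dehom Zl, ?_, ?_⟩
        · rw [← htwo _ hpos.ne']
          exact (hsl.inv₀ hpos.ne').smul hZl
        · have hg0 : Tendsto (fun m => (g m).2) atTop (𝓝 0) := by
            have := (hsl.comp (tendsto_add_atTop_nat 1)).sub hsl
            rw [sub_self] at this
            exact this.congr hgs
          have h1 := hg0.div hsl hpos.ne'
          rw [zero_div] at h1
          exact h1
      · simp only [one_pow, inv_one, one_smul] at hglim
        set l := c • G (L v) with hl
        -- The last coordinate of `G (L v)` is its increase from `v` to `H v`, which is positive on
        -- the strict cone.
        have hlpos : 0 < l.2 := by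
          have h1 := hF.snd_lt_return hvs
          rw [← hH, hHG v hvU, Prod.snd_add] at h1
          have h2 : 0 < (G (L v)).2 := by linarith
          exact mul_pos hcpos h2
        have hsum : ∀ m, Z m = z + ∑ i ∈ Finset.range m, g i := fun m => by
          induction m with
          | zero => simp [hZ0]
          | succ m ih => rw [hZs, ih, Finset.sum_range_succ, add_assoc]
        have hinv : Tendsto (fun m : ℕ => (m : ℝ)⁻¹) atTop (𝓝 0) :=
          tendsto_inv_atTop_zero.comp tendsto_natCast_atTop_atTop
        have hZl : Tendsto (fun m : ℕ => (m : ℝ)⁻¹ • Z m) atTop (𝓝 l) := by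
          have h1 := (hinv.smul_const z).add hglim.cesaro_smul
          rw [zero_smul, zero_add] at h1
          exact h1.congr fun m => by rw [hsum, smul_add]
        have hsl : Tendsto (fun m : ℕ => (m : ℝ)⁻¹ * (Z m).2) atTop (𝓝 l.2) :=
          (continuous_snd.tendsto _).comp hZl
        refine ⟨dehom l, ?_, ?_⟩
        · rw [← htwo _ hlpos.ne']
          refine ((hsl.inv₀ hlpos.ne').smul hZl).congr' ?_
          filter_upwards [eventually_gt_atTop 0] with m hm
          have hm' : (m : ℝ) ≠ 0 := Nat.cast_ne_zero.2 hm.ne'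
          rw [smul_smul, mul_inv, inv_inv, mul_right_comm, mul_inv_cancel₀ hm', one_mul]
        · have hg2 : Tendsto (fun m => (g m).2) atTop (𝓝 l.2) :=
            (continuous_snd.tendsto _).comp hglim
          have h1 := (hinv.mul hg2).div hsl hlpos.ne'
          rw [zero_mul, zero_div] at h1
          refine h1.congr' ?_
          filter_upwards [eventually_gt_atTop 0] with m hm
          have hm' : (m : ℝ)⁻¹ ≠ 0 := inv_ne_zero (Nat.cast_ne_zero.2 hm.ne')
          exact mul_div_mul_left _ _ hm'

end RegionCycle

/-! ### Existence, uniqueness and maximality of trajectories -/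

theorem exists_cyc_eq {k : ℕ} [NeZero k] (l : Fin k) (a m : ℕ) : ∃ j, m ≤ j ∧ cyc k (a + j) = l := by
  have h1 : a + m ≤ (a + m) * k := Nat.le_mul_of_pos_right _ (NeZero.pos k)
  refine ⟨l.val + (a + m) * k - a, by omega, ?_⟩
  rw [show a + (l.val + (a + m) * k - a) = l.val + (a + m) * k by omega, cyc_add_mul, cyc_val]

namespace RegionCycle

open GlassNetwork

variable {n k : ℕ} [NeZero k] {N : GlassNetwork n} (C : RegionCycle N k)

/-- The points where the velocity is the one of `O a`: the region and the wall where it is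
entered. -/
def StartSet (a : Fin k) : Set (Fin n → ℝ) := {x | x ∈ N.region (C.O a) ∨ x ∈ C.wall (a - 1)}

/-- A solution in `O i` with homogeneous initial point `z` (so that the time there is
`log z.2`). -/
noncomputable def arc (i : Fin k) (z : (Fin n → ℝ) × ℝ) (t : ℝ) : Fin n → ℝ :=
  dehom (z + (Real.exp t - z.2) • C.focus i)

variable {C}

theorem velocity_iff {x v : Fin n → ℝ} :
    C.Velocity x v ↔ ∃ a, x ∈ C.StartSet a ∧ v = -x + N.F (C.O a) := by
  constructor
  · rintro ⟨i, ⟨h, hv⟩ | ⟨h, hv⟩⟩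
    · exact ⟨i, Or.inl h, hv⟩
    · exact ⟨i + 1, Or.inr (by rwa [add_sub_cancel_right]), hv⟩
  · rintro ⟨a, h | h, hv⟩
    · exact ⟨a, Or.inl ⟨h, hv⟩⟩
    · exact ⟨a - 1, Or.inr ⟨h, by rwa [sub_add_cancel]⟩⟩

/-- Hence the velocity is a single-valued function of the point. -/
theorem startSet_index_unique {a b : Fin k} {x : Fin n → ℝ} (ha : x ∈ C.StartSet a)
    (hb : x ∈ C.StartSet b) : a = b := by
  rcases ha with ha | ha <;> rcases hb with hb | hb
  · exact C.O_injective (region_code_unique ha (region_subset_closedRegion _ hb))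
  · exact absurd ha (not_mem_region_of_mem_wall hb _)
  · exact absurd hb (not_mem_region_of_mem_wall ha _)
  · exact sub_left_injective (wall_index_unique hb ha)

theorem velocity_eq {a : Fin k} {x v : Fin n → ℝ} (hx : x ∈ C.StartSet a) (h : C.Velocity x v) :
    v = -x + N.F (C.O a) := by
  obtain ⟨b, hb, hv⟩ := velocity_iff.1 h
  rw [startSet_index_unique hx hb, hv]

theorem startCone_of_mem_startSet {a : Fin k} {x : Fin n → ℝ} (hx : x ∈ C.StartSet a) :
    C.StartCone a (x, 1) := by
  rcases hx with hx | hx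
  · exact startCone_of_mem_region hx
  · have := (wallCone_one.2 hx).startCone
    rwa [sub_add_cancel] at this

theorem WallCone.dehom_mem_startSet {a : Fin k} {z : (Fin n → ℝ) × ℝ} (h : C.WallCone a z) :
    dehom z ∈ C.StartSet (a + 1) :=
  Or.inr (by rw [add_sub_cancel_right]; exact (wallCone_iff.1 h).2)

theorem startSet_subset_closedRegion (a : Fin k) : C.StartSet a ⊆ N.closedRegion (C.O a) := by
  rintro x (hx | hx)
  · exact region_subset_closedRegion _ hx
  · have := wall_subset_closedRegion_succ _ hx
    rwa [sub_add_cancel] at this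

theorem arc_eq (i : Fin k) (z : (Fin n → ℝ) × ℝ) (t : ℝ) :
    C.arc i z t = N.F (C.O i) + Real.exp (-t) • (z.1 - z.2 • N.F (C.O i)) := by
  have h : Real.exp (-t) * Real.exp t = 1 := by rw [← Real.exp_add]; simp
  ext j
  simp only [arc, dehom, focus, Prod.fst_add, Prod.snd_add, Prod.smul_fst, Prod.smul_snd,
    Pi.add_apply, Pi.smul_apply, Pi.sub_apply, smul_eq_mul, mul_one, add_sub_cancel,
    ← Real.exp_neg]
  linear_combination (N.F (C.O i) j) * h

theorem hasDerivAt_arc (i : Fin k) (z : (Fin n → ℝ) × ℝ) (t : ℝ) :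
    HasDerivAt (C.arc i z) (-C.arc i z t + N.F (C.O i)) t := by
  have h1 : HasDerivAt (fun t : ℝ => N.F (C.O i) + Real.exp (-t) • (z.1 - z.2 • N.F (C.O i)))
      ((Real.exp (-t) * -1) • (z.1 - z.2 • N.F (C.O i))) t :=
    (((hasDerivAt_neg t).exp).smul_const _).const_add _
  have h2 : C.arc i z = fun t : ℝ =>
      N.F (C.O i) + Real.exp (-t) • (z.1 - z.2 • N.F (C.O i)) := funext fun t => arc_eq i z t
  rw [h2]
  convert h1 using 1
  funext j
  simp only [Pi.add_apply, Pi.neg_apply, Pi.smul_apply, smul_eq_mul]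
  ring

theorem arc_start {i : Fin k} {z : (Fin n → ℝ) × ℝ} (hz : 0 < z.2) :
    C.arc i z (Real.log z.2) = dehom z := by
  rw [arc, Real.exp_log hz, sub_self, zero_smul, add_zero]

theorem arc_end {i : Fin k} {z : (Fin n → ℝ) × ℝ} (hz : 0 < (C.passage i z).2) :
    C.arc i z (Real.log (C.passage i z).2) = dehom (C.passage i z) := by
  rw [arc, Real.exp_log hz, passage_snd, add_sub_cancel_left, passage_apply]

theorem IsFocal.arc_mem_region (hF : C.IsFocal) {i : Fin k} {z : (Fin n → ℝ) × ℝ}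
    (hz : C.StartCone i z) {t : ℝ} (h1 : z.2 < Real.exp t)
    (h2 : Real.exp t < (C.passage i z).2) : C.arc i z t ∈ N.region (C.O i) := by
  rw [passage_snd] at h2
  exact hF.dehom_mem_region hz (sub_pos.2 h1) (by linarith)

/-- This comes from the condition in `switch` on the focal point of the region being entered: at its
entrance wall the field points inward. -/
theorem slack_focus_succ_pos (a : Fin k) :
    0 < N.slack (C.O (a + 1)) (C.edge a) (C.focus (a + 1)) := by
  rw [slack_apply]
  rcases C.switch a with h | h
  · have hs : sideSign (C.O (a + 1) (C.edge a).1) (C.edge a).2 = 1 :=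
      if_pos (show (C.thr a).val < (C.O (a + 1) (C.var a)).val by omega)
    rw [hs]
    simp only [focus, edge, level, mul_one]
    linarith [h.2.2.2]
  · have hs : sideSign (C.O (a + 1) (C.edge a).1) (C.edge a).2 = -1 :=
      if_neg (show ¬ (C.thr a).val < (C.O (a + 1) (C.var a)).val by omega)
    rw [hs]
    simp only [focus, edge, level, mul_one]
    linarith [h.2.2.2]

/-- On the entrance wall the slack of the crossed threshold is zero and its right derivative is that
of the focal point, which is positive. The remaining slacks stay positive by continuity. -/
theorem eventually_mem_region {a : Fin k} {y : ℝ → Fin n → ℝ} {b : ℝ} {v : Fin n → ℝ}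
    (hy : y b ∈ C.StartSet a) (hv : C.Velocity (y b) v) (hd : HasDerivWithinAt y v (Ici b) b) :
    ∀ᶠ s in 𝓝[>] b, y s ∈ N.region (C.O a) := by
  have hcont : Tendsto y (𝓝[>] b) (𝓝 (y b)) :=
    (hd.continuousWithinAt).mono_left (nhdsWithin_mono _ Ioi_subset_Ici_self)
  rw [velocity_eq hy hv] at hd
  rcases hy with hy | hy
  · exact hcont ((isOpen_region _).mem_nhds hy)
  · obtain ⟨a, rfl⟩ : ∃ a', a = a' + 1 := ⟨a - 1, (sub_add_cancel _ _).symm⟩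
    rw [add_sub_cancel_right] at hy
    simp only [mem_region_iff, eventually_all]
    intro e
    by_cases he : e = C.edge a
    · subst he
      have hlin : HasDerivWithinAt (fun s => N.slack (C.O (a + 1)) (C.edge a) (y s, 1))
          (N.slack (C.O (a + 1)) (C.edge a) (-y b + N.F (C.O (a + 1)), 0)) (Ioi b) b := by
        have h1 : HasDerivWithinAt (fun s => (y s, (1 : ℝ))) (-y b + N.F (C.O (a + 1)), (0 : ℝ))
            (Ioi b) b := (hd.mono Ioi_subset_Ici_self).prodMk (hasDerivWithinAt_const _ _ _)
        exact ((N.slack (C.O (a + 1)) (C.edge a)).toContinuousLinearMap.hasFDerivAt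
          |>.comp_hasDerivWithinAt b h1)
      have hval : N.slack (C.O (a + 1)) (C.edge a) (-y b + N.F (C.O (a + 1)), 0) =
          N.slack (C.O (a + 1)) (C.edge a) (C.focus (a + 1)) := by
        have h2 : (-y b + N.F (C.O (a + 1)), (0 : ℝ)) = C.focus (a + 1) - (y b, 1) := by
          ext <;> simp [focus]
          ring
        rw [h2, map_sub, slack_edge_eq_zero hy, sub_zero]
      rw [hval, hasDerivWithinAt_iff_tendsto_slope' self_notMem_Ioi] at hlin
      filter_upwards [hlin.eventually_const_lt (slack_focus_succ_pos a), self_mem_nhdsWithin]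
        with s hs hsb
      rw [slope_def_field, slack_edge_eq_zero hy, sub_zero] at hs
      exact (div_pos_iff_of_pos_right (sub_pos.2 hsb)).1 hs
    · have h1 : 0 < N.slack (C.O (a + 1)) e (y b, 1) := by
        rw [slack_succ_of_ne he]
        exact (mem_wall_iff.1 hy).2 e he
      have h2 : Continuous fun x : Fin n → ℝ => N.slack (C.O (a + 1)) e (x, 1) := by
        have := (N.slack (C.O (a + 1)) e).continuous_of_finiteDimensional
        fun_prop
      exact ((h2.tendsto _).comp hcont).eventually_const_lt h1

/-- The function e^t (y - f) is continuous with vanishing right derivative, hence constant. -/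
theorem solution_unique {a : Fin k} {y : ℝ → Fin n → ℝ} {b c : ℝ}
    (hc : ContinuousOn y (Icc b c)) (hb : y b ∈ C.StartSet a)
    (hreg : ∀ t ∈ Ioo b c, y t ∈ N.region (C.O a))
    (hd : ∀ t ∈ Ico b c, ∃ v, C.Velocity (y t) v ∧ HasDerivWithinAt y v (Ici t) t) :
    ∀ t ∈ Icc b c, y t = N.F (C.O a) + Real.exp (b - t) • (y b - N.F (C.O a)) := by
  intro t ht
  have h0 : ∀ t ∈ Icc b c, Real.exp t • (y t - N.F (C.O a)) =
      Real.exp b • (y b - N.F (C.O a)) := by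
    refine constant_of_has_deriv_right_zero
      (Real.continuous_exp.continuousOn.smul (hc.sub continuousOn_const)) fun s hs => ?_
    obtain ⟨v, hv, hdv⟩ := hd s hs
    have hys : y s ∈ C.StartSet a := by
      rcases hs.1.eq_or_lt with rfl | h
      · exact hb
      · exact Or.inl (hreg s ⟨h, hs.2⟩)
    rw [velocity_eq hys hv] at hdv
    have h1 := (Real.hasDerivAt_exp s).hasDerivWithinAt (s := Ici s) |>.smul
      (hdv.sub_const (N.F (C.O a)))
    rw [← smul_add, show -y s + N.F (C.O a) + (y s - N.F (C.O a)) = 0 by abel, smul_zero] at h1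
    exact h1
  have h1 := h0 t ht
  rw [sub_eq_add_neg b t, add_comm b, Real.exp_add, mul_smul, ← h1, smul_smul, ← Real.exp_add,
    neg_add_cancel, Real.exp_zero, one_smul, add_sub_cancel]

/-- Continuous induction on time. The field is discontinuous across walls, but from any time of
agreement onward the trajectory enters the open region for a short while, where `solution_unique`
applies. -/
theorem IsFocal.trajectory_eq_arc (hF : C.IsFocal) {T : EReal} {y : ℝ → Fin n → ℝ}
    (hy : C.IsTrajectory T y) {a : Fin k} {z : (Fin n → ℝ) × ℝ} (hz : 1 ≤ z.2)
    (hb : y (Real.log z.2) = dehom z) (hs : dehom z ∈ C.StartSet a) {t₁ : ℝ}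
    (h1 : Real.log z.2 ≤ t₁) (h2 : t₁ ≤ Real.log (C.passage a z).2) (h3 : (t₁ : EReal) < T) :
    y t₁ = C.arc a z t₁ := by
  have hz0 : 0 < z.2 := by linarith
  have hzc : C.StartCone a z := by
    have := (startCone_of_mem_startSet hs).smul hz0
    rwa [smul_dehom hz0] at this
  have hp0 : 0 < (C.passage a z).2 := by rw [passage_snd]; linarith [hzc.2.2]
  set b := Real.log z.2 with hbdef
  have hb0 : 0 ≤ b := Real.log_nonneg hz
  have hsub : Icc b t₁ ⊆ {t : ℝ | 0 ≤ t ∧ (t : EReal) < T} := fun t ht =>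
    ⟨hb0.trans ht.1, (EReal.coe_le_coe_iff.2 ht.2).trans_lt h3⟩
  have hcy : ContinuousOn y (Icc b t₁) := hy.2.1.mono hsub
  have hca : Continuous (C.arc a z) :=
    continuous_iff_continuousAt.2 fun t => (hasDerivAt_arc a z t).continuousAt
  have hcl : IsClosed ({t | y t = C.arc a z t} ∩ Icc b t₁) := by
    have := (hcy.sub hca.continuousOn).preimage_isClosed_of_isClosed isClosed_Icc
      (isClosed_singleton (x := (0 : Fin n → ℝ)))
    convert this using 1
    ext t
    simp [sub_eq_zero, and_comm]
  refine hcl.Icc_subset_of_forall_mem_nhdsWithin (hb.trans (arc_start hz0).symm) ?_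
    (right_mem_Icc.2 h1)
  rintro t ⟨hteq, htb, htt⟩
  have htS : y t ∈ C.StartSet a := by
    rcases htb.eq_or_lt with h | h
    · rw [← h, hb]; exact hs
    · left
      rw [show y t = _ from hteq]
      exact hF.arc_mem_region hzc ((Real.log_lt_iff_lt_exp hz0).1 h)
        ((Real.lt_log_iff_exp_lt hp0).1 (htt.trans_le h2))
  obtain ⟨v, hv, hd⟩ := hy.2.2 t (hsub ⟨htb, htt.le⟩).1 (hsub ⟨htb, htt.le⟩).2
  obtain ⟨u, hu, hsubu⟩ := mem_nhdsGT_iff_exists_Ioo_subset.1 (eventually_mem_region htS hv hd)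
  refine mem_nhdsGT_iff_exists_Ioo_subset.2 ⟨min u t₁, lt_min hu htt, fun s hs' => ?_⟩
  have hst : s < t₁ := hs'.2.trans_le (min_le_right _ _)
  have hsu : s < u := hs'.2.trans_le (min_le_left _ _)
  have hts : t < s := hs'.1
  have h4 := solution_unique (a := a) (hcy.mono (Icc_subset_Icc htb hst.le)) htS
    (fun r hr => hsubu ⟨hr.1, hr.2.trans hsu⟩)
    (fun r hr => hy.2.2 r (hb0.trans (htb.trans hr.1))
      ((EReal.coe_le_coe_iff.2 (hr.2.le.trans hst.le)).trans_lt h3)) s ⟨hts.le, le_rfl⟩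
  change y s = C.arc a z s
  rw [h4, show y t = _ from hteq, arc_eq, arc_eq, add_sub_cancel_left, smul_smul, ← Real.exp_add]
  congr 3
  ring

/-! ### The trajectory through a given point -/

variable (C) in
/-- The time of the `j`-th wall crossing of the trajectory starting at `x` in `O a`. -/
noncomputable def clock (a : ℕ) (x : Fin n → ℝ) (j : ℕ) : ℝ := Real.log (C.path a j (x, 1)).2

variable (C) in
/-- The trajectory starting at `x` in `O a`. -/
noncomputable def traj (a : ℕ) (x : Fin n → ℝ) (t : ℝ) : Fin n → ℝ :=
  -- The number of the arc in progress. At times past the end the set is empty and `j = 0`, a value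
  -- that plays no role.
  let j := sInf {j | t < C.clock a x (j + 1)}
  C.arc (cyc k (a + j)) (C.path a j (x, 1)) t

variable (C) in
/-- The end of the trajectory starting at `x` in `O a`. -/
noncomputable def endTime (a : ℕ) (x : Fin n → ℝ) : EReal := ⨆ j, (C.clock a x j : EReal)

theorem clock_zero (a : ℕ) (x : Fin n → ℝ) : C.clock a x 0 = 0 := by simp [clock, path]

section

variable {a : ℕ} {x : Fin n → ℝ}

theorem IsFocal.path_snd_pos (hF : C.IsFocal) (hx : x ∈ C.StartSet (cyc k a)) (j : ℕ) :
    0 < (C.path a j (x, 1)).2 := (hF.path_cone (startCone_of_mem_startSet hx) j).1.1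

theorem IsFocal.exp_clock (hF : C.IsFocal) (hx : x ∈ C.StartSet (cyc k a)) (j : ℕ) :
    Real.exp (C.clock a x j) = (C.path a j (x, 1)).2 := Real.exp_log (hF.path_snd_pos hx j)

theorem IsFocal.clock_strictMono (hF : C.IsFocal) (hx : x ∈ C.StartSet (cyc k a)) :
    StrictMono (C.clock a x) := strictMono_nat_of_lt_succ fun j => by
  refine Real.log_lt_log (hF.path_snd_pos hx j) ?_
  rw [path_succ, passage_snd]
  linarith [(hF.path_cone (startCone_of_mem_startSet hx) j).1.2.2]

theorem IsFocal.one_le_path_snd (hF : C.IsFocal) (hx : x ∈ C.StartSet (cyc k a)) (j : ℕ) :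
    1 ≤ (C.path a j (x, 1)).2 := by
  rw [← hF.exp_clock hx, Real.one_le_exp_iff, ← clock_zero (C := C) a x]
  exact (hF.clock_strictMono hx).monotone (Nat.zero_le j)

theorem IsFocal.node_mem_startSet (hF : C.IsFocal) (hx : x ∈ C.StartSet (cyc k a)) (j : ℕ) :
    dehom (C.path a j (x, 1)) ∈ C.StartSet (cyc k (a + j)) := by
  cases j with
  | zero => rw [path_zero, dehom_one]; exact hx
  | succ j =>
    rw [← add_assoc, cyc_succ]
    exact (hF.path_cone (startCone_of_mem_startSet hx) j).2.dehom_mem_startSet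

theorem exists_clock_le {t : ℝ} (ht : 0 ≤ t)
    (h : (t : EReal) < C.endTime a x) : ∃ j, C.clock a x j ≤ t ∧ t < C.clock a x (j + 1) := by
  obtain ⟨j, hj⟩ := lt_iSup_iff.1 h
  rw [EReal.coe_lt_coe_iff] at hj
  classical
  have hex : ∃ j, t < C.clock a x j := ⟨j, hj⟩
  have h1 := Nat.find_spec hex
  have h2 : Nat.find hex ≠ 0 := fun h0 => by
    rw [h0, clock_zero] at h1
    linarith
  obtain ⟨i, hi⟩ := Nat.exists_eq_succ_of_ne_zero h2
  refine ⟨i, not_lt.1 (Nat.find_min hex (by omega)), ?_⟩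
  rwa [hi] at h1

/-- Consecutive arcs agree at their common node, so the right endpoint is included; this gives left
continuity at the nodes. -/
theorem IsFocal.traj_eq (hF : C.IsFocal) (hx : x ∈ C.StartSet (cyc k a)) {j : ℕ} {t : ℝ}
    (h1 : C.clock a x j ≤ t) (h2 : t ≤ C.clock a x (j + 1)) :
    C.traj a x t = C.arc (cyc k (a + j)) (C.path a j (x, 1)) t := by
  have hm := hF.clock_strictMono hx
  have key : ∀ {j : ℕ} {t : ℝ}, C.clock a x j ≤ t → t < C.clock a x (j + 1) →
      C.traj a x t = C.arc (cyc k (a + j)) (C.path a j (x, 1)) t := fun {j t} h1 h2 => by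
    have : sInf {j | t < C.clock a x (j + 1)} = j := by
      refine le_antisymm (Nat.sInf_le h2) (le_csInf ⟨j, h2⟩ fun i hi => ?_)
      have := hm.lt_iff_lt.1 (h1.trans_lt hi)
      omega
    simp only [traj, this]
  rcases h2.lt_or_eq with h2 | rfl
  · exact key h1 h2
  · rw [key le_rfl (hm (Nat.lt_succ_self _))]
    have hp := hF.path_snd_pos hx (j + 1)
    have e1 : C.arc (cyc k (a + (j + 1))) (C.path a (j + 1) (x, 1)) (C.clock a x (j + 1)) =
        dehom (C.path a (j + 1) (x, 1)) := arc_start hp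
    rw [e1]
    exact (arc_end hp).symm

theorem IsFocal.isTrajectory_traj (hF : C.IsFocal) (hx : x ∈ C.StartSet (cyc k a)) :
    C.IsTrajectory (C.endTime a x) (C.traj a x) := by
  have hm := hF.clock_strictMono hx
  have hder : ∀ {j : ℕ} {t : ℝ}, C.clock a x j ≤ t → t < C.clock a x (j + 1) →
      HasDerivWithinAt (C.traj a x)
        (-C.traj a x t + N.F (C.O (cyc k (a + j)))) (Ici t) t := fun {j t} h1 h2 => by
    rw [hF.traj_eq hx h1 h2.le]
    refine (hasDerivAt_arc _ _ t).hasDerivWithinAt.congr_of_eventuallyEq ?_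
      (hF.traj_eq hx h1 h2.le)
    filter_upwards [Ico_mem_nhdsGE h2] with s hs
    exact hF.traj_eq hx (h1.trans hs.1) hs.2.le
  refine ⟨?_, fun t ht => ?_, fun t ht0 ht => ?_⟩
  · refine lt_iSup_iff.2 ⟨1, ?_⟩
    have := hm (Nat.zero_lt_one)
    rw [clock_zero] at this
    exact_mod_cast this
  · obtain ⟨j, h1, h2⟩ := exists_clock_le ht.1 ht.2
    have hleft : ContinuousWithinAt (C.traj a x) (Icc 0 t) t := by
      have key : ∀ i, C.clock a x i < t → t ≤ C.clock a x (i + 1) →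
          ContinuousWithinAt (C.traj a x) (Icc 0 t) t := fun i hi1 hi2 => by
        refine ((hasDerivAt_arc (C := C) (cyc k (a + i)) (C.path a i (x, 1)) t
          ).continuousAt.continuousWithinAt).congr_of_eventuallyEq ?_
            (hF.traj_eq hx hi1.le hi2)
        filter_upwards [mem_nhdsWithin_of_mem_nhds (Ioi_mem_nhds hi1), self_mem_nhdsWithin]
          with s hs hs'
        exact hF.traj_eq hx (le_of_lt hs) (hs'.2.trans hi2)
      rcases h1.lt_or_eq with h1 | rfl
      · exact key j h1 h2.le
      · cases j with
        | zero => rw [clock_zero, Icc_self]; exact continuousWithinAt_singleton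
        | succ i => exact key i (hm (Nat.lt_succ_self i)) le_rfl
    refine (hleft.union (hder h1 h2).continuousWithinAt).mono fun s hs => ?_
    rcases le_total s t with h | h
    · exact Or.inl ⟨hs.1, h⟩
    · exact Or.inr h
  · obtain ⟨j, h1, h2⟩ := exists_clock_le ht0 ht
    refine ⟨_, velocity_iff.2 ⟨cyc k (a + j), ?_, rfl⟩, hder h1 h2⟩
    rw [hF.traj_eq hx h1 h2.le]
    have hp := hF.path_snd_pos hx j
    rcases h1.lt_or_eq with h1 | h1
    · left
      refine hF.arc_mem_region (hF.path_cone (startCone_of_mem_startSet hx) j).1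
        ((Real.log_lt_iff_lt_exp hp).1 h1) ?_
      exact (Real.lt_log_iff_exp_lt (hF.path_snd_pos hx (j + 1))).1 h2
    · rw [← h1, show C.arc _ _ (C.clock a x j) = _ from arc_start hp]
      exact hF.node_mem_startSet hx j

theorem IsFocal.eq_arc_of_isTrajectory (hF : C.IsFocal) {T : EReal} {y : ℝ → Fin n → ℝ}
    (hy : C.IsTrajectory T y) (h0 : y 0 = x) (hx : x ∈ C.StartSet (cyc k a)) (j : ℕ) :
    ((C.clock a x j : EReal) < T → y (C.clock a x j) = dehom (C.path a j (x, 1))) ∧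
    ∀ t : ℝ, C.clock a x j ≤ t → t ≤ C.clock a x (j + 1) → (t : EReal) < T →
      y t = C.arc (cyc k (a + j)) (C.path a j (x, 1)) t := by
  have hm := hF.clock_strictMono hx
  have step : ∀ j, ((C.clock a x j : EReal) < T →
      y (C.clock a x j) = dehom (C.path a j (x, 1))) →
      ∀ t : ℝ, C.clock a x j ≤ t → t ≤ C.clock a x (j + 1) → (t : EReal) < T →
      y t = C.arc (cyc k (a + j)) (C.path a j (x, 1)) t := fun j h t h1 h2 h3 =>
    hF.trajectory_eq_arc hy (hF.one_le_path_snd hx j)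
      (h ((EReal.coe_le_coe_iff.2 h1).trans_lt h3)) (hF.node_mem_startSet hx j) h1 h2 h3
  have main : (C.clock a x j : EReal) < T → y (C.clock a x j) = dehom (C.path a j (x, 1)) := by
    induction j with
    | zero => intro _; rw [clock_zero, path_zero, dehom_one, h0]
    | succ j ih =>
      intro h
      rw [step j ih _ (hm (Nat.lt_succ_self j)).le le_rfl h]
      exact arc_end (hF.path_snd_pos hx (j + 1))
  exact ⟨main, step j main⟩

theorem IsFocal.eq_traj_of_isTrajectory (hF : C.IsFocal) {T : EReal} {y : ℝ → Fin n → ℝ}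
    (hy : C.IsTrajectory T y) (h0 : y 0 = x) (hx : x ∈ C.StartSet (cyc k a)) {t : ℝ} (ht : 0 ≤ t)
    (h1 : (t : EReal) < T) (h2 : (t : EReal) < C.endTime a x) : y t = C.traj a x t := by
  obtain ⟨j, hj1, hj2⟩ := exists_clock_le ht h2
  rw [hF.traj_eq hx hj1 hj2.le, (hF.eq_arc_of_isTrajectory hy h0 hx j).2 t hj1 hj2.le h1]

/-- A region contains no point on a threshold, and the wall number i contains none on the threshold
crossed next, which is a different one. -/
theorem not_velocity_of_forall_eq {x v : Fin n → ℝ}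
    (h : ∀ i, x (C.var i) = N.level (C.edge i)) : ¬ C.Velocity x v := by
  rintro ⟨i, ⟨hx, -⟩ | ⟨hx, -⟩⟩
  · exact ne_threshold_of_mem_interval (hx (C.var i)) (C.thr i) (h i)
  · have h1 := (mem_wall_iff.1 hx).2 _ (edge_succ_ne i)
    have h2 : N.slack (C.O i) (C.edge (i + 1)) (x, 1) = 0 :=
      (slack_edge_eq_zero_iff _).2 (by simpa using h (i + 1))
    exact h1.ne' h2

/-- If the trajectory lived longer, the crossing times would converge to a finite time inside its
domain. Its position there is a limit of points on every wall, hence lies on all thresholds of the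
cycle, where no velocity is defined. -/
theorem IsFocal.isMaximalTrajectory_endTime (hF : C.IsFocal) {T : EReal} {y : ℝ → Fin n → ℝ}
    (hy : C.IsMaximalTrajectory T y) (h0 : y 0 = x) (hx : x ∈ C.StartSet (cyc k a)) :
    T = C.endTime a x := by
  refine le_antisymm (not_lt.1 fun hlt => ?_) (hy.2 _ _ (hF.isTrajectory_traj hx)
    fun t ht h1 h2 => (hF.eq_traj_of_isTrajectory hy.1 h0 hx ht h1 h2).symm)
  obtain ⟨q, hq1, hq2⟩ := EReal.lt_iff_exists_real_btwn.1 hlt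
  have hm := hF.clock_strictMono hx
  have hle : ∀ j, C.clock a x j ≤ q := fun j =>
    EReal.coe_le_coe_iff.1 ((le_iSup (fun j => (C.clock a x j : EReal)) j).trans hq1.le)
  have hbdd : BddAbove (range (C.clock a x)) := ⟨q, by rintro _ ⟨j, rfl⟩; exact hle j⟩
  have hlim := tendsto_atTop_ciSup hm.monotone hbdd
  set s := ⨆ j, C.clock a x j
  have hs0 : 0 ≤ s := by
    rw [← clock_zero (C := C) a x]
    exact le_ciSup hbdd 0
  have hsT : (s : EReal) < T := (EReal.coe_le_coe_iff.2 (ciSup_le hle)).trans_lt hq2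
  have hclT : ∀ j, (C.clock a x j : EReal) < T := fun j =>
    (EReal.coe_le_coe_iff.2 (hle j)).trans_lt hq2
  have hnode : Tendsto (fun j => dehom (C.path a j (x, 1))) atTop (𝓝 (y s)) := by
    have h1 : Tendsto (C.clock a x) atTop (𝓝[{t : ℝ | 0 ≤ t ∧ (t : EReal) < T}] s) := by
      refine tendsto_nhdsWithin_iff.2 ⟨hlim, Eventually.of_forall fun j => ⟨?_, hclT j⟩⟩
      rw [← clock_zero (C := C) a x]
      exact hm.monotone (Nat.zero_le j)
    exact ((hy.1.2.1 s ⟨hs0, hsT⟩).tendsto.comp h1).congr fun j =>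
      (hF.eq_arc_of_isTrajectory hy.1 h0 hx j).1 (hclT j)
  obtain ⟨v, hv, -⟩ := hy.1.2.2 s hs0 hsT
  refine not_velocity_of_forall_eq (fun i => ?_) hv
  have hcl : IsClosed {x : Fin n → ℝ | x (C.var i) = N.level (C.edge i)} :=
    isClosed_eq (continuous_apply _) continuous_const
  refine hcl.mem_of_frequently_of_tendsto (frequently_atTop.2 fun m => ?_) hnode
  obtain ⟨j, hj, hji⟩ := exists_cyc_eq i a m
  refine ⟨j + 1, by omega, ?_⟩
  have := (wallCone_iff.1 (hF.path_cone (startCone_of_mem_startSet hx) j).2).2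
  rw [hji] at this
  exact this.1

/-- The points of a maximal trajectory in homogeneous coordinates. -/
theorem IsFocal.maximal_eq_dehom (hF : C.IsFocal) {T : EReal} {y : ℝ → Fin n → ℝ}
    (hy : C.IsMaximalTrajectory T y) (h0 : y 0 = x) (hx : x ∈ C.StartSet (cyc k a)) {t : ℝ}
    (ht : 0 ≤ t) (h1 : (t : EReal) < T) : ∃ j r, 0 ≤ r ∧
      r ≤ C.coef (cyc k (a + j)) (C.path a j (x, 1)) ∧
      Real.exp t = (C.path a j (x, 1)).2 + r ∧
      Real.exp t < (C.path a (j + 1) (x, 1)).2 ∧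
      y t = dehom (C.path a j (x, 1) + r • C.focus (cyc k (a + j))) := by
  obtain ⟨j, hj1, hj2⟩ :=
    exists_clock_le (C := C) ht (h1.trans_eq (hF.isMaximalTrajectory_endTime hy h0 hx))
  have e1 := (Real.log_le_iff_le_exp (hF.path_snd_pos hx j)).1 hj1
  have e2 := (Real.lt_log_iff_exp_lt (hF.path_snd_pos hx (j + 1))).1 hj2
  have e3 := e2
  rw [path_succ, passage_snd] at e3
  refine ⟨j, Real.exp t - (C.path a j (x, 1)).2, by linarith, by linarith, by ring, e2, ?_⟩
  exact (hF.eq_arc_of_isTrajectory hy.1 h0 hx j).2 t hj1 hj2.le h1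

end

theorem isMaximalTrajectory_top {y : ℝ → Fin n → ℝ} (hy : C.IsTrajectory ⊤ y) :
    C.IsMaximalTrajectory ⊤ y := ⟨hy, fun _ _ _ _ => le_top⟩

theorem IsTrajectory.exists_startSet {T : EReal} {y : ℝ → Fin n → ℝ} (hy : C.IsTrajectory T y) :
    ∃ a : Fin k, y 0 ∈ C.StartSet (cyc k a.val) := by
  obtain ⟨v, hv, -⟩ := hy.2.2 0 le_rfl (by exact_mod_cast hy.1)
  obtain ⟨a, ha, -⟩ := velocity_iff.1 hv
  exact ⟨a, by rwa [cyc_val]⟩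

theorem IsTrajectory.shift {y : ℝ → Fin n → ℝ} (hy : C.IsTrajectory ⊤ y) {s : ℝ} (hs : 0 ≤ s) :
    C.IsTrajectory ⊤ fun t => y (t + s) := by
  refine ⟨hy.1, ?_, fun t ht _ => ?_⟩
  · refine hy.2.1.comp (by fun_prop) fun t ht => ⟨add_nonneg ht.1 hs, EReal.coe_lt_top _⟩
  · obtain ⟨v, hv, hd⟩ := hy.2.2 (t + s) (by linarith) (EReal.coe_lt_top _)
    refine ⟨v, hv, ?_⟩
    have h1 : HasDerivWithinAt (fun t : ℝ => t + s) 1 (Ici t) t :=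
      (hasDerivWithinAt_id t _).add_const s
    have := hd.scomp t h1 fun r hr => add_le_add_left hr s
    rw [one_smul] at this
    exact this

end RegionCycle

/-! ### Convergence to the spine -/

namespace GlassNetwork

variable {n : ℕ}

/-- Points that are close in homogeneous coordinates are close. -/
theorem dist_dehom_le {q q' : (Fin n → ℝ) × ℝ} {η : ℝ} (hq' : 0 < q'.2) (hη : η ≤ 1 / 2)
    (h : ‖q - q'‖ ≤ η * q'.2) : dist (dehom q) (dehom q') ≤ 2 * η * (1 + ‖dehom q'‖) := by
  have h1 : ‖q.1 - q'.1‖ ≤ η * q'.2 := (norm_fst_le (q - q')).trans h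
  have h2 : |q.2 - q'.2| ≤ η * q'.2 := (norm_snd_le (q - q')).trans h
  have h3 : q'.2 / 2 ≤ q.2 := by
    have := (abs_le.1 h2).1
    nlinarith
  have hq : 0 < q.2 := by linarith
  have hη0 : 0 ≤ η * q'.2 := (norm_nonneg _).trans h
  have e : dehom q - dehom q' = q.2⁻¹ • ((q.1 - q'.1) + (q'.2 - q.2) • dehom q') := by
    ext j
    simp only [dehom, Pi.sub_apply, Pi.smul_apply, Pi.add_apply, smul_eq_mul]
    field_simp
    ring
  rw [dist_eq_norm, e, norm_smul, norm_inv, Real.norm_of_nonneg hq.le, inv_mul_le_iff₀ hq]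
  have h4 : ‖q.1 - q'.1 + (q'.2 - q.2) • dehom q'‖ ≤ η * q'.2 * (1 + ‖dehom q'‖) := by
    refine (norm_add_le _ _).trans ?_
    rw [norm_smul, Real.norm_eq_abs, abs_sub_comm]
    have := mul_le_mul_of_nonneg_right h2 (norm_nonneg (dehom q'))
    linarith
  refine h4.trans ?_
  have h5 : 0 ≤ η := nonneg_of_mul_nonneg_left hη0 hq'
  have h6 : 0 ≤ η * (1 + ‖dehom q'‖) := mul_nonneg h5 (by positivity)
  have := mul_le_mul_of_nonneg_right h3 h6
  linarith

end GlassNetwork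

namespace RegionCycle

open GlassNetwork

variable {n k : ℕ} [NeZero k] {N : GlassNetwork n} {C : RegionCycle N k}

/-- From `O a`, the last wall is reached after k - a passages; then come m full turns and i more
passages. -/
theorem path_var_block {a j : ℕ} (ha : a < k) (z : (Fin n → ℝ) × ℝ) {m i : ℕ}
    (hj : j = (k - a) + (m * k + i)) : cyc k (a + j) = cyc k i ∧
      C.path a j z = C.path 0 i ((C.returnLinearMap ^ m) (C.path a (k - a) z)) := by
  subst hj
  constructor
  · rw [show a + (k - a + (m * k + i)) = i + (m + 1) * k by rw [Nat.succ_mul]; omega, cyc_add_mul]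
  · rw [path_add, ← path_mul_add, path_congr (b := 0)]
    rw [show a + (k - a) = 0 + k by omega, cyc_add_self]

theorem exists_block {a : ℕ} (ha : a < k) (z : (Fin n → ℝ) × ℝ) (M : ℕ) {j : ℕ}
    (hj : (k - a) + M * k ≤ j) : ∃ m i, M ≤ m ∧ i < k ∧ cyc k (a + j) = cyc k i ∧
      C.path a j z = C.path 0 i ((C.returnLinearMap ^ m) (C.path a (k - a) z)) := by
  have hk := NeZero.pos k
  refine ⟨(j - (k - a)) / k, (j - (k - a)) % k, ?_, Nat.mod_lt _ hk, path_var_block ha z ?_⟩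
  · rw [Nat.le_div_iff_mul_le hk]; omega
  · have := Nat.div_add_mod' (j - (k - a)) k
    omega

theorem IsFocal.wallCone_block (hF : C.IsFocal) {a : ℕ} (ha : a < k) {z : (Fin n → ℝ) × ℝ}
    (hz : C.StartCone (cyc k a) z) : C.WallCone (-1) (C.path a (k - a) z) := by
  have h := (hF.path_cone hz (k - a - 1)).2
  rwa [show k - a - 1 + 1 = k - a by omega, show a + (k - a - 1) = k - 1 by omega, cyc_pred] at h

theorem exists_norm_focus_le (C : RegionCycle N k) :
    ∃ R : ℝ, 0 ≤ R ∧ ∀ i, ‖C.focus i‖ ≤ R :=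
  ⟨∑ i, ‖C.focus i‖, Finset.sum_nonneg fun _ _ => norm_nonneg _, fun i =>
    Finset.single_le_sum (f := fun i => ‖C.focus i‖) (fun _ _ => norm_nonneg _)
      (Finset.mem_univ i)⟩

theorem IsFocal.path_snd_mono (hF : C.IsFocal) {a : ℕ} {z : (Fin n → ℝ) × ℝ}
    (hz : C.StartCone (cyc k a) z) : Monotone fun j => (C.path a j z).2 :=
  monotone_nat_of_le_succ fun j => by
    rw [path_succ, passage_snd]
    linarith [(hF.path_cone hz j).1.2.2]

/-- Every passage adds a positive multiple of some (f, 1) and increases the last coordinate by the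
same multiple. -/
theorem IsFocal.norm_path_sub_le (hF : C.IsFocal) {R : ℝ} (hR : ∀ i, ‖C.focus i‖ ≤ R) {a : ℕ}
    {z : (Fin n → ℝ) × ℝ} (hz : C.StartCone (cyc k a) z) (j : ℕ) :
    ‖C.path a j z - z‖ ≤ R * ((C.path a j z).2 - z.2) := by
  induction j with
  | zero => simp [path]
  | succ j ih =>
    have h1 := (hF.path_cone hz j).1.2.2
    have h2 : C.path a (j + 1) z - z = (C.path a j z - z) +
        C.coef (cyc k (a + j)) (C.path a j z) • C.focus (cyc k (a + j)) := by
      rw [path_succ, passage_apply]; abel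
    rw [h2, path_succ, passage_snd]
    refine (norm_add_le _ _).trans ?_
    rw [norm_smul, Real.norm_of_nonneg h1.le]
    have := mul_le_mul_of_nonneg_left (hR (cyc k (a + j))) h1.le
    linarith

/-- Convergence of the return map to a degenerate fixed point, along the whole trajectory. -/
theorem IsFocal.tendsto_of_return (hF : C.IsFocal)
    (hconv : ∀ z, C.WallCone (-1) z → ∃ p : Fin n → ℝ,
      Tendsto (fun m : ℕ => ((C.returnLinearMap ^ m) z).2⁻¹ • (C.returnLinearMap ^ m) z) atTop
        (𝓝 (p, 1)) ∧
      Tendsto (fun m : ℕ => (((C.returnLinearMap ^ (m + 1)) z).2 -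
        ((C.returnLinearMap ^ m) z).2) / ((C.returnLinearMap ^ m) z).2) atTop (𝓝 0))
    {a : ℕ} (ha : a < k) {x : Fin n → ℝ} (hx : x ∈ C.StartSet (cyc k a)) :
    ∃ p : Fin n → ℝ, ∀ ε : ℝ, 0 < ε → ∃ J, ∀ j, J ≤ j → ∀ r, 0 ≤ r →
      r ≤ C.coef (cyc k (a + j)) (C.path a j (x, 1)) →
      dist (dehom (C.path a j (x, 1) + r • C.focus (cyc k (a + j)))) p < ε := by
  have hxs := startCone_of_mem_startSet hx
  have hw := hF.wallCone_block ha hxs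
  obtain ⟨R, hR0, hR⟩ := exists_norm_focus_le C
  obtain ⟨p, hp1, hp2⟩ := hconv _ hw
  set z := C.path a (k - a) (x, 1)
  refine ⟨p, fun ε hε => ?_⟩
  -- The first term is the error at the beginning of the turn, the second bounds the displacement
  -- during the turn, relative to the last coordinate.
  have hη : Tendsto (fun m : ℕ =>
      ‖((C.returnLinearMap ^ m) z).2⁻¹ • (C.returnLinearMap ^ m) z - (p, (1 : ℝ))‖ +
      R * ((((C.returnLinearMap ^ (m + 1)) z).2 -
        ((C.returnLinearMap ^ m) z).2) / ((C.returnLinearMap ^ m) z).2)) atTop (𝓝 0) := by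
    have h1 := (tendsto_iff_norm_sub_tendsto_zero.1 hp1).add (hp2.const_mul R)
    rwa [mul_zero, add_zero] at h1
  have hpp : 0 < 1 + ‖p‖ := by positivity
  obtain ⟨M, hM⟩ := (hη.eventually_lt_const (show 0 < min (1 / 2) (ε / (4 * (1 + ‖p‖))) by
    positivity)).exists_forall_of_atTop
  refine ⟨(k - a) + M * k, fun j hj r hr0 hr => ?_⟩
  obtain ⟨m, i, hm, hi, e1, e2⟩ := exists_block ha (x, 1) M hj
  have hM' := hM m hm
  rw [e1, e2] at hr ⊢
  set Z := (C.returnLinearMap ^ m) z with hZ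
  have hZw : C.WallCone (-1) Z := hF.wallCone_pow hw m
  have hZ0 : 0 < Z.2 := hZw.1
  have hZs : C.StartCone (cyc k 0) Z := by
    rw [cyc_zero, ← neg_add_cancel]; exact hZw.startCone
  have hZ1 : (C.returnLinearMap ^ (m + 1)) z = C.path 0 k Z := by
    rw [path_returnLinearMap, pow_succ', Module.End.mul_apply]
  rw [hZ1] at hM'
  set η := ‖Z.2⁻¹ • Z - (p, (1 : ℝ))‖ + R * (((C.path 0 k Z).2 - Z.2) / Z.2) with hηdef
  have hbound : ‖C.path 0 i Z + r • C.focus (cyc k i) - Z‖ ≤ R * ((C.path 0 k Z).2 - Z.2) := by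
    have h1 : C.path 0 i Z + r • C.focus (cyc k i) - Z =
        (C.path 0 i Z - Z) + r • C.focus (cyc k i) := by abel
    have h2 := hF.norm_path_sub_le hR hZs i
    have h3 := hF.path_snd_mono hZs (show i + 1 ≤ k from hi)
    simp only [path_succ, passage_snd, zero_add] at h3
    rw [h1]
    refine (norm_add_le _ _).trans ?_
    rw [norm_smul, Real.norm_of_nonneg hr0]
    have h4 := mul_le_mul_of_nonneg_left (hR (cyc k i)) hr0
    have h5 : R * ((C.path 0 i Z).2 + r) ≤ R * (C.path 0 k Z).2 :=
      mul_le_mul_of_nonneg_left (by linarith) hR0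
    linarith
  have hq : ‖Z.2⁻¹ • (C.path 0 i Z + r • C.focus (cyc k i)) - (p, (1 : ℝ))‖ ≤
      η * ((p, (1 : ℝ)) : (Fin n → ℝ) × ℝ).2 := by
    have h1 : Z.2⁻¹ • (C.path 0 i Z + r • C.focus (cyc k i)) - (p, (1 : ℝ)) =
        (Z.2⁻¹ • Z - (p, (1 : ℝ))) +
          Z.2⁻¹ • (C.path 0 i Z + r • C.focus (cyc k i) - Z) := by
      rw [smul_sub]; abel
    rw [h1, mul_one, hηdef]
    refine (norm_add_le _ _).trans ?_
    rw [norm_smul, norm_inv, Real.norm_of_nonneg hZ0.le]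
    have h2 := mul_le_mul_of_nonneg_left hbound (inv_nonneg.2 hZ0.le)
    rw [div_eq_inv_mul]
    linarith
  have hfin := dist_dehom_le (q' := (p, 1)) one_pos (hM'.le.trans (min_le_left _ _)) hq
  rw [dehom_smul (inv_ne_zero hZ0.ne'), dehom_one] at hfin
  refine hfin.trans_lt ?_
  have h6 : η < ε / (4 * (1 + ‖p‖)) := hM'.trans_le (min_le_right _ _)
  rw [lt_div_iff₀ (by positivity)] at h6
  linarith

/-- Each wall is crossed by arcs of arbitrarily large index, so it contains points arbitrarily close
to p. -/
theorem IsFocal.mem_spine_of_tendsto (hF : C.IsFocal) {a : ℕ} {x p : Fin n → ℝ}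
    (hx : x ∈ C.StartSet (cyc k a))
    (hp : ∀ ε : ℝ, 0 < ε → ∃ J, ∀ j, J ≤ j → ∀ r, 0 ≤ r →
      r ≤ C.coef (cyc k (a + j)) (C.path a j (x, 1)) →
      dist (dehom (C.path a j (x, 1) + r • C.focus (cyc k (a + j)))) p < ε) :
    p ∈ C.spine := by
  have hxs := startCone_of_mem_startSet hx
  refine mem_iInter.2 fun i => Metric.mem_closure_iff.2 fun ε hε => ?_
  obtain ⟨J, hJ⟩ := hp ε hε
  obtain ⟨j, hj, hji⟩ := exists_cyc_eq i a J
  have h1 := hJ (j + 1) (by omega) 0 le_rfl (hF.path_cone hxs (j + 1)).1.2.2.le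
  rw [zero_smul, add_zero, dist_comm] at h1
  have h2 := (wallCone_iff.1 (hF.path_cone hxs j).2).2
  rw [hji] at h2
  exact ⟨_, h2, h1⟩

theorem IsFocal.clock_lt_endTime (hF : C.IsFocal) {a : ℕ} {x : Fin n → ℝ}
    (hx : x ∈ C.StartSet (cyc k a)) (j : ℕ) : (C.clock a x j : EReal) < C.endTime a x :=
  lt_iSup_iff.2 ⟨j + 1, EReal.coe_lt_coe_iff.2 (hF.clock_strictMono hx (Nat.lt_succ_self j))⟩

/-- A property of the arcs with large index holds at large times of a maximal trajectory. -/
theorem IsFocal.eventually_of_arcs (hF : C.IsFocal) {T : EReal} {y : ℝ → Fin n → ℝ}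
    (hy : C.IsMaximalTrajectory T y) {a : ℕ} (hx : y 0 ∈ C.StartSet (cyc k a))
    {Q : (Fin n → ℝ) → Prop} {J : ℕ} (hJ : ∀ j, J ≤ j → ∀ r, 0 ≤ r →
      r ≤ C.coef (cyc k (a + j)) (C.path a j (y 0, 1)) →
      Q (dehom (C.path a j (y 0, 1) + r • C.focus (cyc k (a + j))))) {t : ℝ} (ht0 : 0 ≤ t)
    (ht : C.clock a (y 0) J ≤ t) (htT : (t : EReal) < T) : Q (y t) := by
  obtain ⟨j, r, hr0, hr, -, e2, e3⟩ := hF.maximal_eq_dehom hy rfl hx ht0 htT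
  rw [e3]
  refine hJ j ?_ r hr0 hr
  have h1 := (Real.log_le_iff_le_exp (hF.path_snd_pos hx J)).1 ht
  have h2 : C.clock a (y 0) J < C.clock a (y 0) (j + 1) := by
    rw [← Real.exp_lt_exp, hF.exp_clock hx, hF.exp_clock hx]
    exact h1.trans_lt e2
  have := (hF.clock_strictMono hx).lt_iff_lt.1 h2
  omega

theorem IsFocal.allConvergeToSpine (hF : C.IsFocal)
    (hconv : ∀ z, C.WallCone (-1) z → ∃ p : Fin n → ℝ,
      Tendsto (fun m : ℕ => ((C.returnLinearMap ^ m) z).2⁻¹ • (C.returnLinearMap ^ m) z) atTop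
        (𝓝 (p, 1)) ∧
      Tendsto (fun m : ℕ => (((C.returnLinearMap ^ (m + 1)) z).2 -
        ((C.returnLinearMap ^ m) z).2) / ((C.returnLinearMap ^ m) z).2) atTop (𝓝 0)) :
    C.AllConvergeToSpine ∧ ¬ C.IsIdeal := by
  constructor
  · intro T y hy
    obtain ⟨a, ha⟩ := hy.1.exists_startSet
    obtain ⟨p, hp⟩ := hF.tendsto_of_return hconv a.isLt ha
    refine ⟨p, hF.mem_spine_of_tendsto ha hp, fun ε hε => ?_⟩
    obtain ⟨J, hJ⟩ := hp ε hε
    have h0 : 0 ≤ C.clock a.val (y 0) J := (clock_zero (C := C) a.val (y 0)).ge.trans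
      ((hF.clock_strictMono ha).monotone (Nat.zero_le J))
    refine ⟨C.clock a.val (y 0) J, h0, ?_, fun t ht htT =>
      hF.eventually_of_arcs hy ha (Q := fun q => dist q p < ε) hJ (h0.trans ht) ht htT⟩
    rw [hF.isMaximalTrajectory_endTime hy rfl ha]
    exact hF.clock_lt_endTime ha J
  · intro hid
    obtain ⟨x, hx⟩ := wall_nonempty (C := C) (-1)
    have hx' : x ∈ C.StartSet (cyc k 0) := Or.inr (by rwa [cyc_zero, zero_sub])
    obtain ⟨p, hp⟩ := hF.tendsto_of_return hconv (NeZero.pos k) hx'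
    have := hF.mem_spine_of_tendsto hx' hp
    rw [hid] at this
    exact this

theorem eq_level_of_mem_spine {p : Fin n → ℝ} (hp : p ∈ C.spine) (i : Fin k) :
    p (C.var i) = N.level (C.edge i) := by
  have hcl : IsClosed {x : Fin n → ℝ | x (C.var i) = N.level (C.edge i)} :=
    isClosed_eq (continuous_apply _) continuous_const
  exact closure_minimal (fun x hx => hx.1) hcl (mem_iInter.1 hp i)

theorem periodic_add_nat_mul {y : ℝ → Fin n → ℝ} {P : ℝ} (hP : 0 < P)
    (h : ∀ t, 0 ≤ t → y (t + P) = y t) (m : ℕ) {t : ℝ} (ht : 0 ≤ t) : y (t + m * P) = y t := by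
  induction m with
  | zero => simp
  | succ m ih =>
    rw [Nat.cast_succ, add_mul, one_mul, ← add_assoc, h _ (by positivity), ih]

/-- A convergent periodic trajectory starts at its limit; but at a point of the spine there is no
velocity in the cycle. -/
theorem not_isPeriodicOrbit_of_allConvergeToSpine (h : C.AllConvergeToSpine)
    (Γ : Set (Fin n → ℝ)) : ¬ C.IsPeriodicOrbit Γ := by
  rintro ⟨y, P, hy, hP, hper, -⟩
  obtain ⟨p, hp, hlim⟩ := h ⊤ y (isMaximalTrajectory_top hy)
  have h0 : y 0 = p := by
    refine eq_of_forall_dist_le fun ε hε => ?_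
    obtain ⟨s, -, -, hs⟩ := hlim ε hε
    obtain ⟨m, hm⟩ := exists_nat_ge (s / P)
    have h1 := hs (0 + m * P) (by rw [zero_add]; exact (div_le_iff₀ hP).1 hm)
      (EReal.coe_lt_top _)
    rw [periodic_add_nat_mul hP hper m le_rfl] at h1
    exact h1.le
  obtain ⟨v, hv, -⟩ := hy.2.2 0 le_rfl (EReal.coe_lt_top _)
  exact not_velocity_of_forall_eq (fun i => by rw [h0]; exact eq_level_of_mem_spine hp i) hv

end RegionCycle

/-! ### The periodic orbit through a fixed point of the return map -/

namespace RegionCycle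

open GlassNetwork

variable {n k : ℕ} [NeZero k] {N : GlassNetwork n} {C : RegionCycle N k}

/-! ### Norm estimates for passages -/

theorem exists_norm_passage_le (C : RegionCycle N k) :
    ∃ B : ℝ, 1 ≤ B ∧ (∀ a j z, ‖C.path a j z‖ ≤ B ^ j * ‖z‖) ∧
      ∀ i z, |C.coef i z| * ‖C.focus i‖ ≤ B * ‖z‖ := by
  let K := ∑ i, ‖(C.coef i).toContinuousLinearMap‖ * ‖C.focus i‖
  have hK0 : 0 ≤ K := Finset.sum_nonneg fun _ _ => by positivity
  have hK : ∀ i z, |C.coef i z| * ‖C.focus i‖ ≤ K * ‖z‖ := fun i z => by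
    have h1 : |C.coef i z| ≤ ‖(C.coef i).toContinuousLinearMap‖ * ‖z‖ :=
      (C.coef i).toContinuousLinearMap.le_opNorm z
    have h2 : ‖(C.coef i).toContinuousLinearMap‖ * ‖C.focus i‖ ≤ K :=
      Finset.single_le_sum
        (f := fun i => ‖(C.coef i).toContinuousLinearMap‖ * ‖C.focus i‖)
        (fun _ _ => by positivity) (Finset.mem_univ i)
    have h3 := mul_le_mul_of_nonneg_right h1 (norm_nonneg (C.focus i))
    have h4 := mul_le_mul_of_nonneg_right h2 (norm_nonneg z)
    linarith
  have hpass : ∀ i z, ‖C.passage i z‖ ≤ (1 + K) * ‖z‖ := fun i z => by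
    rw [passage_apply]
    refine (norm_add_le _ _).trans ?_
    rw [norm_smul, Real.norm_eq_abs]
    linarith [hK i z]
  refine ⟨1 + K, by linarith, fun a j z => ?_, fun i z => (hK i z).trans ?_⟩
  · induction j with
    | zero => simp [path]
    | succ j ih =>
      rw [path_succ, pow_succ']
      refine (hpass _ _).trans ?_
      rw [mul_assoc]
      exact mul_le_mul_of_nonneg_left ih (by linarith)
  · linarith [norm_nonneg z]

/-- Every point of an arc is close to a point of the corresponding arc with a near start. -/
theorem exists_near_arc {B : ℝ} (hB : ∀ i z, |C.coef i z| * ‖C.focus i‖ ≤ B * ‖z‖) {i : Fin k}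
    {w w' : (Fin n → ℝ) × ℝ} (hw' : 0 ≤ C.coef i w') {r : ℝ} (hr0 : 0 ≤ r)
    (hr : r ≤ C.coef i w) : ∃ r', 0 ≤ r' ∧ r' ≤ C.coef i w' ∧
      ‖(w + r • C.focus i) - (w' + r' • C.focus i)‖ ≤ (1 + B) * ‖w - w'‖ := by
  -- The parameter `r` is cut off at the end of the other arc. The amount lost is at most the
  -- difference of the two arc lengths.
  refine ⟨min r (C.coef i w'), le_min hr0 hw', min_le_right _ _, ?_⟩
  have h1 : (w + r • C.focus i) - (w' + min r (C.coef i w') • C.focus i) =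
      (w - w') + (r - min r (C.coef i w')) • C.focus i := by
    rw [sub_smul]; abel
  have h2 : |r - min r (C.coef i w')| ≤ |C.coef i (w - w')| := by
    rw [map_sub]
    rcases le_total r (C.coef i w') with h | h
    · rw [min_eq_left h, sub_self, abs_zero]; exact abs_nonneg _
    · rw [min_eq_right h, abs_of_nonneg (sub_nonneg.2 h)]
      exact le_trans (by linarith) (le_abs_self _)
  rw [h1]
  refine (norm_add_le _ _).trans ?_
  rw [norm_smul, Real.norm_eq_abs]
  have h3 := mul_le_mul_of_nonneg_right h2 (norm_nonneg (C.focus i))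
  linarith [hB i (w - w')]

variable (C) in
/-- The point `x` of the last wall is fixed by the return map, with multiplier `μ > 1`. -/
structure IsReturnFixed (μ : ℝ) (x : Fin n → ℝ) : Prop where
  one_lt : 1 < μ
  mem_wall : x ∈ C.wall (-1)
  apply_eq : C.returnLinearMap (x, 1) = μ • (x, (1 : ℝ))
  tendsto : ∀ z ∈ C.hyper, ∃ c : ℝ,
    Tendsto (fun m : ℕ => (μ ^ m)⁻¹ • (C.returnLinearMap ^ m) z) atTop (𝓝 (c • (x, (1 : ℝ)))) ∧
      (C.WallCone (-1) z → 0 < c)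

variable (C) in
/-- The orbit of the trajectory starting at the point `x` of the last wall. -/
def orbit (x : Fin n → ℝ) : Set (Fin n → ℝ) := C.traj 0 x '' Ici 0

namespace IsReturnFixed

variable {μ : ℝ} {x : Fin n → ℝ}

theorem pos (h : C.IsReturnFixed μ x) : 0 < μ := one_pos.trans h.one_lt

theorem mem_startSet (h : C.IsReturnFixed μ x) : x ∈ C.StartSet (cyc k 0) :=
  Or.inr (by rw [cyc_zero, zero_sub]; exact h.mem_wall)

theorem startCone (h : C.IsReturnFixed μ x) : C.StartCone (cyc k 0) (x, 1) :=
  startCone_of_mem_startSet h.mem_startSet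

theorem path_mul_add (h : C.IsReturnFixed μ x) (m i : ℕ) :
    C.path 0 (m * k + i) (x, 1) = μ ^ m • C.path 0 i (x, 1) := by
  rw [RegionCycle.path_mul_add, Module.End.pow_apply_of_eq_smul h.apply_eq, map_smul]

theorem path_add_self (h : C.IsReturnFixed μ x) (j : ℕ) :
    C.path 0 (j + k) (x, 1) = μ • C.path 0 j (x, 1) := by
  have := h.path_mul_add 1 j
  rwa [one_mul, pow_one, add_comm] at this

theorem pow_le_path_snd (hF : C.IsFocal) (h : C.IsReturnFixed μ x) (j : ℕ) :
    μ ^ (j / k) ≤ (C.path 0 j (x, 1)).2 := by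
  have h1 := h.path_mul_add (j / k) (j % k)
  rw [Nat.div_add_mod'] at h1
  rw [h1, Prod.smul_snd, smul_eq_mul]
  exact le_mul_of_one_le_right (pow_pos h.pos _).le (hF.one_le_path_snd h.mem_startSet _)

theorem node_mem_wall (hF : C.IsFocal) (h : C.IsReturnFixed μ x) (j : ℕ) :
    dehom (C.path 0 j (x, 1)) ∈ C.wall (cyc k j - 1) := by
  cases j with
  | zero => rw [path_zero, dehom_one, cyc_zero, zero_sub]; exact h.mem_wall
  | succ j =>
    rw [cyc_succ, add_sub_cancel_right]
    have := (wallCone_iff.1 (hF.path_cone h.startCone j).2).2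
    rwa [zero_add] at this

theorem _root_.RegionCycle.IsFocal.endTime_eq_top (hF : C.IsFocal) {a : ℕ} {y : Fin n → ℝ}
    (hy : y ∈ C.StartSet (cyc k a)) (hub : ∀ b : ℝ, ∃ j, b < (C.path a j (y, 1)).2) :
    C.endTime a y = ⊤ := by
  refine EReal.eq_top_iff_forall_lt _ |>.2 fun t => ?_
  obtain ⟨j, hj⟩ := hub (Real.exp t)
  refine lt_iSup_iff.2 ⟨j, EReal.coe_lt_coe_iff.2 ?_⟩
  rw [← Real.exp_lt_exp, hF.exp_clock hy]
  exact hj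

theorem endTime_eq_top (hF : C.IsFocal) (h : C.IsReturnFixed μ x) : C.endTime 0 x = ⊤ := by
  refine hF.endTime_eq_top h.mem_startSet fun b => ?_
  obtain ⟨m, hm⟩ := pow_unbounded_of_one_lt b h.one_lt
  refine ⟨m * k, hm.trans_le ?_⟩
  have := pow_le_path_snd hF h (m * k)
  rwa [Nat.mul_div_cancel _ (NeZero.pos k)] at this

theorem isTrajectory (hF : C.IsFocal) (h : C.IsReturnFixed μ x) :
    C.IsTrajectory ⊤ (C.traj 0 x) := by
  have := hF.isTrajectory_traj h.mem_startSet
  rwa [h.endTime_eq_top hF] at this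

theorem exists_clock_le (hF : C.IsFocal) (h : C.IsReturnFixed μ x) {t : ℝ} (ht : 0 ≤ t) :
    ∃ j, C.clock 0 x j ≤ t ∧ t < C.clock 0 x (j + 1) :=
  RegionCycle.exists_clock_le ht (by rw [h.endTime_eq_top hF]; exact EReal.coe_lt_top t)

theorem clock_add_self (hF : C.IsFocal) (h : C.IsReturnFixed μ x) (j : ℕ) :
    C.clock 0 x (j + k) = C.clock 0 x j + Real.log μ := by
  rw [clock, h.path_add_self, Prod.smul_snd, smul_eq_mul,
    Real.log_mul h.pos.ne' (hF.path_snd_pos h.mem_startSet j).ne', add_comm]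
  rfl

theorem traj_add_period (hF : C.IsFocal) (h : C.IsReturnFixed μ x) (t : ℝ) (ht : 0 ≤ t) :
    C.traj 0 x (t + Real.log μ) = C.traj 0 x t := by
  obtain ⟨j, h1, h2⟩ := h.exists_clock_le hF ht
  have e1 := h.clock_add_self hF j
  have e2 := h.clock_add_self hF (j + 1)
  rw [hF.traj_eq h.mem_startSet h1 h2.le, hF.traj_eq h.mem_startSet (j := j + k) (by linarith)
    (by rw [add_right_comm]; linarith), h.path_add_self, ← add_assoc, cyc_add_self, arc, arc]
  have e3 : μ • C.path 0 j (x, 1) + (Real.exp (t + Real.log μ) - (μ • C.path 0 j (x, 1)).2) •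
      C.focus (cyc k (0 + j)) = μ • (C.path 0 j (x, 1) +
        (Real.exp t - (C.path 0 j (x, 1)).2) • C.focus (cyc k (0 + j))) := by
    rw [Real.exp_add, Real.exp_log h.pos, smul_add, smul_smul, Prod.smul_snd, smul_eq_mul]
    congr 2
    ring
  rw [e3, dehom_smul h.pos.ne']

theorem log_pos (h : C.IsReturnFixed μ x) : 0 < Real.log μ := Real.log_pos h.one_lt

theorem isPeriodicOrbit (hF : C.IsFocal) (h : C.IsReturnFixed μ x) :
    C.IsPeriodicOrbit (C.orbit x) :=
  ⟨_, _, h.isTrajectory hF, h.log_pos, h.traj_add_period hF, rfl⟩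

/-- The orbit consists of the arcs between its nodes. -/
theorem mem_orbit_iff (hF : C.IsFocal) (h : C.IsReturnFixed μ x) {γ : Fin n → ℝ} :
    γ ∈ C.orbit x ↔ ∃ j r, 0 ≤ r ∧ r ≤ C.coef (cyc k j) (C.path 0 j (x, 1)) ∧
      γ = dehom (C.path 0 j (x, 1) + r • C.focus (cyc k j)) := by
  have hx := h.mem_startSet
  constructor
  · rintro ⟨t, ht, rfl⟩
    obtain ⟨j, h1, h2⟩ := h.exists_clock_le hF ht
    rw [hF.traj_eq hx h1 h2.le]
    have e1 := (Real.log_le_iff_le_exp (hF.path_snd_pos hx j)).1 h1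
    have e2 := (Real.lt_log_iff_exp_lt (hF.path_snd_pos hx (j + 1))).1 h2
    rw [path_succ, passage_snd, zero_add] at e2
    refine ⟨j, Real.exp t - (C.path 0 j (x, 1)).2, by linarith, by linarith, ?_⟩
    rw [zero_add]
    rfl
  · rintro ⟨j, r, hr0, hr, rfl⟩
    have h1 := hF.one_le_path_snd hx j
    have hpos : 0 < (C.path 0 j (x, 1)).2 + r := by linarith
    have e3 : Real.exp (Real.log ((C.path 0 j (x, 1)).2 + r)) = (C.path 0 j (x, 1)).2 + r :=
      Real.exp_log hpos
    refine ⟨Real.log ((C.path 0 j (x, 1)).2 + r), Real.log_nonneg (by linarith), ?_⟩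
    rw [hF.traj_eq hx (j := j), arc, e3, add_sub_cancel_left, zero_add]
    · exact Real.log_le_log (by linarith) (by linarith)
    · refine Real.log_le_log hpos ?_
      rw [path_succ, passage_snd, zero_add]
      linarith

theorem mem_orbit (hF : C.IsFocal) (h : C.IsReturnFixed μ x) : x ∈ C.orbit x := by
  refine (h.mem_orbit_iff hF).2 ⟨0, 0, le_rfl, ?_, ?_⟩
  · rw [path_zero]; exact h.startCone.2.2.le
  · rw [path_zero, zero_smul, add_zero, dehom_one]

/-- The open arcs lie in regions and the j-th node on the wall entering `O j`. So a point on the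
last wall is a node with k ∣ j, and such a node is a multiple of (x, 1). -/
theorem orbit_inter_wall (hF : C.IsFocal) (h : C.IsReturnFixed μ x) :
    C.orbit x ∩ C.wall (-1) = {x} := by
  have hx := h.mem_startSet
  refine Subset.antisymm ?_ (singleton_subset_iff.2 ⟨h.mem_orbit hF, h.mem_wall⟩)
  rintro _ ⟨⟨t, ht, rfl⟩, hw⟩
  obtain ⟨j, h1, h2⟩ := h.exists_clock_le hF ht
  have hp := hF.path_snd_pos hx j
  rw [hF.traj_eq hx h1 h2.le] at hw ⊢
  rcases h1.lt_or_eq with h1 | h1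
  · exact absurd (hF.arc_mem_region (hF.path_cone h.startCone j).1
      ((Real.log_lt_iff_lt_exp hp).1 h1)
      ((Real.lt_log_iff_exp_lt (hF.path_snd_pos hx (j + 1))).1 h2))
      (not_mem_region_of_mem_wall hw _)
  · rw [← h1, show C.arc _ _ (C.clock 0 x j) = _ from arc_start hp] at hw ⊢
    have h3 := wall_index_unique hw (h.node_mem_wall hF j)
    have h4 : cyc k j = cyc k 0 := by
      rw [cyc_zero]
      exact sub_left_injective (h3.trans (zero_sub 1).symm)
    rw [cyc_eq_iff, Nat.zero_mod] at h4
    obtain ⟨m, rfl⟩ := Nat.dvd_of_mod_eq_zero h4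
    have h5 := h.path_mul_add m 0
    rw [add_zero, path_zero, mul_comm] at h5
    rw [h5, dehom_smul (pow_pos h.pos m).ne', dehom_one]
    rfl

theorem isCompact_orbit (hF : C.IsFocal) (h : C.IsReturnFixed μ x) : IsCompact (C.orbit x) := by
  have : C.orbit x = C.traj 0 x '' Icc 0 (Real.log μ) := by
    refine Subset.antisymm ?_ (image_mono Icc_subset_Ici_self)
    rintro _ ⟨t, ht, rfl⟩
    have hP := h.log_pos
    have ht' : 0 ≤ t := ht
    have h1 : 0 ≤ t / Real.log μ := div_nonneg ht' hP.le
    set m := ⌊t / Real.log μ⌋₊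
    have h2 : m * Real.log μ ≤ t := (le_div_iff₀ hP).1 (Nat.floor_le h1)
    have h3 : t < (m + 1) * Real.log μ := (div_lt_iff₀ hP).1 (Nat.lt_floor_add_one _)
    refine ⟨t - m * Real.log μ, ⟨by linarith, by linarith⟩, ?_⟩
    have h4 := periodic_add_nat_mul hP (h.traj_add_period hF) m
      (show 0 ≤ t - m * Real.log μ by linarith)
    rwa [sub_add_cancel, eq_comm] at h4
  rw [this]
  exact isCompact_Icc.image_of_continuousOn
    ((h.isTrajectory hF).2.1.mono fun t ht => ⟨ht.1, EReal.coe_lt_top t⟩)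

theorem exists_norm_orbit_le (hF : C.IsFocal) (h : C.IsReturnFixed μ x) :
    ∃ R : ℝ, 0 ≤ R ∧ ∀ γ ∈ C.orbit x, ‖γ‖ ≤ R := by
  obtain ⟨R, hR⟩ := (h.isCompact_orbit hF).isBounded.exists_norm_le
  exact ⟨max R 0, le_max_right _ _, fun γ hγ => (hR γ hγ).trans (le_max_left _ _)⟩

/-- All trajectories exist for all times and are attracted by the orbit. -/
theorem attracts (hF : C.IsFocal) (h : C.IsReturnFixed μ x) {a : ℕ} (ha : a < k)
    {y : Fin n → ℝ} (hy : y ∈ C.StartSet (cyc k a)) :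
    C.endTime a y = ⊤ ∧ ∀ ε : ℝ, 0 < ε → ∃ J, ∀ j, J ≤ j → ∀ r, 0 ≤ r →
      r ≤ C.coef (cyc k (a + j)) (C.path a j (y, 1)) →
      Metric.infDist (dehom (C.path a j (y, 1) + r • C.focus (cyc k (a + j)))) (C.orbit x)
        < ε := by
  have hys := startCone_of_mem_startSet hy
  have hw := hF.wallCone_block ha hys
  obtain ⟨c, hc, hc0⟩ := h.tendsto _ hw.mem_hyper
  replace hc0 := hc0 hw
  obtain ⟨B, hB1, hBp, hBc⟩ := exists_norm_passage_le C
  obtain ⟨R, hR0, hR⟩ := h.exists_norm_orbit_le hF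
  have hμ := h.pos
  set z := C.path a (k - a) (y, 1) with hz
  constructor
  · refine hF.endTime_eq_top hy fun b => ?_
    have h1 : Tendsto (fun m : ℕ => ((μ ^ m)⁻¹ • (C.returnLinearMap ^ m) z).2) atTop (𝓝 c) := by
      have h3 := (continuous_snd.tendsto _).comp hc
      rwa [Prod.smul_snd, smul_eq_mul, mul_one] at h3
    have h2 : Tendsto (fun m : ℕ => μ ^ m * ((μ ^ m)⁻¹ • (C.returnLinearMap ^ m) z).2) atTop
        atTop := (tendsto_pow_atTop_atTop_of_one_lt h.one_lt).atTop_mul_pos hc0 h1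
    obtain ⟨m, hm⟩ := (h2.eventually_gt_atTop b).exists
    refine ⟨(k - a) + (m * k + 0), ?_⟩
    rw [(path_var_block ha (y, 1) rfl).2, path_zero]
    rwa [Prod.smul_snd, smul_eq_mul, mul_inv_cancel_left₀ (pow_pos hμ m).ne'] at hm
  · intro ε hε
    set E := (1 + B) * B ^ k with hE
    have hE0 : 0 ≤ E := by positivity
    have hη : Tendsto (fun m : ℕ => E *
        ‖c⁻¹ • ((μ ^ m)⁻¹ • (C.returnLinearMap ^ m) z) - (x, (1 : ℝ))‖) atTop (𝓝 0) := by
      have h1 := hc.const_smul c⁻¹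
      rw [inv_smul_smul₀ hc0.ne'] at h1
      have h2 := (tendsto_iff_norm_sub_tendsto_zero.1 h1).const_mul E
      rwa [mul_zero] at h2
    obtain ⟨M, hM⟩ := (hη.eventually_lt_const (show 0 < min (1 / 2) (ε / (2 * (1 + R))) by
      positivity)).exists_forall_of_atTop
    refine ⟨(k - a) + M * k, fun j hj r hr0 hr => ?_⟩
    obtain ⟨m, i, hm, hi, e1, e2⟩ := exists_block ha (y, 1) M hj
    have hM' := hM m hm
    rw [e1, e2, ← hz] at hr ⊢
    set Z := (C.returnLinearMap ^ m) z
    -- This factor brings the m-th return close to (x, 1), and scaling does not change the point of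
    -- the trajectory. The following arcs can then be compared with those of the orbit during one
    -- turn.
    set s := c⁻¹ * (μ ^ m)⁻¹ with hs
    have hs0 : 0 < s := by positivity
    rw [smul_smul, ← hs] at hM'
    set u := s • Z with hu
    set η := E * ‖u - (x, (1 : ℝ))‖ with hηd
    have e3 : s • (C.path 0 i Z + r • C.focus (cyc k i)) =
        C.path 0 i u + (s * r) • C.focus (cyc k i) := by
      rw [smul_add, smul_smul, hu, map_smul]
    have hcx := (hF.path_cone h.startCone i).1
    rw [zero_add] at hcx
    obtain ⟨r', hr'0, hr', hn⟩ := exists_near_arc hBc (w := C.path 0 i u) hcx.2.2.le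
      (mul_nonneg hs0.le hr0) (by
        rw [hu, map_smul, map_smul, smul_eq_mul]
        exact mul_le_mul_of_nonneg_left hr hs0.le)
    set q := C.path 0 i (x, 1) + r' • C.focus (cyc k i) with hq
    have hqo : dehom q ∈ C.orbit x := (h.mem_orbit_iff hF).2 ⟨i, r', hr'0, hr', rfl⟩
    have hq1 : 1 ≤ q.2 := by
      have := hF.one_le_path_snd h.mem_startSet i
      simp only [hq, focus, Prod.snd_add, Prod.smul_snd, smul_eq_mul, mul_one]
      linarith
    have hn' : ‖C.path 0 i u + (s * r) • C.focus (cyc k i) - q‖ ≤ η * q.2 := by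
      refine hn.trans ?_
      rw [← map_sub]
      have h1 : ‖C.path 0 i (u - (x, (1 : ℝ)))‖ ≤ B ^ k * ‖u - (x, (1 : ℝ))‖ :=
        (hBp 0 i _).trans (mul_le_mul_of_nonneg_right (pow_le_pow_right₀ hB1 hi.le)
          (norm_nonneg _))
      have h2 := mul_le_mul_of_nonneg_left h1 (show 0 ≤ 1 + B by linarith)
      have h3 : 0 ≤ η := mul_nonneg hE0 (norm_nonneg _)
      calc _ ≤ η := by rw [hηd, hE, mul_assoc]; exact h2
        _ ≤ η * q.2 := le_mul_of_one_le_right h3 hq1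
    have hfin := dist_dehom_le (by linarith) (hM'.le.trans (min_le_left _ _)) hn'
    rw [← e3, dehom_smul hs0.ne'] at hfin
    refine (Metric.infDist_le_dist_of_mem hqo).trans_lt (hfin.trans_lt ?_)
    have h6 : η < ε / (2 * (1 + R)) := hM'.trans_le (min_le_right _ _)
    rw [lt_div_iff₀ (by positivity)] at h6
    have h7 : 0 ≤ η := mul_nonneg hE0 (norm_nonneg _)
    have h8 := mul_le_mul_of_nonneg_left (hR _ hqo) h7
    linarith

theorem maximal_eq_top (hF : C.IsFocal) (h : C.IsReturnFixed μ x) {T : EReal}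
    {y : ℝ → Fin n → ℝ} (hy : C.IsMaximalTrajectory T y) : T = ⊤ := by
  obtain ⟨a, ha⟩ := hy.1.exists_startSet
  rw [hF.isMaximalTrajectory_endTime hy rfl ha, (h.attracts hF a.isLt ha).1]

theorem tendsto_infDist (hF : C.IsFocal) (h : C.IsReturnFixed μ x) {y : ℝ → Fin n → ℝ}
    (hy : C.IsMaximalTrajectory ⊤ y) :
    Tendsto (fun t => Metric.infDist (y t) (C.orbit x)) atTop (𝓝 0) := by
  obtain ⟨a, ha⟩ := hy.1.exists_startSet
  rw [Metric.tendsto_atTop]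
  intro ε hε
  obtain ⟨J, hJ⟩ := (h.attracts hF a.isLt ha).2 ε hε
  refine ⟨max 0 (C.clock a.val (y 0) J), fun t ht => ?_⟩
  rw [Real.dist_eq, sub_zero, abs_of_nonneg Metric.infDist_nonneg]
  exact hF.eventually_of_arcs hy ha (Q := fun q => Metric.infDist q (C.orbit x) < ε) hJ
    ((le_max_left _ _).trans ht) ((le_max_right _ _).trans ht) (EReal.coe_lt_top t)

/-- Along multiples of the period the distance to the orbit is constant, and it tends to zero. As
the orbit is closed, the trajectory starts on it, and uniqueness of trajectories does the rest. -/
theorem eq_orbit (hF : C.IsFocal) (h : C.IsReturnFixed μ x) {Γ : Set (Fin n → ℝ)}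
    (hΓ : C.IsPeriodicOrbit Γ) : Γ = C.orbit x := by
  obtain ⟨y, P, hy, hP, hper, rfl⟩ := hΓ
  have hlim := h.tendsto_infDist hF (isMaximalTrajectory_top hy)
  have hmem : y 0 ∈ C.orbit x := by
    rw [(h.isCompact_orbit hF).isClosed.mem_iff_infDist_zero ⟨x, h.mem_orbit hF⟩]
    have h1 : Tendsto (fun m : ℕ => (0 : ℝ) + m * P) atTop atTop := by
      simp only [zero_add]
      exact tendsto_natCast_atTop_atTop.atTop_mul_const hP
    refine tendsto_nhds_unique ?_ (hlim.comp h1)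
    refine tendsto_const_nhds.congr fun m => ?_
    rw [Function.comp_apply, periodic_add_nat_mul hP hper m le_rfl]
  obtain ⟨s, hs, hs'⟩ := hmem
  have hs0 : 0 ≤ s := hs
  have hsh := (h.isTrajectory hF).shift hs0
  obtain ⟨a, ha⟩ := hy.exists_startSet
  have htop := (h.attracts hF a.isLt ha).1
  have heq : ∀ t, 0 ≤ t → y t = C.traj 0 x (t + s) := fun t ht => by
    have ht' : (t : EReal) < C.endTime a.val (y 0) := by rw [htop]; exact EReal.coe_lt_top t
    rw [hF.eq_traj_of_isTrajectory hy rfl ha ht (EReal.coe_lt_top t) ht']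
    exact (hF.eq_traj_of_isTrajectory hsh (by rw [zero_add]; exact hs') ha ht
      (EReal.coe_lt_top t) ht').symm
  refine Subset.antisymm ?_ ?_
  · rintro _ ⟨t, ht, rfl⟩
    exact ⟨t + s, add_nonneg ht hs0, (heq t ht).symm⟩
  · rintro _ ⟨t, ht, rfl⟩
    have ht0 : 0 ≤ t := ht
    obtain ⟨m, hm⟩ := exists_nat_ge (s / Real.log μ)
    have h1 : s ≤ m * Real.log μ := (div_le_iff₀ h.log_pos).1 hm
    refine ⟨t + m * Real.log μ - s, mem_Ici.2 (by linarith), ?_⟩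
    rw [heq _ (by linarith), sub_add_cancel,
      periodic_add_nat_mul h.log_pos (h.traj_add_period hF) m ht0]

/-! ### Lyapunov stability -/

/-- The rescaled powers converge pointwise, so they are uniformly bounded by the Banach-Steinhaus
theorem. -/
theorem exists_norm_return_le (h : C.IsReturnFixed μ x) :
    ∃ B : ℝ, 0 ≤ B ∧ ∀ (m : ℕ) z, ‖(C.returnLinearMap ^ m) z‖ ≤ B * μ ^ m * ‖z‖ := by
  have hμ := h.pos
  let g : ℕ → ((Fin n → ℝ) × ℝ) →L[ℝ] ((Fin n → ℝ) × ℝ) := fun m =>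
    LinearMap.toContinuousLinearMap ((μ ^ m)⁻¹ • (C.returnLinearMap ^ m))
  have hg : ∀ z, ∃ B, ∀ m, ‖g m z‖ ≤ B := fun z => by
    -- Convergence is known on the hyperplane only, but one application of the return map leads
    -- there from any `z`.
    obtain ⟨c, hc, -⟩ := h.tendsto _ (returnLinearMap_mem_hyper z)
    have h1 : Tendsto (fun m => g (m + 1) z) atTop (𝓝 (μ⁻¹ • c • (x, (1 : ℝ)))) := by
      refine (hc.const_smul μ⁻¹).congr fun m => ?_
      change _ = (μ ^ (m + 1))⁻¹ • (C.returnLinearMap ^ (m + 1)) z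
      rw [pow_succ C.returnLinearMap, Module.End.mul_apply, smul_smul, ← mul_inv, pow_succ']
    have h2 := (tendsto_add_atTop_iff_nat (f := fun m => g m z) 1).1 h1
    obtain ⟨B, hB⟩ := h2.norm.bddAbove_range
    exact ⟨B, fun m => hB ⟨m, rfl⟩⟩
  obtain ⟨B, hB⟩ := banach_steinhaus hg
  refine ⟨B, (norm_nonneg _).trans (hB 0), fun m z => ?_⟩
  have h1 : ‖(μ ^ m)⁻¹ • (C.returnLinearMap ^ m) z‖ ≤ B * ‖z‖ := (g m).le_of_opNorm_le (hB m) z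
  rw [norm_smul, norm_inv, Real.norm_of_nonneg (pow_pos hμ m).le,
    inv_mul_le_iff₀ (pow_pos hμ m)] at h1
  linarith

/-- Together with `pow_le_path_snd` this shows that perturbations grow at most in proportion to the
last coordinate along the orbit, so they stay bounded after division by it. -/
theorem exists_norm_path_le (h : C.IsReturnFixed μ x) :
    ∃ B : ℝ, 0 ≤ B ∧ ∀ a j z, a < k → ‖C.path a j z‖ ≤ B * μ ^ ((a + j) / k) * ‖z‖ := by
  obtain ⟨B₀, hB₀, hH⟩ := h.exists_norm_return_le
  obtain ⟨B, hB1, hBp, -⟩ := exists_norm_passage_le C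
  have hμ := h.pos
  have hk := NeZero.pos k
  refine ⟨B ^ k + B ^ k * B₀ * B ^ k, by positivity, fun a j z ha => ?_⟩
  have hBk : 0 ≤ B ^ k * B₀ * B ^ k := by positivity
  rcases lt_or_ge (a + j) k with hlt | hge
  · rw [Nat.div_eq_of_lt hlt, pow_zero, mul_one]
    refine (hBp a j z).trans (mul_le_mul_of_nonneg_right ?_ (norm_nonneg z))
    linarith [pow_le_pow_right₀ hB1 (show j ≤ k by omega)]
  · obtain ⟨i, m, hi, hj⟩ : ∃ i m, i < k ∧ j = (k - a) + (m * k + i) := by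
      refine ⟨(j - (k - a)) % k, (j - (k - a)) / k, Nat.mod_lt _ hk, ?_⟩
      have := Nat.div_add_mod' (j - (k - a)) k
      omega
    have hdiv : (a + j) / k = m + 1 := by
      rw [hj, show a + (k - a + (m * k + i)) = i + (m + 1) * k by rw [Nat.succ_mul]; omega,
        Nat.add_mul_div_right _ _ hk, Nat.div_eq_of_lt hi, zero_add]
    rw [(path_var_block ha z hj).2, hdiv]
    set u := C.path a (k - a) z
    have h1 : ‖u‖ ≤ B ^ k * ‖z‖ := (hBp _ _ _).trans
      (mul_le_mul_of_nonneg_right (pow_le_pow_right₀ hB1 (by omega)) (norm_nonneg z))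
    have h2 : ‖(C.returnLinearMap ^ m) u‖ ≤ B₀ * μ ^ m * (B ^ k * ‖z‖) :=
      (hH m u).trans (mul_le_mul_of_nonneg_left h1 (by positivity))
    have h3 : ‖C.path 0 i ((C.returnLinearMap ^ m) u)‖ ≤
        B ^ k * (B₀ * μ ^ m * (B ^ k * ‖z‖)) := by
      refine (hBp _ _ _).trans (mul_le_mul (pow_le_pow_right₀ hB1 hi.le) h2 (norm_nonneg _)
        (by positivity))
    have h4 : μ ^ m ≤ μ ^ (m + 1) := pow_le_pow_right₀ h.one_lt.le (Nat.le_succ m)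
    have h5 := mul_le_mul_of_nonneg_left h4 (show 0 ≤ B ^ k * B₀ * B ^ k * ‖z‖ by positivity)
    have h6 : 0 ≤ B ^ k * μ ^ (m + 1) * ‖z‖ := by positivity
    calc _ ≤ B ^ k * (B₀ * μ ^ m * (B ^ k * ‖z‖)) := h3
      _ = B ^ k * B₀ * B ^ k * ‖z‖ * μ ^ m := by ring
      _ ≤ B ^ k * B₀ * B ^ k * ‖z‖ * μ ^ (m + 1) := h5
      _ ≤ _ := by linarith

/-- A point of the orbit on the boundary of a region lies on the arc in that region. -/
theorem exists_arc_of_mem_closedRegion (hF : C.IsFocal) (h : C.IsReturnFixed μ x)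
    {γ : Fin n → ℝ} (hγ : γ ∈ C.orbit x) {a : Fin k} (ha : γ ∈ N.closedRegion (C.O a)) :
    ∃ j r, cyc k j = a ∧ 0 ≤ r ∧ r ≤ C.coef (cyc k j) (C.path 0 j (x, 1)) ∧
      γ = dehom (C.path 0 j (x, 1) + r • C.focus (cyc k j)) := by
  obtain ⟨j, r, hr0, hr, rfl⟩ := (h.mem_orbit_iff hF).1 hγ
  have hnode : ∀ j, dehom (C.path 0 j (x, 1)) ∈ N.closedRegion (C.O a) →
      ∃ j' r, cyc k j' = a ∧ 0 ≤ r ∧ r ≤ C.coef (cyc k j') (C.path 0 j' (x, 1)) ∧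
      dehom (C.path 0 j (x, 1)) = dehom (C.path 0 j' (x, 1) + r • C.focus (cyc k j')) := by
    intro j hj
    have hc := fun j => (hF.path_cone h.startCone j).1.2.2
    simp only [zero_add] at hc
    rcases eq_or_of_mem_wall_of_mem_closedRegion (h.node_mem_wall hF j) hj with h1 | h1
    -- Here `O a` is the region before the wall, and the node is the end of the arc in it. That arc
    -- is taken one turn later, with number `j + (k - 1)`, since `j - 1` fails for `j = 0`; the end
    -- is then the same node scaled by μ.
    · have hk := Nat.sub_add_cancel (NeZero.one_le (n := k))
      have h2 : cyc k (j + (k - 1)) = a := by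
        have h3 : cyc k (j + (k - 1) + 1) = cyc k j := by
          rw [add_assoc, hk, cyc_add_self]
        rw [cyc_succ] at h3
        rw [h1, ← h3, add_sub_cancel_right]
      refine ⟨j + (k - 1), _, h2, (hc _).le, le_rfl, ?_⟩
      rw [← passage_apply]
      have h4 := path_succ (C := C) 0 (j + (k - 1)) (x, 1)
      rw [zero_add] at h4
      rw [← h4, add_assoc, hk, h.path_add_self, dehom_smul h.pos.ne']
    · rw [sub_add_cancel] at h1
      exact ⟨j, 0, h1.symm, le_rfl, (hc j).le, by rw [zero_smul, add_zero]⟩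
  rcases hr0.eq_or_lt with rfl | hr0
  · rw [zero_smul, add_zero] at ha ⊢
    exact hnode j ha
  rcases hr.eq_or_lt with rfl | hr
  · have h4 := path_succ (C := C) 0 j (x, 1)
    rw [zero_add] at h4
    rw [← passage_apply, ← h4] at ha ⊢
    exact hnode _ ha
  · have hc := (hF.path_cone h.startCone j).1
    rw [zero_add] at hc
    have h1 := hF.dehom_mem_region hc hr0 hr
    exact ⟨j, r, C.O_injective (region_code_unique h1 ha), hr0.le, hr.le, rfl⟩

theorem _root_.RegionCycle.coef_focus (i : Fin k) : C.coef i (C.focus i) = -1 := by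
  have h := focus_sub_ne (C := C) i
  simp only [coef_apply, focus]
  field_simp
  ring

/-- All points of a line in the direction of the focal point reach the wall hyperplane at the same
vector. Thus an orbit point in the middle of an arc has the same later nodes as the start of that
arc. -/
theorem _root_.RegionCycle.passage_add_smul_focus (i : Fin k) (z : (Fin n → ℝ) × ℝ) (r : ℝ) :
    C.passage i (z + r • C.focus i) = C.passage i z := by
  rw [passage_apply, passage_apply, map_add, map_smul, coef_focus, smul_eq_mul, mul_neg_one,
    add_smul, neg_smul]
  abel

/-- Trajectories that start in `O a` close to a given point of the orbit stay close to the
orbit. -/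
theorem exists_stable_nhd (hF : C.IsFocal) (h : C.IsReturnFixed μ x) {γ : Fin n → ℝ}
    (hγ : γ ∈ C.orbit x) {a : ℕ} (ha : a < k) (hcl : γ ∈ N.closedRegion (C.O (cyc k a))) {ε : ℝ}
    (hε : 0 < ε) : ∃ δ : ℝ, 0 < δ ∧ ∀ y ∈ C.StartSet (cyc k a), dist y γ < δ → ∀ j r, 0 ≤ r →
      r ≤ C.coef (cyc k (a + j)) (C.path a j (y, 1)) →
      Metric.infDist (dehom (C.path a j (y, 1) + r • C.focus (cyc k (a + j)))) (C.orbit x)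
        < ε := by
  obtain ⟨J, ρ, hJ, hρ0, hρ, hγe⟩ := h.exists_arc_of_mem_closedRegion hF hγ hcl
  obtain ⟨B, -, -, hBc⟩ := exists_norm_passage_le C
  obtain ⟨K, hK0, hK⟩ := h.exists_norm_path_le
  obtain ⟨R, hR0, hR⟩ := h.exists_norm_orbit_le hF
  have hμ := h.pos
  have hB0 : 0 ≤ 1 + B := by
    by_contra hneg
    have := hBc 0 (0, 1)
    have h1 : ‖((0 : Fin n → ℝ), (1 : ℝ))‖ = 1 := by simp [Prod.norm_def]
    rw [h1, mul_one] at this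
    have : 0 ≤ |C.coef 0 (0, 1)| * ‖C.focus 0‖ := by positivity
    linarith
  set ζ := C.path 0 J (x, 1) + ρ • C.focus (cyc k J) with hζ
  have hζ1 : 1 ≤ ζ.2 := by
    have := hF.one_le_path_snd h.mem_startSet J
    simp only [hζ, focus, Prod.snd_add, Prod.smul_snd, smul_eq_mul, mul_one]
    linarith
  have hζ0 : 0 < ζ.2 := by linarith
  have hγζ : ζ.2 • (γ, (1 : ℝ)) = ζ := by rw [hγe, smul_dehom hζ0]
  -- This makes the number of turns counted from `J` at least that counted from `a`, as the
  -- comparison of growth rates requires.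
  have haJ : a ≤ J := by
    rw [cyc_eq_iff, Nat.mod_eq_of_lt ha] at hJ
    rw [← hJ]; exact Nat.mod_le _ _
  have hcyc : ∀ j, cyc k (a + j) = cyc k (J + j) := fun j => by
    rw [cyc_eq_iff] at hJ ⊢
    exact (Nat.ModEq.add_right j hJ).symm
  -- the arcs of the orbit, starting from `ζ`
  have hsucc : ∀ j, C.path a (j + 1) ζ = C.path 0 (J + (j + 1)) (x, 1) := fun j => by
    induction j with
    | zero =>
      rw [zero_add, path_succ, path_zero, add_zero, ← hJ, hζ, passage_add_smul_focus, path_succ,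
        zero_add]
    | succ j ih =>
      rw [path_succ, ih, hcyc, show J + (j + 1 + 1) = J + (j + 1) + 1 from rfl,
        path_succ 0 (J + (j + 1)), zero_add]
  have hkey : ∀ j, 0 ≤ C.coef (cyc k (a + j)) (C.path a j ζ) ∧
      μ ^ ((a + j) / k) ≤ (C.path a j ζ).2 ∧
      ∀ r, 0 ≤ r → r ≤ C.coef (cyc k (a + j)) (C.path a j ζ) →
        dehom (C.path a j ζ + r • C.focus (cyc k (a + j))) ∈ C.orbit x := fun j => by
    have hpow : μ ^ ((a + j) / k) ≤ μ ^ ((J + j) / k) :=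
      pow_le_pow_right₀ h.one_lt.le (Nat.div_le_div_right (by omega))
    have hle := pow_le_path_snd hF h (J + j)
    cases j with
    | zero =>
      have hc : C.coef (cyc k J) ζ = C.coef (cyc k J) (C.path 0 J (x, 1)) - ρ := by
        rw [hζ, map_add, map_smul, coef_focus, smul_eq_mul]; ring
      simp only [add_zero] at hpow hle ⊢
      rw [path_zero, ← hJ, hc]
      refine ⟨by linarith, ?_, fun r hr0 hr => ?_⟩
      · have : ζ.2 = (C.path 0 J (x, 1)).2 + ρ := by simp [hζ, focus]
        rw [this]; linarith
      · rw [hζ, add_assoc, ← add_smul]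
        exact (h.mem_orbit_iff hF).2 ⟨J, ρ + r, by linarith, by linarith, rfl⟩
    | succ j =>
      have hc := (hF.path_cone h.startCone (J + (j + 1))).1.2.2
      rw [zero_add] at hc
      rw [hsucc, hcyc]
      exact ⟨hc.le, hpow.trans hle, fun r hr0 hr =>
        (h.mem_orbit_iff hF).2 ⟨_, r, hr0, hr, rfl⟩⟩
  -- The perturbation on the arc number j is at most (1 + B) K μ^⌊(a + j) / k⌋ d, while `ζ.2 * q.2`
  -- is at least that power of μ. The power cancels, and the relative error is at most `E * d` for
  -- all j.
  set E := (1 + B) * K * ζ.2 with hE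
  have hE0 : 0 ≤ E := by positivity
  refine ⟨min (1 / 2) (ε / (2 * (1 + R))) / (1 + E), by positivity, fun y hy hd j r hr0 hr => ?_⟩
  rw [lt_div_iff₀ (by positivity)] at hd
  obtain ⟨hk1, hk2, hk3⟩ := hkey j
  have hscale : C.path a j ζ = ζ.2 • C.path a j (γ, 1) := by rw [← map_smul, hγζ]
  obtain ⟨r', hr'0, hr', hn⟩ := exists_near_arc hBc (w := C.path a j (y, 1))
    (w' := C.path a j (γ, 1)) (i := cyc k (a + j)) (by
      rw [hscale, map_smul, smul_eq_mul] at hk1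
      exact (mul_nonneg_iff_of_pos_left hζ0).1 hk1) hr0 hr
  set q := C.path a j (γ, 1) + r' • C.focus (cyc k (a + j)) with hq
  have hqs : ζ.2 • q = C.path a j ζ + (ζ.2 * r') • C.focus (cyc k (a + j)) := by
    rw [hq, smul_add, smul_smul, hscale]
  have hqo : dehom q ∈ C.orbit x := by
    rw [← dehom_smul hζ0.ne', hqs]
    refine hk3 _ (mul_nonneg hζ0.le hr'0) ?_
    rw [hscale, map_smul, smul_eq_mul]
    exact mul_le_mul_of_nonneg_left hr' hζ0.le
  have hq2 : μ ^ ((a + j) / k) ≤ ζ.2 * q.2 := by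
    have h1 : ζ.2 * q.2 = (C.path a j ζ).2 + ζ.2 * r' := by
      have := congrArg Prod.snd hqs
      simpa [focus] using this
    rw [h1]
    have := mul_nonneg hζ0.le hr'0
    linarith
  have hpw : 0 < μ ^ ((a + j) / k) := pow_pos hμ _
  have hq0 : 0 < q.2 := (mul_pos_iff_of_pos_left hζ0).1 (hpw.trans_le hq2)
  set d := dist y γ with hdd
  have hd0 : 0 ≤ d := dist_nonneg
  have hn' : ‖C.path a j (y, 1) + r • C.focus (cyc k (a + j)) - q‖ ≤ (E * d) * q.2 := by
    refine hn.trans ?_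
    rw [← map_sub]
    have h1 : ‖((y, (1 : ℝ)) - (γ, (1 : ℝ)) : (Fin n → ℝ) × ℝ)‖ = d := by
      rw [← dist_eq_norm, dist_prod_same_right]
    have h2 := hK a j ((y, (1 : ℝ)) - (γ, (1 : ℝ))) ha
    rw [h1] at h2
    have h3 : K * μ ^ ((a + j) / k) * d ≤ K * (ζ.2 * q.2) * d :=
      mul_le_mul_of_nonneg_right (mul_le_mul_of_nonneg_left hq2 hK0) hd0
    calc _ ≤ (1 + B) * (K * (ζ.2 * q.2) * d) := mul_le_mul_of_nonneg_left (h2.trans h3) hB0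
      _ = (E * d) * q.2 := by rw [hE]; ring
  have hEd : E * d < min (1 / 2) (ε / (2 * (1 + R))) := by
    rcases hd0.eq_or_lt with h0 | h0
    · rw [← h0, mul_zero]; positivity
    · linarith
  have hfin := dist_dehom_le hq0 (hEd.le.trans (min_le_left _ _)) hn'
  refine (Metric.infDist_le_dist_of_mem hqo).trans_lt (hfin.trans_lt ?_)
  have h6 : E * d < ε / (2 * (1 + R)) := hEd.trans_le (min_le_right _ _)
  rw [lt_div_iff₀ (by positivity)] at h6
  have h8 := mul_le_mul_of_nonneg_left (hR _ hqo) (mul_nonneg hE0 hd0)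
  linarith

theorem isAsymptoticallyStable (hF : C.IsFocal) (h : C.IsReturnFixed μ x) :
    C.IsAsymptoticallyStable (C.orbit x) := by
  -- Attraction is global, so any radius serves.
  refine ⟨fun ε hε => ?_, 1, one_pos, fun T y hy _ => ?_⟩
  · let W : Set (Fin n → ℝ) := {y | ∀ a : Fin k, y ∈ C.StartSet (cyc k a) → ∀ j r, 0 ≤ r →
      r ≤ C.coef (cyc k (a + j)) (C.path a j (y, 1)) →
      Metric.infDist (dehom (C.path a j (y, 1) + r • C.focus (cyc k (a + j)))) (C.orbit x) < ε}
    have hW : C.orbit x ⊆ interior W := fun γ hγ => by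
      rw [mem_interior_iff_mem_nhds]
      refine eventually_all.2 fun a => ?_
      -- A point near `γ` can start only in regions whose closure contains `γ`. These are finitely
      -- many, so their neighborhoods can be intersected.
      by_cases hcl : γ ∈ N.closedRegion (C.O (cyc k a))
      · obtain ⟨δ, hδ, hd⟩ := h.exists_stable_nhd hF hγ a.isLt hcl hε
        filter_upwards [Metric.ball_mem_nhds γ hδ] with y hy hys
        exact hd y hys hy
      · filter_upwards [(isClosed_closedRegion _).isOpen_compl.mem_nhds hcl] with y hy hys
        exact absurd (startSet_subset_closedRegion _ hys) hy
    obtain ⟨δ, hδ, hsub⟩ := (h.isCompact_orbit hF).exists_thickening_subset_open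
      isOpen_interior hW
    refine ⟨δ, hδ, fun T y hy hd => ?_⟩
    have hT := h.maximal_eq_top hF hy
    refine ⟨hT, fun t ht => ?_⟩
    have hyW : y 0 ∈ W := interior_subset
      (hsub ((Metric.mem_thickening_iff_infDist_lt ⟨x, h.mem_orbit hF⟩).2 hd))
    obtain ⟨a, ha⟩ := hy.1.exists_startSet
    refine hF.eventually_of_arcs hy ha (J := 0)
      (Q := fun q => Metric.infDist q (C.orbit x) < ε) (fun j _ => hyW a ha j) ht ?_ ?_
    · rw [clock_zero]; exact ht
    · rw [hT]; exact EReal.coe_lt_top t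
  · obtain rfl := h.maximal_eq_top hF hy
    exact ⟨rfl, h.tendsto_infDist hF hy⟩

theorem hasUniqueStablePeriodicOrbit (hF : C.IsFocal) (h : C.IsReturnFixed μ x) :
    C.HasUniqueStablePeriodicOrbit :=
  ⟨C.orbit x, h.isPeriodicOrbit hF, h.isAsymptoticallyStable hF, fun _ hΓ => h.eq_orbit hF hΓ⟩

theorem mem_hyper_of_eigenvector {ν : ℝ} {w : (Fin n → ℝ) × ℝ} (hν : ν ≠ 0)
    (hw : C.returnLinearMap w = ν • w) : w ∈ C.hyper := by
  rw [← inv_smul_smul₀ hν w, ← hw]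
  exact C.hyper.smul_mem _ (returnLinearMap_mem_hyper w)

theorem hasEigenvalue (h : C.IsReturnFixed μ x) :
    Module.End.HasEigenvalue C.returnLinearMap μ :=
  Module.End.hasEigenvalue_of_hasEigenvector (x := (x, (1 : ℝ)))
    ⟨Module.End.mem_eigenspace_iff.2 h.apply_eq, fun h0 => by simpa using congrArg Prod.snd h0⟩

theorem le_of_hasEigenvalue (h : C.IsReturnFixed μ x) {ν : ℝ}
    (hν : Module.End.HasEigenvalue C.returnLinearMap ν) : ν ≤ μ := by
  by_contra hlt
  push Not at hlt
  obtain ⟨w, hw⟩ := hν.exists_hasEigenvector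
  have hHw := hw.apply_eq_smul
  obtain ⟨c, hc, -⟩ := h.tendsto w (mem_hyper_of_eigenvector (by linarith [h.pos]) hHw)
  refine hw.2 (eq_zero_of_tendsto_pow_smul (r := ν / μ) ((one_lt_div h.pos).2 hlt)
    (hc.congr fun m => ?_))
  rw [Module.End.pow_apply_of_eq_smul hHw, smul_smul, div_pow, div_eq_inv_mul]

/-- For an eigenvector w with eigenvalue μ the sequence μ^(-m) H^m w is constant, and its limit is a
multiple of (x, 1). -/
theorem eigenspace_eq (h : C.IsReturnFixed μ x) :
    Module.End.eigenspace C.returnLinearMap μ = Submodule.span ℝ {(x, (1 : ℝ))} := by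
  refine le_antisymm (fun w hw => ?_) ?_
  · have hHw := Module.End.mem_eigenspace_iff.1 hw
    obtain ⟨c, hc, -⟩ := h.tendsto w (mem_hyper_of_eigenvector h.pos.ne' hHw)
    refine Submodule.mem_span_singleton.2 ⟨c, tendsto_nhds_unique hc ?_⟩
    refine tendsto_const_nhds.congr fun m => ?_
    rw [Module.End.pow_apply_of_eq_smul hHw, inv_smul_smul₀ (pow_pos h.pos m).ne']
  · rw [Submodule.span_singleton_le_iff_mem]
    exact Module.End.mem_eigenspace_iff.2 h.apply_eq

end IsReturnFixed

end RegionCycle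

/-! ### Classification of cyclic attractors -/

theorem theorem5p12 {n k : ℕ} [NeZero k] (N : GlassNetwork n) (C : RegionCycle N k)
    (hC : C.IsCyclicAttractor) :
    -- the classification
    (C.IsIdeal → C.HasUniqueStablePeriodicOrbit) ∧
    (¬ C.IsIdeal → Xor C.HasUniqueStablePeriodicOrbit C.AllConvergeToSpine) ∧
    -- the cases can be determined
    (C.HasUniqueStablePeriodicOrbit ↔
      ∃ μ : ℝ, 1 < μ ∧ Module.End.HasEigenvalue C.returnLinearMap μ) ∧
    -- the periodic orbit can be calculated
    (∀ Γ, C.IsPeriodicOrbit Γ → ∃ (μ : ℝ) (x : Fin n → ℝ), 1 < μ ∧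
      Module.End.HasEigenvalue C.returnLinearMap μ ∧
      (∀ ν : ℝ, Module.End.HasEigenvalue C.returnLinearMap ν → ν ≤ μ) ∧
      Module.End.eigenspace C.returnLinearMap μ = Submodule.span ℝ {(x, (1 : ℝ))} ∧
      Γ ∩ C.wall (-1) = {x}) := by
  have hF := hC.isFocal
  rcases hF.perron_dichotomy with ⟨μ, x, h1, h2, h3, h4⟩ | ⟨hev, hconv⟩
  · have h : C.IsReturnFixed μ x := ⟨h1, h2, h3, h4⟩
    have hU := h.hasUniqueStablePeriodicOrbit hF
    refine ⟨fun _ => hU, fun _ => Or.inl ⟨hU, fun hA =>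
      RegionCycle.not_isPeriodicOrbit_of_allConvergeToSpine hA _ (h.isPeriodicOrbit hF)⟩,
      ⟨fun _ => ⟨μ, h1, h.hasEigenvalue⟩, fun _ => hU⟩, fun Γ hΓ => ?_⟩
    refine ⟨μ, x, h1, h.hasEigenvalue, fun ν hν => h.le_of_hasEigenvalue hν, h.eigenspace_eq, ?_⟩
    rw [h.eq_orbit hF hΓ, h.orbit_inter_wall hF]
  · obtain ⟨hA, hI⟩ := hF.allConvergeToSpine hconv
    have hno := RegionCycle.not_isPeriodicOrbit_of_allConvergeToSpine hA
    have hU : ¬ C.HasUniqueStablePeriodicOrbit := fun ⟨Γ, hΓ, _⟩ => hno Γ hΓ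
    exact ⟨fun hI' => absurd hI' hI, fun _ => Or.inr ⟨hA, hU⟩,
      ⟨fun h => absurd h hU, fun ⟨ν, hν, hν'⟩ => absurd hν' (hev ν hν)⟩,
      fun Γ hΓ => absurd hΓ (hno Γ)⟩
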